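/- Let $g\ge 2$ and let $\Gamma_g=\langle a_1,b_1,\dots,a_g,b_g \mid [a_1,b_1]\cdots[a_g,b_g]=1\rangle$, where $[x,y]=xyx^{-1}y^{-1}$, be the fundamental group of a closed oriented surface of genus $g$. Let $G=\mathrm{PSL}(2,\mathbb{R})$ with its standard structure of a 3-dimensional Lie group. Let $\mathrm{Hom}_0(\Gamma_g,G)$ be the space of injective homomorphisms $\rho:\Gamma_g\to G$ with discrete image and $G/\rho(\Gamma_g)$ compact, with the topology of pointwise convergence (equivalently, the compact-open topology), on which $G$ acts by conjugation, $(h\cdot\rho)(\gamma)=h\rho(\gamma)h^{-1}$. An element $\gamma\in G$ is hyperbolic if $\inf_{z\in\mathbb{H}^2}d(z,\gamma z)$ is positive and attained. "Smooth manifold" means Hausdorff, second countable, without boundary. Then: 1. The differential of $R:G^{2g}\to G$, $R(A_1,B_1,\dots,A_g,B_g)=[A_1,B_1]\cdots[A_g,B_g]$, is surjective at every point $(A_1,B_1,\dots,A_g,B_g)$ for which $A_1,B_1$ are non-commuting hyperbolic elements. 2. $\mathrm{Hom}_0(\Gamma_g,G)$ is a smooth manifold of dimension $6g-3$ for which the map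 $\rho\mapsto(\rho(a_1),\rho(b_1),\dots,\rho(a_g),\rho(b_g))$ is a smooth embedding into $G^{2g}$. 3. With this structure, let $Z\subset\mathrm{Hom}_0(\Gamma_g,G)$ be the set of those $\rho$ for which the triple (attractive fixed point of $\rho(a_1)$, repelling fixed point of $\rho(a_1)$, attractive fixed point of $\rho(b_1)$) in $\partial\mathbb{H}^2=\mathbb{R}\cup\{\infty\}$ equals $(0,1,\infty)$ or $(1,0,\infty)$. Then $Z$ is a smooth embedded submanifold of dimension $6g-6$ (codimension 3); there is a smooth map $\psi:\mathrm{Hom}_0(\Gamma_g,G)\to G$ with $\psi(h\cdot\rho)=h\,\psi(\rho)$ for all $h\in G$ and $Z=\psi^{-1}(1)$; and $G\times Z\to\mathrm{Hom}_0(\Gamma_g,G)$, $(h,z)\mapsto h\cdot z$, is a diffeomorphism. 4. The orbit space $\mathrm{Hom}_0(\Gamma_g,G)/G$, with the quotient topology, carries a structure of smooth manifold of dimension $6g-6$ for which the projection $\mathrm{Hom}_0(\Gamma_g,G)\to\mathrm{Hom}_0(\Gamma_g,G)/G$ is a smooth submersion. It is the only smooth structure of dimension $6g-6$ with this property, and the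 restriction of the projection to $Z$ is a diffeomorphism $Z\to\mathrm{Hom}_0(\Gamma_g,G)/G$. -/

import Mathlib

open Set Filter Topology Manifold
open scoped ContDiff MatrixGroups

noncomputable section

/-! ### The Lie group `PSL(2, ℝ)` -/

/-- The group `PSL(2, ℝ) = SL(2, ℝ) / {± 1}`, with the quotient topology. -/
abbrev PSL2R : Type := PSL(2, ℝ)

namespace PSL2R

/-- The class in `PSL(2, ℝ)` of a matrix of determinant one. -/
def mk (A : SL(2, ℝ)) : PSL2R := QuotientGroup.mk A

theorem mk_mul (A B : SL(2, ℝ)) : mk (A * B) = mk A * mk B := rfl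

theorem mk_inv (A : SL(2, ℝ)) : mk A⁻¹ = (mk A)⁻¹ := rfl

theorem mk_surjective : Function.Surjective mk := QuotientGroup.mk_surjective

theorem continuous_mk : Continuous mk := continuous_quot_mk

theorem mem_center {A : SL(2, ℝ)} (h : A ∈ Subgroup.center SL(2, ℝ)) : A = 1 ∨ A = -1 := by
  obtain ⟨r, hr, hA⟩ := Matrix.SpecialLinearGroup.mem_center_iff.1 h
  have hr' : r ^ 2 = 1 := by simpa using hr
  rcases (by simpa using hr : r = 1 ∨ r = -1) with h | h
  · left; ext i j; rw [← hA]; simp [h]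
  · right; ext i j; rw [← hA]; fin_cases i <;> fin_cases j <;> simp [h]

theorem mk_neg (A : SL(2, ℝ)) : mk (-A) = mk A := by
  refine (QuotientGroup.eq (s := Subgroup.center SL(2, ℝ))).2 ?_
  refine Matrix.SpecialLinearGroup.mem_center_iff.2 ⟨-1, by simp, ?_⟩
  have : (-A)⁻¹ * A = -1 := by rw [inv_mul_eq_iff_eq_mul]; simp
  rw [this]
  ext i j
  fin_cases i <;> fin_cases j <;> simp

theorem eq_or_eq_neg_of_mk_eq {A B : SL(2, ℝ)} (h : mk A = mk B) : B = A ∨ B = -A := by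
  have h' := (QuotientGroup.eq (s := Subgroup.center SL(2, ℝ))).1 h
  rcases mem_center h' with h | h
  · left; rw [inv_mul_eq_iff_eq_mul] at h; simpa using h
  · right; rw [inv_mul_eq_iff_eq_mul] at h; simpa using h

/-- The products `A i j * A k l` of two matrix entries are well defined on `PSL(2, ℝ)`. -/
def quad (i j k l : Fin 2) (x : PSL2R) : ℝ :=
  Quotient.lift (fun A : SL(2, ℝ) => A i j * A k l)
    (fun A B h => by
      rcases eq_or_eq_neg_of_mk_eq (Quotient.sound h) with h | h <;> simp [h]) x

@[simp] theorem quad_mk (i j k l : Fin 2) (A : SL(2, ℝ)) :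
    quad i j k l (mk A) = A i j * A k l := rfl

theorem continuous_quad (i j k l : Fin 2) : Continuous (quad i j k l) := by
  refine Continuous.quotient_lift ?_ _
  have h : ∀ i j : Fin 2, Continuous fun A : SL(2, ℝ) => A i j := fun i j =>
    (continuous_induced_dom (f := fun A : SL(2, ℝ) => (A : Matrix (Fin 2) (Fin 2) ℝ))).matrix_elem
      i j
  exact (h i j).mul (h k l)

theorem quad_mul (i j k l : Fin 2) (x y : PSL2R) :
    quad i j k l (x * y) = ∑ m, ∑ n, quad i m k n x * quad m j n l y := by
  obtain ⟨A, rfl⟩ := mk_surjective x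
  obtain ⟨B, rfl⟩ := mk_surjective y
  rw [← mk_mul]
  simp only [quad_mk, Matrix.SpecialLinearGroup.coe_mul, Matrix.mul_apply, Fin.sum_univ_two]
  ring

theorem quad_inv (i j k l : Fin 2) (x : PSL2R) :
    quad i j k l x⁻¹ =
      (-1) ^ ((i : ℕ) + j + k + l) * quad (1 - j) (1 - i) (1 - l) (1 - k) x := by
  obtain ⟨A, rfl⟩ := mk_surjective x
  rw [← mk_inv]
  simp only [quad_mk, Matrix.SpecialLinearGroup.coe_inv, Matrix.adjugate_fin_two]
  fin_cases i <;> fin_cases j <;> fin_cases k <;> fin_cases l <;> simp <;> norm_num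

theorem exists_rep_pos {x : PSL2R} (hx : 0 < quad 0 0 0 0 x) :
    ∃ A : SL(2, ℝ), mk A = x ∧ 0 < A 0 0 := by
  obtain ⟨A, rfl⟩ := mk_surjective x
  have hx' : 0 < A 0 0 * A 0 0 := hx
  have h0 : A 0 0 ≠ 0 := by rintro h; simp [h] at hx'
  rcases lt_or_gt_of_ne h0 with h | h
  · exact ⟨-A, mk_neg A, by simpa using h⟩
  · exact ⟨A, rfl, h⟩

/-- The entries of the matrix with first row `(√p, q / √p)`, lower left entry `r / √p` and
determinant one. -/
def sectionMatrix (v : EuclideanSpace ℝ (Fin 3)) : Matrix (Fin 2) (Fin 2) ℝ :=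
  !![√(v 0), v 1 / √(v 0); v 2 / √(v 0), (1 + v 1 * v 2 / v 0) / √(v 0)]

theorem det_sectionMatrix {v : EuclideanSpace ℝ (Fin 3)} (h : 0 < v 0) :
    (sectionMatrix v).det = 1 := by
  have h1 : √(v 0) ≠ 0 := (Real.sqrt_pos.2 h).ne'
  have h2 : √(v 0) ^ 2 = v 0 := Real.sq_sqrt h.le
  rw [sectionMatrix, Matrix.det_fin_two_of]
  field_simp
  rw [h2]
  field_simp
  ring

open Classical in
/-- The inverse of the chart below. -/
def chartInv (v : EuclideanSpace ℝ (Fin 3)) : PSL2R :=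
  if h : 0 < v 0 then mk ⟨sectionMatrix v, det_sectionMatrix h⟩ else 1

theorem chartInv_eq {v : EuclideanSpace ℝ (Fin 3)} (h : 0 < v 0) :
    chartInv v = mk ⟨sectionMatrix v, det_sectionMatrix h⟩ := dif_pos h

theorem quad_chartInv {v : EuclideanSpace ℝ (Fin 3)} (h : 0 < v 0) (i j k l : Fin 2) :
    quad i j k l (chartInv v) = sectionMatrix v i j * sectionMatrix v k l := by
  rw [chartInv_eq h]; rfl

theorem contDiffOn_sectionMatrix (i j : Fin 2) :
    ContDiffOn ℝ ∞ (fun v => sectionMatrix v i j) {v | 0 < v 0} := by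
  have hp : ∀ k : Fin 3, ContDiff ℝ ∞ fun v : EuclideanSpace ℝ (Fin 3) => v k := fun k =>
    contDiff_euclidean.1 contDiff_id k
  have hs : ContDiffOn ℝ ∞ (fun v : EuclideanSpace ℝ (Fin 3) => √(v 0)) {v | 0 < v 0} :=
    (hp 0).contDiffOn.sqrt fun v hv => (show 0 < v 0 from hv).ne'
  have hs0 : ∀ v ∈ {v : EuclideanSpace ℝ (Fin 3) | 0 < v 0}, √(v 0) ≠ 0 := fun v hv =>
    (Real.sqrt_pos.2 hv).ne'
  have h0 : ∀ v ∈ {v : EuclideanSpace ℝ (Fin 3) | 0 < v 0}, v 0 ≠ 0 := fun v hv =>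
    (show 0 < v 0 from hv).ne'
  fin_cases i <;> fin_cases j
  · exact hs
  · exact (hp 1).contDiffOn.div hs hs0
  · exact (hp 2).contDiffOn.div hs hs0
  · exact (contDiffOn_const.add (((hp 1).contDiffOn.mul (hp 2).contDiffOn).div
      (hp 0).contDiffOn h0)).div hs hs0

theorem continuousOn_chartInv : ContinuousOn chartInv {v | 0 < v 0} := by
  rw [continuousOn_iff_continuous_domRestrict]
  have : ({v : EuclideanSpace ℝ (Fin 3) | 0 < v 0}).domRestrict chartInv =
      fun v => mk ⟨sectionMatrix v.1, det_sectionMatrix v.2⟩ := by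
    ext v; exact chartInv_eq v.2
  rw [this]
  refine continuous_mk.comp (continuous_induced_rng.2 ?_)
  refine continuous_matrix fun i j => ?_
  exact continuousOn_iff_continuous_domRestrict.1 (contDiffOn_sectionMatrix i j).continuousOn

/-- The chart `± (a b; c d) ↦ (a ^ 2, a * b, a * c)` of `PSL(2, ℝ)` on the open set `a ≠ 0`; its
image is the half space where the first coordinate is positive. -/
def baseChart : OpenPartialHomeomorph PSL2R (EuclideanSpace ℝ (Fin 3)) where
  toFun x := !₂[quad 0 0 0 0 x, quad 0 0 0 1 x, quad 0 0 1 0 x]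
  invFun := chartInv
  source := {x | 0 < quad 0 0 0 0 x}
  target := {v | 0 < v 0}
  map_source' x hx := by simpa using hx
  map_target' v hv := by
    have hv' : 0 < v 0 := hv
    simp [quad_chartInv hv', sectionMatrix, hv']
  left_inv' x hx := by
    obtain ⟨A, rfl, hA⟩ := exists_rep_pos hx
    have hdet : A 0 0 * A 1 1 - A 0 1 * A 1 0 = 1 := by
      rw [← Matrix.det_fin_two]; exact A.2
    have hs : √(A 0 0 * A 0 0) = A 0 0 := Real.sqrt_mul_self hA.le
    rw [chartInv_eq (by simpa using hA.ne')]
    congr 1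
    ext i j
    have h11 : (1 + A 0 1 * A 1 0) / A 0 0 = A 1 1 := by
      rw [div_eq_iff hA.ne']; linarith
    fin_cases i <;> fin_cases j <;> simp [sectionMatrix, hs]
    · field_simp
    · field_simp
    · rw [← h11]; field_simp
  right_inv' v hv := by
    have hv' : 0 < v 0 := hv
    have h1 : √(v 0) ≠ 0 := (Real.sqrt_pos.2 hv').ne'
    ext i
    fin_cases i <;> simp [quad_chartInv hv', sectionMatrix, hv'.le] <;> field_simp
  open_source := isOpen_lt continuous_const (continuous_quad 0 0 0 0)
  open_target := isOpen_lt continuous_const (PiLp.continuous_apply 2 _ 0)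
  continuousOn_toFun := by
    refine Continuous.continuousOn ?_
    refine (PiLp.continuous_toLp 2 _).comp (continuous_pi fun i => ?_)
    fin_cases i
    exacts [continuous_quad _ _ _ _, continuous_quad _ _ _ _, continuous_quad _ _ _ _]
  continuousOn_invFun := continuousOn_chartInv

/-- The left translate of the chart by `w`. -/
def translatedChart (w : PSL2R) : OpenPartialHomeomorph PSL2R (EuclideanSpace ℝ (Fin 3)) :=
  (Homeomorph.mulLeft w⁻¹).transOpenPartialHomeomorph baseChart

/-- `PSL(2, ℝ)` as a three-dimensional manifold: the atlas consists of all left translates of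
the chart around the identity. -/
instance instChartedSpace : ChartedSpace (EuclideanSpace ℝ (Fin 3)) PSL2R where
  atlas := Set.range translatedChart
  chartAt := translatedChart
  mem_chart_source x := by
    change 0 < quad 0 0 0 0 (x⁻¹ * x)
    rw [inv_mul_cancel]
    change (0 : ℝ) < (1 : SL(2, ℝ)) 0 0 * (1 : SL(2, ℝ)) 0 0
    simp
  chart_mem_atlas x := ⟨x, rfl⟩

theorem contDiffOn_quad_chartInv (i j k l : Fin 2) :
    ContDiffOn ℝ ∞ (fun v => quad i j k l (chartInv v)) {v | 0 < v 0} :=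
  ((contDiffOn_sectionMatrix i j).mul (contDiffOn_sectionMatrix k l)).congr fun _ hv =>
    quad_chartInv hv i j k l

theorem contDiffOn_quad_mul {E : Type*} [NormedAddCommGroup E] [NormedSpace ℝ E] {s : Set E}
    {f : E → PSL2R} (hf : ∀ i j k l, ContDiffOn ℝ ∞ (fun v => quad i j k l (f v)) s) (w : PSL2R)
    (i j k l : Fin 2) : ContDiffOn ℝ ∞ (fun v => quad i j k l (w * f v)) s := by
  simp only [quad_mul]
  exact ContDiffOn.sum fun m _ => ContDiffOn.sum fun n _ => contDiffOn_const.mul (hf _ _ _ _)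

instance instIsManifold : IsManifold (𝓡 3) ∞ PSL2R := by
  refine isManifold_of_contDiffOn _ _ _ ?_
  rintro _ _ ⟨w, rfl⟩ ⟨w', rfl⟩
  have key := fun i j k l => contDiffOn_quad_mul
    (contDiffOn_quad_mul contDiffOn_quad_chartInv w⁻¹⁻¹) w'⁻¹ i j k l
  have hsub : (𝓡 3).symm ⁻¹' ((translatedChart w).symm ≫ₕ translatedChart w').source ∩
      Set.range (𝓡 3) ⊆ {v : EuclideanSpace ℝ (Fin 3) | 0 < v 0} := fun v hv => hv.1.1
  refine ContDiffOn.mono ?_ hsub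
  refine contDiffOn_euclidean.2 fun i => ?_
  fin_cases i
  exacts [key 0 0 0 0, key 0 0 0 1, key 0 0 1 0]

/-- A map into `PSL(2, ℝ)` is smooth as soon as it is smooth in the functions `quad`. -/
theorem contMDiff_of_quad {E H M : Type*} [NormedAddCommGroup E] [NormedSpace ℝ E]
    [TopologicalSpace H] {I : ModelWithCorners ℝ E H} [TopologicalSpace M] [ChartedSpace H M]
    {f : M → PSL2R} (hc : Continuous f)
    (hf : ∀ i j k l, ContMDiff I 𝓘(ℝ) ∞ fun m => quad i j k l (f m)) :
    ContMDiff I (𝓡 3) ∞ f := by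
  intro m
  rw [contMDiffAt_iff_target]
  refine ⟨hc.continuousAt, ?_⟩
  have key : ∀ i j k l, ContMDiff I 𝓘(ℝ) ∞ fun x => quad i j k l ((f m)⁻¹ * f x) := by
    intro i j k l
    simp only [quad_mul]
    exact contMDiff_finsetSum fun m _ => contMDiff_finsetSum fun n _ =>
      contMDiff_const.mul (hf _ _ _ _)
  have h : ContMDiff I 𝓘(ℝ, Fin 3 → ℝ) ∞ fun x =>
      ![quad 0 0 0 0 ((f m)⁻¹ * f x), quad 0 0 0 1 ((f m)⁻¹ * f x),
        quad 0 0 1 0 ((f m)⁻¹ * f x)] := by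
    refine contMDiff_pi_space.2 fun i => ?_
    fin_cases i
    exacts [key 0 0 0 0, key 0 0 0 1, key 0 0 1 0]
  exact ((EuclideanSpace.equiv (Fin 3) ℝ).symm.contDiff.contMDiff.comp h) m

theorem contMDiff_quad (i j k l : Fin 2) : ContMDiff (𝓡 3) 𝓘(ℝ) ∞ (quad i j k l) := by
  rw [contMDiff_iff]
  refine ⟨continuous_quad i j k l, fun x y => ?_⟩
  refine ((contDiffOn_quad_mul contDiffOn_quad_chartInv x⁻¹⁻¹) i j k l).mono ?_
  intro v hv
  exact hv.1.2

instance instLieGroup : LieGroup (𝓡 3) ∞ PSL2R where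
  contMDiff_mul := by
    refine contMDiff_of_quad continuous_mul fun i j k l => ?_
    simp only [quad_mul]
    exact contMDiff_finsetSum fun m _ => contMDiff_finsetSum fun n _ =>
      ((contMDiff_quad _ _ _ _).comp contMDiff_fst).mul
        ((contMDiff_quad _ _ _ _).comp contMDiff_snd)
  contMDiff_inv := by
    refine contMDiff_of_quad continuous_inv fun i j k l => ?_
    simp only [quad_inv]
    exact contMDiff_const.mul (contMDiff_quad _ _ _ _)

end PSL2R

namespace PSL2R

theorem center_le_ker :
    Subgroup.center SL(2, ℝ) ≤ (MulAction.toPermHom SL(2, ℝ) UpperHalfPlane).ker := by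
  intro A hA
  ext z
  rcases mem_center hA with rfl | rfl
  · simp
  · simp only [MulAction.toPermHom_apply, MulAction.toPerm_apply, Equiv.Perm.coe_one, id_eq]
    rw [UpperHalfPlane.specialLinearGroup_apply]
    simp

/-- The action of `PSL(2, ℝ)` on the upper half plane by Möbius transformations. -/
instance instMulActionUpperHalfPlane : MulAction PSL2R UpperHalfPlane :=
  MulAction.compHom UpperHalfPlane
    (QuotientGroup.lift (Subgroup.center SL(2, ℝ)) (MulAction.toPermHom SL(2, ℝ) UpperHalfPlane)
      center_le_ker)

theorem mk_smul (A : SL(2, ℝ)) (z : UpperHalfPlane) : mk A • z = A • z := rfl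

/-- The translation length `inf_z d(z, γ z)` for the hyperbolic distance. -/
def translationLength (γ : PSL2R) : ℝ := ⨅ z : UpperHalfPlane, dist z (γ • z)

/-- `γ` is hyperbolic if its translation length is positive and attained. -/
def IsHyperbolic (γ : PSL2R) : Prop :=
  0 < translationLength γ ∧ ∃ z : UpperHalfPlane, dist z (γ • z) = translationLength γ

/-- The boundary point `x ∈ ℝ ∪ {∞}` is the attractive fixed point of `γ`: `γ ^ n z → x` as
`n → ∞`, for all `z` in the upper half plane. The limit is taken in the Riemann sphere
`ℂ ∪ {∞}`. The repelling fixed point of `γ` is the attractive fixed point of `γ⁻¹`. -/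
def IsAttractiveFixedPoint (γ : PSL2R) (x : OnePoint ℝ) : Prop :=
  ∀ z : UpperHalfPlane, Tendsto (fun n : ℕ => (((γ ^ n • z : UpperHalfPlane) : ℂ) : OnePoint ℂ))
    atTop (𝓝 (OnePoint.map (fun t : ℝ => (t : ℂ)) x))

end PSL2R

/-! ### Discrete, faithful, cocompact representations -/

section Representations

theorem conj_mem_range_iff {Γ G : Type*} [Group Γ] [Group G] (h : G) (ρ : Γ →* G) (x : G) :
    x ∈ ((MulAut.conj h).toMonoidHom.comp ρ).range ↔ h⁻¹ * x * h ∈ ρ.range := by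
  constructor
  · rintro ⟨γ, rfl⟩
    exact ⟨γ, by simp [mul_assoc]⟩
  · rintro ⟨γ, hγ⟩
    exact ⟨γ, by simp [hγ, mul_assoc]⟩

variable (Γ G : Type*) [Group Γ] [Group G] [TopologicalSpace G]

/-- The space `Hom₀(Γ, G)` of injective homomorphisms `ρ : Γ → G` with discrete image such that
`G / ρ(Γ)` is compact. -/
def Hom₀ : Type _ :=
  {ρ : Γ →* G // Function.Injective ρ ∧ DiscreteTopology ρ.range ∧ CompactSpace (G ⧸ ρ.range)}

variable {Γ G}

instance : CoeFun (Hom₀ Γ G) fun _ => Γ → G := ⟨fun ρ => ρ.1⟩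

/-- The topology of pointwise convergence, i.e. the compact-open topology for discrete `Γ`. -/
instance : TopologicalSpace (Hom₀ Γ G) :=
  TopologicalSpace.induced (fun ρ γ => ρ γ) Pi.topologicalSpace

theorem discreteTopology_conj_range [IsTopologicalGroup G] (h : G) (ρ : Γ →* G)
    [DiscreteTopology ρ.range] :
    DiscreteTopology ((MulAut.conj h).toMonoidHom.comp ρ).range := by
  refine DiscreteTopology.of_continuous_injective (β := ρ.range)
    (f := fun x => ⟨h⁻¹ * x.1 * h, (conj_mem_range_iff h ρ x.1).1 x.2⟩) ?_ ?_
  · exact ((continuous_const.mul continuous_subtype_val).mul continuous_const).subtype_mk _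
  · intro x y hxy
    simpa [Subtype.ext_iff] using hxy

theorem compactSpace_conj_range [IsTopologicalGroup G] (h : G) (ρ : Γ →* G)
    [CompactSpace (G ⧸ ρ.range)] :
    CompactSpace (G ⧸ ((MulAut.conj h).toMonoidHom.comp ρ).range) := by
  let f : G ⧸ ρ.range → G ⧸ ((MulAut.conj h).toMonoidHom.comp ρ).range :=
    Quotient.map' (fun x => h * x * h⁻¹) fun x y hxy => by
      rw [QuotientGroup.leftRel_apply] at hxy ⊢
      rw [conj_mem_range_iff]
      convert hxy using 1
      group
  have hf : Continuous f :=
    Continuous.quotient_map' ((continuous_const.mul continuous_id).mul continuous_const) _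
  have hs : Function.Surjective f := by
    intro y
    obtain ⟨y, rfl⟩ := QuotientGroup.mk_surjective y
    refine ⟨QuotientGroup.mk (h⁻¹ * y * h), ?_⟩
    change QuotientGroup.mk (h * (h⁻¹ * y * h) * h⁻¹) = _
    congr 1
    group
  exact hs.compactSpace hf

/-- Conjugation of representations: `(h • ρ) γ = h ρ(γ) h⁻¹`. -/
instance [IsTopologicalGroup G] : MulAction G (Hom₀ Γ G) where
  smul h ρ := ⟨(MulAut.conj h).toMonoidHom.comp ρ.1,
    (MulAut.conj h).injective.comp ρ.2.1,
    haveI := ρ.2.2.1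
    discreteTopology_conj_range h ρ.1,
    haveI := ρ.2.2.2
    compactSpace_conj_range h ρ.1⟩
  one_smul ρ := by
    apply Subtype.ext; ext γ
    change 1 * ρ γ * 1⁻¹ = ρ γ
    simp
  mul_smul h h' ρ := by
    apply Subtype.ext; ext γ
    change h * h' * ρ γ * (h * h')⁻¹ = h * (h' * ρ γ * h'⁻¹) * h⁻¹
    group

theorem Hom₀.smul_apply [IsTopologicalGroup G] (h : G) (ρ : Hom₀ Γ G) (γ : Γ) : (h • ρ) γ = h * ρ γ * h⁻¹ := rfl

variable (Γ G) in
/-- The orbit space `Hom₀(Γ, G) / G` of the conjugation action, with the quotient topology. -/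
abbrev Hom₀Quotient [IsTopologicalGroup G] : Type _ := MulAction.orbitRel.Quotient G (Hom₀ Γ G)

end Representations

/-! ### Surface groups -/

/-- The index of the first pair of generators. -/
abbrev firstIndex {g : ℕ} (hg : 2 ≤ g) : Fin g := ⟨0, by omega⟩

/-- The product of commutators `[x₁, y₁] ⋯ [x_g, y_g]`, where `[x, y] = x y x⁻¹ y⁻¹`, of a tuple
`(x₁, …, x_g, y₁, …, y_g)` in a group. -/
def commutatorProduct {G : Type*} [Group G] (g : ℕ) (p : Fin g ⊕ Fin g → G) : G :=
  (List.ofFn fun i : Fin g => p (Sum.inl i) * p (Sum.inr i) * (p (Sum.inl i))⁻¹ * (p (Sum.inr i))⁻¹).prod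

/-- The fundamental group of the closed oriented surface of genus `g`, with generators
`a₁, …, a_g` (`Sum.inl`) and `b₁, …, b_g` (`Sum.inr`) and the relation
`[a₁, b₁] ⋯ [a_g, b_g] = 1`. -/
abbrev SurfaceGroup (g : ℕ) : Type :=
  PresentedGroup {commutatorProduct g (FreeGroup.of : Fin g ⊕ Fin g → FreeGroup _)}

/-- The inclusion `Hom₀(Γ_g, PSL(2, ℝ)) → PSL(2, ℝ) ^ (2g)` sending `ρ` to the images of the
generators. -/
def evalGenerators (g : ℕ) (ρ : Hom₀ (SurfaceGroup g) PSL2R) : Fin g ⊕ Fin g → PSL2R :=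
  fun s => ρ (PresentedGroup.of s)

/-- `x` and `y` are the attractive and the repelling fixed point of `ρ(a₁)`, and `z` is the
attractive fixed point of `ρ(b₁)`. -/
def HasFixedTriple {g : ℕ} (hg : 2 ≤ g) (ρ : Hom₀ (SurfaceGroup g) PSL2R)
    (x y z : OnePoint ℝ) : Prop :=
  PSL2R.IsAttractiveFixedPoint (ρ (PresentedGroup.of (Sum.inl (firstIndex hg)))) x ∧
  PSL2R.IsAttractiveFixedPoint (ρ (PresentedGroup.of (Sum.inl (firstIndex hg))))⁻¹ y ∧
  PSL2R.IsAttractiveFixedPoint (ρ (PresentedGroup.of (Sum.inr (firstIndex hg)))) z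

/-- The representations for which the triple of fixed points is one of the two base triples
`(0, 1, ∞)` and `(1, 0, ∞)`, which represent the two orbits of `PSL(2, ℝ)` on ordered triples of
distinct boundary points. -/
def fixedPointSlice {g : ℕ} (hg : 2 ≤ g) : Set (Hom₀ (SurfaceGroup g) PSL2R) :=
  {ρ | HasFixedTriple hg ρ ((0 : ℝ) : OnePoint ℝ) ((1 : ℝ) : OnePoint ℝ) OnePoint.infty ∨
    HasFixedTriple hg ρ ((1 : ℝ) : OnePoint ℝ) ((0 : ℝ) : OnePoint ℝ) OnePoint.infty}

/-! ### Smooth manifolds -/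

/-- A Hausdorff, second countable smooth manifold (without boundary) of dimension `d`. -/
structure IsSmoothManifold (d : ℕ) (M : Type*) [TopologicalSpace M]
    [ChartedSpace (EuclideanSpace ℝ (Fin d)) M] : Prop where
  t2 : T2Space M
  secondCountable : SecondCountableTopology M
  isManifold : IsManifold (𝓡 d) ∞ M

/-- Two manifold structures on `M` are the same if they have the same maximal smooth atlas. -/
def SameSmoothStructure {d : ℕ} {M : Type*} [TopologicalSpace M]
    (c c' : ChartedSpace (EuclideanSpace ℝ (Fin d)) M) : Prop :=
  @IsManifold.maximalAtlas ℝ _ _ _ _ _ _ (𝓡 d) ∞ M _ c =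
    @IsManifold.maximalAtlas ℝ _ _ _ _ _ _ (𝓡 d) ∞ M _ c'

end

/-!
# Representations of surface groups in `PSL(2, ℝ)`

Write `R` for the product of commutators on `PSL(2, ℝ) ^ (2g)` and `Hom₀` for the space of discrete,
faithful, cocompact representations of the surface group.

*The differential of `R`.* A covector vanishing on the range of the differential of `R` at a point
with first entries `A`, `B` is a quadratic form on the plane. Multiplying `A` or `B` by
transvections shows that a translate of this form is invariant under `A` and under `B`. The matrices
preserving a given nonzero form commute, so that the covector vanishes if `A` and `B` do not commute
(`surjective_mfderiv_commutatorProduct`).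

*`Hom₀` is a manifold.* It is embedded in the fibre `R⁻¹(1)` by evaluation on the generators, and
its image is open there by a theorem of Weil: homomorphisms near a discrete, faithful, cocompact one
have these properties as well (`eventually_hom₀_property`). The proof is geometric. Cocompactness
means that the orbit of `i` is `D`-dense for some `D`. A nearby homomorphism changes the images of
`i` under the finitely many elements which move `i` by a bounded distance only slightly. Hence the
neighbourhood of radius `D + 1` of the new orbit is open and closed, and the new orbit is dense as
well (`hasDenseOrbit_of_close`). For a group element `γ` and the given representation `ρ₀`, the path
from `i` to `ρ₀(γ)i` is cut into long steps approximated by orbit points; the elements leading from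
one of these to the next lie in a finite set, so the new homomorphism turns the steps into a local
quasigeodesic. Hyperbolicity of the plane (`UpperHalfPlane.dist_add_dist_le_max`,
`le_dist_of_local_quasigeodesic`) then bounds the displacement of `i` from below
(`dist_orbit_le_of_close`), which yields injectivity and discreteness. Since `a₁` and `b₁` do not
commute, `R` is a submersion along `Hom₀`, and the fibre is a manifold there by the inverse function
theorem (`exists_chartedSpace_of_isSubmersionAt`).

*The slice.* In a discrete cocompact group elements of infinite order are hyperbolic
(`Hom₀.exists_rep_two_lt_trace`), and the attractive fixed point of `ρ(b₁)` differs from both fixed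
points of `ρ(a₁)`: otherwise the conjugates of `ρ(b₁)` by powers of `ρ(a₁)` would stay bounded,
hence repeat, and a power of `a₁` would commute with `b₁` (`exists_commute_pow`). The fixed points
are given by eigenvectors, which depend smoothly on `ρ`. There is exactly one element of `PSL(2, ℝ)`
which moves one of the triples `(0, 1, ∞)`, `(1, 0, ∞)` to the three fixed points. This element, as
a function of `ρ`, is the equivariant map `sliceMap`, and the slice is its fibre over `1`.

*The orbit space.* By equivariance `sliceMap` is a submersion with sections given by the orbits. So
the slice is a manifold and `ρ ↦ (sliceMap ρ, (sliceMap ρ)⁻¹ • ρ)` inverts `(h, z) ↦ h • z`. The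
orbit space embeds in `Hom₀` through `ρ ↦ (sliceMap ρ)⁻¹ • ρ` with the slice as image, which makes
it a manifold diffeomorphic to the slice. The projection is a submersion because it has smooth
sections through all points, and the smooth structure is unique because smoothness of maps out of
the target of a surjective submersion can be tested upstairs
(`sameSmoothStructure_of_isSubmersion`).
-/

/-! ### Submersions from surjective differentials -/

section Submersion

variable {E E' F H H' M N : Type*}
  [NormedAddCommGroup E] [NormedSpace ℝ E] [NormedAddCommGroup E'] [NormedSpace ℝ E']
  [NormedAddCommGroup F] [NormedSpace ℝ F]
  [TopologicalSpace H] [TopologicalSpace H'] {I : ModelWithCorners ℝ E H}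
  {J : ModelWithCorners ℝ E' H'} [TopologicalSpace M] [ChartedSpace H M]
  [TopologicalSpace N] [ChartedSpace H' N]

/-- A surjective linear map between finite-dimensional spaces becomes the first projection after
splitting off its kernel. -/
theorem exists_continuousLinearEquiv_fst_eq [FiniteDimensional ℝ E] [FiniteDimensional ℝ E']
    [FiniteDimensional ℝ F]
    (hd : Module.finrank ℝ E = Module.finrank ℝ E' + Module.finrank ℝ F)
    (L : E →L[ℝ] E') (hL : Function.Surjective L) :
    ∃ e : E ≃L[ℝ] E' × F, ∀ v, (e v).1 = L v := by
  obtain ⟨s, hs⟩ := L.toLinearMap.exists_rightInverse_of_surjective (LinearMap.range_eq_top.2 hL)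
  have hs' : ∀ w, L (s w) = w := fun w => LinearMap.congr_fun hs w
  have hr : Module.finrank ℝ (LinearMap.ker L.toLinearMap) = Module.finrank ℝ F := by
    have h1 := L.toLinearMap.finrank_range_add_finrank_ker
    rw [LinearMap.range_eq_top.2 hL, finrank_top] at h1
    omega
  let κ : LinearMap.ker L.toLinearMap ≃ₗ[ℝ] F := LinearEquiv.ofFinrankEq _ _ hr
  let p : E →ₗ[ℝ] LinearMap.ker L.toLinearMap :=
    LinearMap.codRestrict _ (LinearMap.id - s ∘ₗ L.toLinearMap) (fun v => by simp [hs'])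
  have hp : ∀ v, (p v : E) = v - s (L v) := fun v => rfl
  let e : E ≃ₗ[ℝ] E' × F :=
    { toLinearMap := L.toLinearMap.prod (κ.toLinearMap ∘ₗ p)
      invFun := fun w => s w.1 + (κ.symm w.2 : E)
      left_inv := fun v => by simp [hp]
      right_inv := fun w => by
        have hk : L (κ.symm w.2 : E) = 0 := (κ.symm w.2).2
        have : p (s w.1 + (κ.symm w.2 : E)) = κ.symm w.2 := by
          apply Subtype.ext
          simp [hp, hs', hk]
        apply Prod.ext
        · simp [hs', hk]
        · simp [this] }
  exact ⟨e.toContinuousLinearEquiv, fun v => rfl⟩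

/-- A smooth map between finite-dimensional manifolds without boundary whose differential is onto
at a point is a submersion there, by the inverse function theorem. -/
theorem isSubmersionAtOfComplement_of_surjective [FiniteDimensional ℝ E] [FiniteDimensional ℝ E']
    [FiniteDimensional ℝ F] [I.Boundaryless] [J.Boundaryless] [IsManifold I ∞ M]
    [IsManifold J ∞ N]
    (hd : Module.finrank ℝ E = Module.finrank ℝ E' + Module.finrank ℝ F)
    {R : M → N} (hR : ContMDiff I J ∞ R) {p : M} (hs : Function.Surjective (mfderiv I J R p)) :
    IsSubmersionAtOfComplement F I J ∞ R p := by
  set X := extChartAt I p with hX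
  set Y := extChartAt J (R p) with hY
  set f : E → E' := Y ∘ R ∘ X.symm with hf
  have hmd : MDifferentiableAt I J R p := (hR p).mdifferentiableAt (by simp)
  have hL : Function.Surjective (fderiv ℝ f (X p)) := by
    have : mfderiv I J R p = fderiv ℝ f (X p) := by
      refine hmd.mfderiv.trans ?_
      rw [I.range_eq_univ, fderivWithin_univ]
      rfl
    rwa [this] at hs
  obtain ⟨e, he⟩ := exists_continuousLinearEquiv_fst_eq (F := F) hd _ hL
  set U : Set E := X.target ∩ X.symm ⁻¹' (R ⁻¹' Y.source) with hU
  have hUo : IsOpen U :=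
    (continuousOn_extChartAt_symm p).isOpen_inter_preimage (isOpen_extChartAt_target p)
      ((isOpen_extChartAt_source _).preimage hR.continuous)
  have hpU : X p ∈ U := by
    refine ⟨mem_extChartAt_target p, ?_⟩
    change R (X.symm (X p)) ∈ Y.source
    rw [X.left_inv (mem_extChartAt_source p)]
    exact mem_extChartAt_source _
  have hfU : ContDiffOn ℝ ∞ f U := by
    rw [← contMDiffOn_iff_contDiffOn]
    have h1 : ContMDiffOn J 𝓘(ℝ, E') ∞ Y Y.source := by
      rw [hY, extChartAt_source]
      exact contMDiffOn_extChartAt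
    have h2 : ContMDiffOn 𝓘(ℝ, E) I ∞ X.symm X.target := contMDiffOn_extChartAt_symm p
    exact h1.comp (hR.comp_contMDiffOn (h2.mono inter_subset_left)) fun v hv => hv.2
  let S : E → E' × F := fun v => (f v, (e v).2)
  have hSU : ContDiffOn ℝ ∞ S U := hfU.prodMk (contDiff_snd.comp e.contDiff).contDiffOn
  have hSat : ∀ v ∈ U, ContDiffAt ℝ ∞ S v := fun v hv => hSU.contDiffAt (hUo.mem_nhds hv)
  have hS' : HasFDerivAt S (e : E →L[ℝ] E' × F) (X p) := by
    have h1 : HasFDerivAt f (fderiv ℝ f (X p)) (X p) :=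
      ((hfU.contDiffAt (hUo.mem_nhds hpU)).differentiableAt (by simp)).hasFDerivAt
    have h2 : HasFDerivAt (fun v => (e v).2)
        ((ContinuousLinearMap.snd ℝ E' F).comp (e : E →L[ℝ] E' × F)) (X p) :=
      ((ContinuousLinearMap.snd ℝ E' F).comp (e : E →L[ℝ] E' × F)).hasFDerivAt
    refine (h1.prodMk h2).congr_fderiv ?_
    ext v
    · simp [he]
    · simp
  let σ := (hSat _ hpU).toOpenPartialHomeomorph S hS' (by simp)
  have hσ : ∀ v, σ v = S v := fun v => rfl
  have hσp : X p ∈ σ.source := (hSat _ hpU).mem_toOpenPartialHomeomorph_source hS' (by simp)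
  -- restrict to the points where the differential stays invertible
  set V : Set E := U ∩ fderiv ℝ S ⁻¹' range ((↑) : (E ≃L[ℝ] E' × F) → E →L[ℝ] E' × F) with hV
  have hVo : IsOpen V :=
    (hSU.continuousOn_fderiv_of_isOpen hUo (by simp)).isOpen_inter_preimage hUo
      (ContinuousLinearEquiv.isOpen)
  have hpV : X p ∈ V := ⟨hpU, e, hS'.fderiv.symm⟩
  let τ := σ.restrOpen V hVo
  have hτs : τ.source = σ.source ∩ V := rfl
  have hτ : ∀ v, τ v = S v := fun v => rfl
  have hτsymm : ContDiffOn ℝ ∞ τ.symm τ.target := by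
    intro w hw
    have hv : τ.symm w ∈ σ.source ∩ V := τ.map_target hw
    obtain ⟨e', he'⟩ := hv.2.2
    have hd' : HasFDerivAt τ (e' : E →L[ℝ] E' × F) (τ.symm w) := by
      rw [he']
      exact ((hSat _ hv.2.1).differentiableAt (by simp)).hasFDerivAt
    exact (τ.contDiffAt_symm hw hd' (hSat _ hv.2.1)).contDiffWithinAt
  let A : OpenPartialHomeomorph M E :=
    (chartAt H p) ≫ₕ I.toHomeomorph.toOpenPartialHomeomorph
  have hA : ∀ q, A q = X q := fun q => rfl
  have hAs : ∀ v, A.symm v = X.symm v := fun v => rfl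
  have hAsrc : A.source = (chartAt H p).source := by simp [A]
  have hAX : A.source = X.source := by rw [hAsrc, hX, extChartAt_source]
  have hAt : A.target = X.target := by
    simp [A, hX, I.range_eq_univ]; rfl
  let T : OpenPartialHomeomorph E H :=
    e.symm.toHomeomorph.toOpenPartialHomeomorph.trans
      I.toHomeomorph.symm.toOpenPartialHomeomorph |> fun t => τ ≫ₕ t
  have hT : ∀ v, T v = I.symm (e.symm (S v)) := fun v => rfl
  have hTs : ∀ h, T.symm h = τ.symm (e (I h)) := fun v => rfl
  have hTsrc : T.source = τ.source := by simp [T]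
  have hTt : ∀ h, h ∈ T.target ↔ e (I h) ∈ τ.target := by
    intro h
    simp [T]
  let D : OpenPartialHomeomorph M H := A ≫ₕ T
  have hDs : ∀ q, q ∈ D.source ↔ q ∈ X.source ∧ X q ∈ τ.source := by
    intro q
    simp only [D, OpenPartialHomeomorph.trans_source, hTsrc, mem_inter_iff, mem_preimage, hAX, hA]
  have hI : ∀ v : E, I (I.symm v) = v := fun v => I.right_inv (by simp [I.range_eq_univ])
  have hIs : ContMDiff 𝓘(ℝ, E) I ∞ I.symm := by
    have := I.contMDiffOn_symm (n := ∞)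
    rwa [I.range_eq_univ, contMDiffOn_univ] at this
  have hDt : ∀ h, h ∈ D.target ↔ e (I h) ∈ τ.target ∧ τ.symm (e (I h)) ∈ X.target := by
    intro h
    simp only [D, OpenPartialHomeomorph.trans_target, mem_inter_iff, mem_preimage, hTt, hAt, hTs]
  refine IsSubmersionAtOfComplement.mk_of_charts e D (chartAt H' (R p)) ?_ ?_ ?_ ?_ ?_ ?_
  · rw [hDs]
    exact ⟨mem_extChartAt_source p, hσp, hpV⟩
  · exact mem_chart_source _ _
  · refine D.mem_maximalAtlas_of_contMDiffOn ?_ ?_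
    · have h1 : ContMDiffOn I 𝓘(ℝ, E) ∞ X D.source := by
        refine contMDiffOn_extChartAt.mono ?_
        intro q hq
        have := ((hDs q).1 hq).1
        rwa [hX, extChartAt_source] at this
      have h2 : ContMDiffOn 𝓘(ℝ, E) 𝓘(ℝ, E' × F) ∞ S U := hSU.contMDiffOn
      exact (hIs.comp e.symm.contDiff.contMDiff).comp_contMDiffOn
        (h2.comp h1 fun q hq => (((hDs q).1 hq).2.2).1)
    · have h1 : ContMDiffOn 𝓘(ℝ, E) I ∞ X.symm X.target := contMDiffOn_extChartAt_symm p
      have h2 : ContMDiffOn I 𝓘(ℝ, E) ∞ (fun h => τ.symm (e (I h))) D.target :=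
        hτsymm.contMDiffOn.comp ((e.contDiff.contMDiff.comp I.contMDiff).contMDiffOn)
          fun h hh => ((hDt h).1 hh).1
      exact h1.comp h2 fun h hh => ((hDt h).1 hh).2
  · exact IsManifold.chart_mem_maximalAtlas _
  · intro q hq
    have h := (hDs q).1 hq
    have h' := h.2.2.1.2
    change R (X.symm (X q)) ∈ Y.source at h'
    rw [X.left_inv h.1, hY, extChartAt_source] at h'
    exact h'
  · intro v hv
    have hv' : I.symm v ∈ D.target := (by simpa using hv : (∃ y, I y = v) ∧ I.symm v ∈ D.target).2
    have := ((hDt _).1 hv').1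
    rw [hI] at this
    change f (τ.symm (e (I (I.symm v)))) = (e v).1
    rw [hI]
    exact congrArg Prod.fst (τ.right_inv this)

end Submersion

/-! ### Fibres of submersions as manifolds -/

section Level

variable {E E' F H H' M N W : Type*}
  [NormedAddCommGroup E] [NormedSpace ℝ E] [NormedAddCommGroup E'] [NormedSpace ℝ E']
  [NormedAddCommGroup F] [NormedSpace ℝ F]
  [TopologicalSpace H] [TopologicalSpace H'] {I : ModelWithCorners ℝ E H}
  {J : ModelWithCorners ℝ E' H'} [TopologicalSpace M] [ChartedSpace H M]
  [TopologicalSpace N] [ChartedSpace H' N] [TopologicalSpace W]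

/-- `Ψ` straightens the subset `S` of the manifold `M` near `p`: it is a smooth chart with values
in a product `E' × F`, in which `S` is given by the vanishing of the first component. -/
structure IsSliceChart (I : ModelWithCorners ℝ E H) (S : Set M) (p : M)
    (Ψ : OpenPartialHomeomorph M (E' × F)) : Prop where
  mem_source : p ∈ Ψ.source
  mem_iff : ∀ q ∈ Ψ.source, q ∈ S ↔ (Ψ q).1 = 0
  smooth : ContMDiffOn I 𝓘(ℝ, E' × F) ∞ Ψ Ψ.source
  smooth_symm : ContMDiffOn 𝓘(ℝ, E' × F) I ∞ Ψ.symm Ψ.target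

/-- A set which near `p` agrees with the fibre of a submersion has a slice chart at `p`. -/
theorem exists_isSliceChart [I.Boundaryless] [IsManifold I ∞ M] [IsManifold J ∞ N]
    {R : M → N} {S : Set M} {p : M} (h : IsSubmersionAtOfComplement F I J ∞ R p)
    (hS : ∀ q ∈ S, R q = R p) (hr : ∀ᶠ q in 𝓝 p, R q = R p → q ∈ S) :
    ∃ Ψ : OpenPartialHomeomorph M (E' × F), IsSliceChart I S p Ψ := by
  obtain ⟨O, hO, hOo, hpO⟩ := eventually_nhds_iff.1 hr
  set φ := h.domChart with hφ
  set χ := h.codChart with hχ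
  set L := h.equiv with hL
  set a : E' := χ.extend J (R p) with ha
  have key : ∀ q ∈ φ.source, (L (I (φ q))).1 = χ.extend J (R q) := by
    intro q hq
    have hq' : q ∈ (φ.extend I).source := by rwa [OpenPartialHomeomorph.extend_source]
    have := h.writtenInCharts ((φ.extend I).map_source hq')
    simp only [Function.comp_apply] at this
    rw [(φ.extend I).left_inv hq'] at this
    exact this.symm
  let t : (E' × F) ≃ₜ (E' × F) := Homeomorph.addRight (-(a, 0))
  let Ψ : OpenPartialHomeomorph M (E' × F) :=
    (φ.restrOpen O hOo).transHomeomorph ((I.toHomeomorph.trans L.toHomeomorph).trans t)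
  have hΨ : ∀ q, Ψ q = L (I (φ q)) + -(a, 0) := fun q => rfl
  have hΨs : ∀ w, Ψ.symm w = φ.symm (I.symm (L.symm (w + (a, 0)))) := fun w => by
    change φ.symm (I.symm (L.symm (w + - -(a, 0)))) = _
    rw [neg_neg]
  have hsrc : Ψ.source = φ.source ∩ O := rfl
  have htgt : ∀ w ∈ Ψ.target, I.symm (L.symm (w + (a, 0))) ∈ φ.target := by
    intro w hw
    have hw' : I.symm (L.symm (w + - -(a, 0))) ∈ (φ.restrOpen O hOo).target := hw
    rw [neg_neg] at hw'
    exact hw'.1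
  refine ⟨Ψ, ⟨⟨h.mem_domChart_source, hpO⟩, ?_, ?_, ?_⟩⟩
  · rintro q ⟨hq, hqO⟩
    have h1 : (Ψ q).1 = χ.extend J (R q) - a := by
      rw [hΨ, Prod.fst_add, key q hq]
      simp [sub_eq_add_neg]
    rw [h1, sub_eq_zero]
    constructor
    · intro hqS
      rw [hS q hqS]
    · intro hqa
      refine hO q hqO ((χ.extend J).injOn ?_ ?_ hqa)
      · rw [OpenPartialHomeomorph.extend_source]
        exact h.source_subset_preimage_source hq
      · rw [OpenPartialHomeomorph.extend_source]
        exact h.mem_codChart_source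
  · have h1 : ContMDiffOn I I ∞ φ Ψ.source :=
      (contMDiffOn_of_mem_maximalAtlas h.domChart_mem_maximalAtlas).mono inter_subset_left
    have h2 : ContMDiff I 𝓘(ℝ, E' × F) ∞ fun x => L (I x) + -(a, 0) :=
      ((L.contDiff.add contDiff_const).contMDiff).comp I.contMDiff
    exact h2.comp_contMDiffOn h1
  · have hIs : ContMDiff 𝓘(ℝ, E) I ∞ I.symm := by
      have := I.contMDiffOn_symm (n := ∞)
      rwa [I.range_eq_univ, contMDiffOn_univ] at this
    have h1 := contMDiffOn_symm_of_mem_maximalAtlas h.domChart_mem_maximalAtlas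
    have h2 : ContMDiff 𝓘(ℝ, E' × F) I ∞ fun w : E' × F => I.symm (L.symm (w + (a, 0))) :=
      hIs.comp (L.symm.contDiff.comp (contDiff_id.add contDiff_const)).contMDiff
    exact (h1.comp h2.contMDiffOn htgt).congr fun w _ => hΨs w

/-- The chart on the source of an embedding `f` induced by a slice chart of its image. -/
noncomputable def IsSliceChart.chart {f : W → M} (hf : IsEmbedding f) {x : W}
    {Ψ : OpenPartialHomeomorph M (E' × F)} (h : IsSliceChart I (range f) (f x) Ψ) :
    OpenPartialHomeomorph W F where
  toFun y := (Ψ (f y)).2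
  invFun u := haveI : Nonempty W := ⟨x⟩; Function.invFun f (Ψ.symm (0, u))
  source := f ⁻¹' Ψ.source
  target := {u | ((0, u) : E' × F) ∈ Ψ.target}
  map_source' y hy := by
    have h1 : (Ψ (f y)).1 = 0 := (h.mem_iff _ hy).1 ⟨y, rfl⟩
    have h2 : ((0, (Ψ (f y)).2) : E' × F) = Ψ (f y) := Prod.ext h1.symm rfl
    change ((0, (Ψ (f y)).2) : E' × F) ∈ Ψ.target
    rw [h2]
    exact Ψ.map_source hy
  map_target' u hu := by
    have : Nonempty W := ⟨x⟩
    have h1 : Ψ.symm (0, u) ∈ range f := by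
      rw [h.mem_iff _ (Ψ.map_target hu), Ψ.right_inv hu]
    change f (Function.invFun f (Ψ.symm (0, u))) ∈ Ψ.source
    rw [Function.invFun_eq h1]
    exact Ψ.map_target hu
  left_inv' y hy := by
    have : Nonempty W := ⟨x⟩
    have h1 : (Ψ (f y)).1 = 0 := (h.mem_iff _ hy).1 ⟨y, rfl⟩
    have h2 : ((0, (Ψ (f y)).2) : E' × F) = Ψ (f y) := Prod.ext h1.symm rfl
    refine hf.injective ?_
    rw [h2, Ψ.left_inv hy]
    exact Function.invFun_eq ⟨y, rfl⟩
  right_inv' u hu := by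
    have : Nonempty W := ⟨x⟩
    have h1 : Ψ.symm (0, u) ∈ range f := by
      rw [h.mem_iff _ (Ψ.map_target hu), Ψ.right_inv hu]
    change (Ψ (f (Function.invFun f (Ψ.symm (0, u))))).2 = u
    rw [Function.invFun_eq h1, Ψ.right_inv hu]
  open_source := Ψ.open_source.preimage hf.continuous
  open_target := Ψ.open_target.preimage (continuous_const.prodMk continuous_id)
  continuousOn_toFun := continuous_snd.comp_continuousOn
    (Ψ.continuousOn.comp hf.continuous.continuousOn fun _ hy => hy)
  continuousOn_invFun := by
    have : Nonempty W := ⟨x⟩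
    rw [hf.continuousOn_iff]
    refine ContinuousOn.congr (f := fun u => Ψ.symm (0, u)) ?_ ?_
    · exact Ψ.continuousOn_symm.comp (continuous_const.prodMk continuous_id).continuousOn
        fun _ hu => hu
    · intro u hu
      have h1 : Ψ.symm (0, u) ∈ range f := by
        rw [h.mem_iff _ (Ψ.map_target hu), Ψ.right_inv hu]
      exact Function.invFun_eq h1

theorem IsSliceChart.apply_chart_symm {f : W → M} (hf : IsEmbedding f) {x : W}
    {Ψ : OpenPartialHomeomorph M (E' × F)} (h : IsSliceChart I (range f) (f x) Ψ) {u : F}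
    (hu : u ∈ (h.chart hf).target) : f ((h.chart hf).symm u) = Ψ.symm (0, u) := by
  have : Nonempty W := ⟨x⟩
  have h1 : Ψ.symm (0, u) ∈ range f := by
    rw [h.mem_iff _ (Ψ.map_target hu), Ψ.right_inv hu]
  exact Function.invFun_eq h1

/-- The regular value theorem: the source of a topological embedding into a manifold, whose image
is locally a fibre of a submersion, is a manifold and the embedding is smooth. -/
theorem exists_chartedSpace_of_isSubmersionAt [I.Boundaryless] [IsManifold I ∞ M]
    [IsManifold J ∞ N] {f : W → M} (hf : IsEmbedding f) {R : M → N} {c : N}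
    (hsub : ∀ x, IsSubmersionAtOfComplement F I J ∞ R (f x)) (hc : ∀ x, R (f x) = c)
    (hr : ∀ x, ∀ᶠ q in 𝓝 (f x), R q = c → q ∈ range f) :
    ∃ _ : ChartedSpace F W, IsManifold 𝓘(ℝ, F) ∞ W ∧ IsSmoothEmbedding 𝓘(ℝ, F) I ∞ f := by
  have hex : ∀ x, ∃ Ψ : OpenPartialHomeomorph M (E' × F), IsSliceChart I (range f) (f x) Ψ := by
    intro x
    refine exists_isSliceChart (hsub x) ?_ ?_
    · rintro _ ⟨y, rfl⟩
      rw [hc, hc]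
    · rw [hc]
      exact hr x
  choose Ψ hΨ using hex
  let cs : ChartedSpace F W :=
    { atlas := range fun x => (hΨ x).chart hf
      chartAt := fun x => (hΨ x).chart hf
      mem_chart_source := fun x => (hΨ x).mem_source
      chart_mem_atlas := fun x => ⟨x, rfl⟩ }
  have hM : IsManifold 𝓘(ℝ, F) ∞ W := by
    refine isManifold_of_contDiffOn _ _ _ ?_
    rintro _ _ ⟨x, rfl⟩ ⟨y, rfl⟩
    have h1 : ContMDiffOn 𝓘(ℝ, F) 𝓘(ℝ, F) ∞ (fun u : F => (Ψ y ((Ψ x).symm ((0 : E'), u))).2)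
        {u | ((0 : E'), u) ∈ (Ψ x).target ∧ (Ψ x).symm ((0 : E'), u) ∈ (Ψ y).source} := by
      have h2 : ContMDiffOn 𝓘(ℝ, F) I ∞ (fun u : F => (Ψ x).symm ((0 : E'), u))
          {u | ((0 : E'), u) ∈ (Ψ x).target ∧ (Ψ x).symm ((0 : E'), u) ∈ (Ψ y).source} :=
        (hΨ x).smooth_symm.comp
          ((contDiff_const (c := (0 : E'))).prodMk contDiff_id).contMDiff.contMDiffOn
          fun u hu => hu.1
      exact (contDiff_snd.contMDiff (E := E' × F)).comp_contMDiffOn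
        ((hΨ y).smooth.comp h2 fun u hu => hu.2)
    refine (contMDiffOn_iff_contDiffOn.1 h1).congr_mono ?_ ?_
    · rintro u ⟨hu, -⟩
      have hu' : u ∈ ((hΨ x).chart hf).target := hu.1
      exact congrArg (fun z => (Ψ y z).2) ((hΨ x).apply_chart_symm hf hu')
    · rintro u ⟨hu, -⟩
      have hu' : u ∈ ((hΨ x).chart hf).target := hu.1
      refine ⟨hu', ?_⟩
      rw [← (hΨ x).apply_chart_symm hf hu']
      exact hu.2
  refine ⟨cs, hM, ?_, hf⟩
  suffices h : IsImmersionOfComplement E' 𝓘(ℝ, F) I ∞ f from h.isImmersion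
  intro x
  let L : (F × E') ≃L[ℝ] E :=
    (ContinuousLinearEquiv.prodComm ℝ F E').trans (hsub x).equiv.symm
  let D : OpenPartialHomeomorph M H := (Ψ x).transHomeomorph
    ((hsub x).equiv.symm.toHomeomorph.trans I.toHomeomorph.symm)
  have hD : ∀ q, D q = I.symm ((hsub x).equiv.symm (Ψ x q)) := fun q => rfl
  have hDs : ∀ w, D.symm w = (Ψ x).symm ((hsub x).equiv (I w)) := fun q => rfl
  have hIs : ContMDiff 𝓘(ℝ, E) I ∞ I.symm := by
    have := I.contMDiffOn_symm (n := ∞)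
    rwa [I.range_eq_univ, contMDiffOn_univ] at this
  refine IsImmersionAtOfComplement.mk_of_charts L ((hΨ x).chart hf) D
    (hΨ x).mem_source (hΨ x).mem_source (IsManifold.chart_mem_maximalAtlas x) ?_ ?_ ?_
  · refine D.mem_maximalAtlas_of_contMDiffOn ?_ ?_
    · exact (hIs.comp (hsub x).equiv.symm.contDiff.contMDiff).comp_contMDiffOn (hΨ x).smooth
    · refine (hΨ x).smooth_symm.comp
        ((hsub x).equiv.contDiff.contMDiff.comp I.contMDiff).contMDiffOn ?_
      intro w hw
      exact hw
  · exact fun _ h => h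
  · intro u hu
    have hu' : u ∈ ((hΨ x).chart hf).target := by simpa using hu
    have hI : ∀ v : E, I (I.symm v) = v := fun v => I.right_inv (by simp [I.range_eq_univ])
    change I (I.symm ((hsub x).equiv.symm (Ψ x (f (((hΨ x).chart hf).symm u))))) =
      (hsub x).equiv.symm (0, u)
    rw [hI, (hΨ x).apply_chart_symm hf hu', (Ψ x).right_inv hu']

end Level

/-! ### Maps out of submersions and finite products of manifolds -/

section Descent

variable {E E' E'' H H' H'' M N P : Type*}
  [NormedAddCommGroup E] [NormedSpace ℝ E] [NormedAddCommGroup E'] [NormedSpace ℝ E']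
  [NormedAddCommGroup E''] [NormedSpace ℝ E'']
  [TopologicalSpace H] [TopologicalSpace H'] [TopologicalSpace H'']
  {I : ModelWithCorners ℝ E H} {J : ModelWithCorners ℝ E' H'} {K : ModelWithCorners ℝ E'' H''}
  [TopologicalSpace M] [ChartedSpace H M]
  [TopologicalSpace N] [ChartedSpace H' N] [TopologicalSpace P] [ChartedSpace H'' P]

/-- A submersion has smooth local sections. -/
theorem Manifold.IsSubmersionAt.exists_section [I.Boundaryless] {π : M → N} {x : M}
    (h : IsSubmersionAt I J ∞ π x) :
    ∃ s : N → M, ContMDiffAt J I ∞ s (π x) ∧ s (π x) = x ∧ ∀ᶠ q in 𝓝 (π x), π (s q) = q := by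
  obtain ⟨F, _, _, h⟩ := h
  set φ := h.domChart
  set χ := h.codChart
  set L := h.equiv
  let v : N → E := fun q => L.symm (χ.extend J q, (L (φ.extend I x)).2)
  have hvx : v (π x) = φ.extend I x := by
    have hx : x ∈ (φ.extend I).source := by
      rw [OpenPartialHomeomorph.extend_source]; exact h.mem_domChart_source
    have := h.writtenInCharts ((φ.extend I).map_source hx)
    simp only [Function.comp_apply] at this
    rw [(φ.extend I).left_inv hx] at this
    change L.symm (χ.extend J (π x), (L (φ.extend I x)).2) = _
    rw [this]
    simp [L, φ]
  have hv : ContMDiffAt J 𝓘(ℝ, E) ∞ v (π x) := by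
    have h1 : ContMDiffAt J 𝓘(ℝ, E') ∞ (χ.extend J) (π x) :=
      χ.contMDiffAt_extend h.codChart_mem_maximalAtlas h.mem_codChart_source
    have h2 : ContDiff ℝ ∞ fun w : E' => L.symm (w, (L (φ.extend I x)).2) :=
      L.symm.contDiff.comp (contDiff_id.prodMk contDiff_const)
    exact h2.contMDiff.contMDiffAt.comp _ h1
  have hto : IsOpen (φ.extend I).target := φ.isOpen_extend_target
  have hxt : φ.extend I x ∈ (φ.extend I).target := by
    refine (φ.extend I).map_source ?_
    rw [OpenPartialHomeomorph.extend_source]; exact h.mem_domChart_source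
  have hI : I '' φ.target = (φ.extend I).target := by
    rw [OpenPartialHomeomorph.extend_target, I.image_eq]
  refine ⟨fun q => (φ.extend I).symm (v q), ?_, ?_, ?_⟩
  · have h1 : ContMDiffOn 𝓘(ℝ, E) I ∞ (φ.extend I).symm (φ.extend I).target := by
      rw [← hI]; exact contMDiffOn_extend_symm h.domChart_mem_maximalAtlas
    have h2 := h1.contMDiffAt (hto.mem_nhds hxt)
    rw [← hvx] at h2
    exact h2.comp _ hv
  · change (φ.extend I).symm (v (π x)) = x
    rw [hvx]
    refine (φ.extend I).left_inv ?_
    rw [OpenPartialHomeomorph.extend_source]; exact h.mem_domChart_source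
  · have h1 : ∀ᶠ q in 𝓝 (π x), v q ∈ (φ.extend I).target := by
      refine hv.continuousAt.eventually ?_
      rw [hvx]
      exact hto.mem_nhds hxt
    filter_upwards [h1, χ.open_source.mem_nhds h.mem_codChart_source] with q hq hqs
    have h2 := h.writtenInCharts hq
    simp only [Function.comp_apply] at h2
    have h3 : (h.equiv (v q)).1 = χ.extend J q := by simp [v, L]
    rw [h3] at h2
    refine (χ.extend J).injOn ?_ ?_ h2
    · rw [OpenPartialHomeomorph.extend_source]
      refine h.source_subset_preimage_source ?_
      have := (φ.extend I).map_target hq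
      rwa [OpenPartialHomeomorph.extend_source] at this
    · rwa [OpenPartialHomeomorph.extend_source]

/-- Smoothness of a map on the target of a surjective submersion can be tested upstairs. -/
theorem Manifold.IsSubmersion.contMDiff_of_comp [I.Boundaryless] {π : M → N}
    (h : IsSubmersion I J ∞ π) (hs : Function.Surjective π) {f : N → P}
    (hf : ContMDiff I K ∞ (f ∘ π)) : ContMDiff J K ∞ f := by
  intro y
  obtain ⟨x, rfl⟩ := hs y
  obtain ⟨s, h1, h2, h3⟩ := (h.isSubmersionAt x).exists_section
  have h4 : ContMDiffAt J K ∞ ((f ∘ π) ∘ s) (π x) := ContMDiffAt.comp _ (hf _) h1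
  refine h4.congr_of_eventuallyEq ?_
  filter_upwards [h3] with q hq
  simp [hq]

end Descent

/-- Two manifold structures between which the identity is smooth in both directions have the same
charts. -/
theorem maximalAtlas_le_of_contMDiff_id {E H M : Type*} [NormedAddCommGroup E]
    [NormedSpace ℝ E] [TopologicalSpace H] {I : ModelWithCorners ℝ E H} [TopologicalSpace M]
    (c c' : ChartedSpace H M)
    (hc' : @IsManifold ℝ _ E _ _ H _ I ∞ M _ c')
    (h : @ContMDiff ℝ _ E _ _ H _ I M _ c E _ _ H _ I M _ c' ∞ id)
    (h' : @ContMDiff ℝ _ E _ _ H _ I M _ c' E _ _ H _ I M _ c ∞ id) :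
    @IsManifold.maximalAtlas ℝ _ _ _ _ _ _ I ∞ M _ c ⊆
      @IsManifold.maximalAtlas ℝ _ _ _ _ _ _ I ∞ M _ c' := by
  intro e he
  refine @OpenPartialHomeomorph.mem_maximalAtlas_of_contMDiffOn ℝ _ E _ _ H _ I M _ c' _ hc' e
    ?_ ?_
  · have h1 := @contMDiffOn_of_mem_maximalAtlas ℝ _ E _ _ H _ I M _ c _ e he
    exact @ContMDiffOn.comp ℝ _ E _ _ H _ I M _ E _ _ H _ I M _ E _ _ H _ I H _ c' c _ id _ ∞ _ e
      h1 (@ContMDiff.contMDiffOn ℝ _ E _ _ H _ I M _ c' E _ _ H _ I M _ c id _ _ h')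
      (subset_refl _)
  · have h1 := @contMDiffOn_symm_of_mem_maximalAtlas ℝ _ E _ _ H _ I M _ c _ e he
    exact @ContMDiffOn.comp ℝ _ E _ _ H _ I H _ E _ _ H _ I M _ E _ _ H _ I M _ _ c c' e.symm
      _ ∞ _ id (@ContMDiff.contMDiffOn ℝ _ E _ _ H _ I M _ c E _ _ H _ I M _ c' id univ _ h)
      h1 (subset_univ _)

section Pi

variable {ι : Type*} [Fintype ι] {E H M : ι → Type*} [∀ i, NormedAddCommGroup (E i)]
  [∀ i, NormedSpace ℝ (E i)] [∀ i, TopologicalSpace (H i)] {I : ∀ i, ModelWithCorners ℝ (E i) (H i)}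
  [∀ i, TopologicalSpace (M i)] [∀ i, ChartedSpace (H i) (M i)]
  {E' H' N : Type*} [NormedAddCommGroup E'] [NormedSpace ℝ E'] [TopologicalSpace H']
  {J : ModelWithCorners ℝ E' H'} [TopologicalSpace N] [ChartedSpace H' N]

instance ModelWithCorners.boundaryless_pi [∀ i, (I i).Boundaryless] :
    (ModelWithCorners.pi I).Boundaryless := by
  constructor
  change range (fun (x : ∀ i, H i) i => I i (x i)) = univ
  rw [eq_univ_iff_forall]
  intro y
  have : ∀ i, ∃ x, I i x = y i := fun i => by
    have := (I i).range_eq_univ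
    rw [eq_univ_iff_forall] at this
    exact this (y i)
  choose x hx using this
  exact ⟨x, funext hx⟩

/-- A map into a finite product of manifolds is smooth if its components are. -/
theorem contMDiff_pi_of_components {f : N → ∀ i, M i}
    (h : ∀ i, ContMDiff J (I i) ∞ fun x => f x i) :
    ContMDiff J (ModelWithCorners.pi I) ∞ f := by
  intro x
  rw [contMDiffAt_iff_target]
  refine ⟨(continuous_pi fun i => (h i).continuous).continuousAt, ?_⟩
  refine contMDiffAt_pi_space.2 fun i => ?_
  exact (contMDiffAt_iff_target.1 (h i x)).2

/-- The projections of a finite product of manifolds are smooth. -/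
theorem contMDiff_pi_proj (i : ι) :
    ContMDiff (ModelWithCorners.pi I) (I i) ∞ fun p : ∀ i, M i => p i := by
  intro p
  rw [contMDiffAt_iff]
  refine ⟨(continuous_apply i).continuousAt, ?_⟩
  have h1 : ContDiff ℝ ∞ (fun v : ∀ i, E i => v i) :=
    (ContinuousLinearMap.proj (R := ℝ) (φ := E) i).contDiff
  refine h1.contDiffWithinAt.congr_of_eventuallyEq ?_ ?_
  · have h2 : Tendsto (fun v : ∀ i, E i => v i)
        (𝓝[range (ModelWithCorners.pi I)] (extChartAt (ModelWithCorners.pi I) p p))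
        (𝓝[range (I i)] (extChartAt (I i) (p i) (p i))) := by
      refine tendsto_nhdsWithin_of_tendsto_nhds_of_eventually_within _ ?_ ?_
      · exact ((continuous_apply i).tendsto _).mono_left nhdsWithin_le_nhds
      · filter_upwards [self_mem_nhdsWithin]
        rintro _ ⟨y, rfl⟩
        exact ⟨y i, rfl⟩
    filter_upwards [h2 (extChartAt_target_mem_nhdsWithin (I := I i) (p i))] with v hv
    exact (extChartAt (I i) (p i)).right_inv hv
  · change extChartAt (I i) (p i) ((extChartAt (I i) (p i)).symm (extChartAt (I i) (p i) (p i))) =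
      extChartAt (I i) (p i) (p i)
    rw [(extChartAt (I i) (p i)).left_inv (mem_extChartAt_source _)]

instance isManifold_pi [∀ i, IsManifold (I i) ∞ (M i)] :
    IsManifold (ModelWithCorners.pi I) ∞ (∀ i, M i) := by
  refine isManifold_of_contDiffOn _ _ _ ?_
  rintro _ _ ⟨e, he, rfl⟩ ⟨e', he', rfl⟩
  refine contDiffOn_pi.2 fun i => ?_
  have h1 : (e i).symm ≫ₕ e' i ∈ contDiffGroupoid ∞ (I i) :=
    (contDiffGroupoid ∞ (I i)).compatible (he i (mem_univ i)) (he' i (mem_univ i))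
  have h2 : ContDiffOn ℝ ∞ (I i ∘ ((e i).symm ≫ₕ e' i) ∘ (I i).symm)
      ((I i).symm ⁻¹' ((e i).symm ≫ₕ e' i).source ∩ range (I i)) :=
    (mem_groupoid_of_pregroupoid.1 h1).1
  have h3 : ContDiff ℝ ∞ (fun v : ∀ i, E i => v i) :=
    (ContinuousLinearMap.proj (R := ℝ) (φ := E) i).contDiff
  refine h2.comp (f := fun v : ∀ i, E i => v i) h3.contDiffOn ?_
  rintro v ⟨⟨h4, h5⟩, y, rfl⟩
  refine ⟨⟨h4 i (mem_univ i), h5 i (mem_univ i)⟩, y i, rfl⟩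

end Pi

/-! ### Quasigeodesics in the hyperbolic plane -/

namespace UpperHalfPlane

/-- The hyperbolic plane is Gromov hyperbolic: the four-point condition. It is Ptolemy's inequality
for the Euclidean distances, which are proportional to `sinh (d / 2)`. -/
theorem dist_add_dist_le_max (x y z w : UpperHalfPlane) :
    dist x y + dist z w ≤ max (dist x z + dist y w) (dist x w + dist y z) + 6 := by
  set m := max (dist x z + dist y w) (dist x w + dist y z) with hm
  have hm1 : dist x z + dist y w ≤ m := le_max_left _ _
  have hm2 : dist x w + dist y z ≤ m := le_max_right _ _
  rcases lt_or_ge (dist x y) 2 with hxy | hxy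
  · have h1 := dist_triangle4 z x y w
    rw [dist_comm z x] at h1
    linarith
  rcases lt_or_ge (dist z w) 2 with hzw | hzw
  · have h1 := dist_triangle4 x z w y
    rw [dist_comm w y] at h1
    linarith
  -- both distances are large, so `sinh` is comparable with `exp`
  have hs : ∀ a b : UpperHalfPlane, dist (a : ℂ) b = Real.sinh (dist a b / 2) *
      (2 * (√a.im * √b.im)) := by
    intro a b
    rw [sinh_half_dist, Real.sqrt_mul a.im_pos.le]
    have h1 := Real.sqrt_pos.2 a.im_pos
    have h2 := Real.sqrt_pos.2 b.im_pos
    field_simp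
  have hpt := EuclideanGeometry.mul_dist_le_mul_dist_add_mul_dist (x : ℂ) (z : ℂ) (y : ℂ) (w : ℂ)
  rw [hs, hs, hs, hs, hs, hs] at hpt
  have h1 := Real.sqrt_pos.2 x.im_pos
  have h2 := Real.sqrt_pos.2 y.im_pos
  have h3 := Real.sqrt_pos.2 z.im_pos
  have h4 := Real.sqrt_pos.2 w.im_pos
  have hpos : 0 < 4 * (√x.im * √y.im * √z.im * √w.im) := by positivity
  have hpt' : Real.sinh (dist x y / 2) * Real.sinh (dist z w / 2) ≤
      Real.sinh (dist x z / 2) * Real.sinh (dist y w / 2) +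
        Real.sinh (dist x w / 2) * Real.sinh (dist y z / 2) := by
    rw [dist_comm z y] at hpt
    refine le_of_mul_le_mul_right ?_ hpos
    linarith
  have hup : ∀ t : ℝ, Real.sinh t ≤ Real.exp t / 2 := by
    intro t
    rw [Real.sinh_eq]
    have := Real.exp_pos (-t)
    linarith
  have hprod : ∀ a b : ℝ, 0 ≤ a → 0 ≤ b → a + b ≤ m →
      Real.sinh (a / 2) * Real.sinh (b / 2) ≤ Real.exp (m / 2) / 4 := by
    intro a b ha hb hab
    have h5 : Real.sinh (a / 2) * Real.sinh (b / 2) ≤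
        Real.exp (a / 2) / 2 * (Real.exp (b / 2) / 2) :=
      mul_le_mul (hup _) (hup _) (Real.sinh_nonneg_iff.2 (by positivity)) (by positivity)
    have h6 : Real.exp (a / 2) * Real.exp (b / 2) ≤ Real.exp (m / 2) := by
      rw [← Real.exp_add]
      exact Real.exp_le_exp.2 (by linarith)
    linarith
  have hlow : ∀ t : ℝ, 1 ≤ t → Real.exp t / 4 ≤ Real.sinh t := by
    intro t ht
    rw [Real.sinh_eq]
    have h5 : Real.exp (-t) ≤ 1 := Real.exp_le_one_iff.2 (by linarith)
    have h6 : t + 1 ≤ Real.exp t := Real.add_one_le_exp t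
    linarith
  have h5 : Real.exp (dist x y / 2) / 4 * (Real.exp (dist z w / 2) / 4) ≤
      Real.sinh (dist x y / 2) * Real.sinh (dist z w / 2) :=
    mul_le_mul (hlow _ (by linarith)) (hlow _ (by linarith)) (by positivity)
      (Real.sinh_nonneg_iff.2 (by positivity))
  have h6 := hprod _ _ dist_nonneg dist_nonneg hm1
  have h7 := hprod _ _ dist_nonneg dist_nonneg hm2
  have h8 : Real.exp ((dist x y + dist z w) / 2) ≤ 8 * Real.exp (m / 2) := by
    rw [add_div, Real.exp_add]
    linarith
  have h9 : (8 : ℝ) ≤ Real.exp 3 := by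
    have h10 : (2 : ℝ) ≤ Real.exp 1 := by
      have := Real.add_one_le_exp 1
      linarith
    have h11 : Real.exp 3 = Real.exp 1 ^ 3 := by
      rw [← Real.exp_nat_mul]; norm_num
    rw [h11]
    calc (8 : ℝ) = 2 ^ 3 := by norm_num
      _ ≤ Real.exp 1 ^ 3 := by gcongr
  have h10 : Real.exp ((dist x y + dist z w) / 2) ≤ Real.exp (3 + m / 2) := by
    rw [Real.exp_add]
    exact h8.trans (mul_le_mul_of_nonneg_right h9 (Real.exp_pos _).le)
  have h11 := Real.exp_le_exp.1 h10
  linarith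

/-- The hyperbolic plane is a geodesic space. The hyperbolic balls of radii `t` and `d(x, y) - t`
about `x` and `y` are Euclidean balls which touch each other from outside; the point of contact is
the point wanted. -/
theorem exists_dist_eq_dist_eq (x y : UpperHalfPlane) {t : ℝ} (ht : 0 ≤ t) (htd : t ≤ dist x y) :
    ∃ p : UpperHalfPlane, dist x p = t ∧ dist p y = dist x y - t := by
  rcases eq_or_lt_of_le (dist_nonneg (x := x) (y := y)) with h0 | h0
  · refine ⟨x, ?_, ?_⟩
    · rw [dist_self]; linarith
    · linarith
  set s := dist x y - t with hs
  have hs0 : 0 ≤ s := by linarith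
  set r₁ := x.im * Real.sinh t with hr₁
  set r₂ := y.im * Real.sinh s with hr₂
  have hr₁0 : 0 ≤ r₁ := mul_nonneg x.im_pos.le (Real.sinh_nonneg_iff.2 ht)
  have hr₂0 : 0 ≤ r₂ := mul_nonneg y.im_pos.le (Real.sinh_nonneg_iff.2 hs0)
  have hr : 0 < r₁ + r₂ := by
    rcases eq_or_lt_of_le ht with h | h
    · have : 0 < r₂ := mul_pos y.im_pos (Real.sinh_pos_iff.2 (by linarith))
      linarith
    · have : 0 < r₁ := mul_pos x.im_pos (Real.sinh_pos_iff.2 h)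
      linarith
  set c₁ := center x t with hc₁
  set c₂ := center y s with hc₂
  have hcosh : Real.cosh (t + s) = 1 + ((x.re - y.re) ^ 2 + (x.im - y.im) ^ 2) /
      (2 * x.im * y.im) := by
    have h1 : t + s = dist x y := by rw [hs]; ring
    rw [h1, cosh_dist, Complex.dist_eq, ← Complex.normSq_eq_norm_sq, Complex.normSq_apply]
    simp [pow_two]
  have hdist : dist (c₁ : ℂ) c₂ = r₁ + r₂ := by
    rw [← sq_eq_sq₀ dist_nonneg hr.le, Complex.dist_eq, ← Complex.normSq_eq_norm_sq,
      Complex.normSq_apply]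
    simp only [Complex.sub_re, Complex.sub_im, coe_re, coe_im, hc₁, hc₂, center_re, center_im]
    have h2 := Real.cosh_sq t
    have h3 := Real.cosh_sq s
    rw [Real.cosh_add] at hcosh
    have hx := x.im_pos
    have hy := y.im_pos
    field_simp at hcosh
    rw [hr₁, hr₂]
    linear_combination (x.im ^ 2) * h2 + y.im ^ 2 * h3 - hcosh
  have him : 0 < ((c₁ : ℂ) + ((r₁ / (r₁ + r₂) : ℝ) : ℂ) * (c₂ - c₁)).im := by
    have h1 : ((c₁ : ℂ) + ((r₁ / (r₁ + r₂) : ℝ) : ℂ) * (c₂ - c₁)).im =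
        (r₂ * c₁.im + r₁ * c₂.im) / (r₁ + r₂) := by
      simp only [Complex.add_im, Complex.im_ofReal_mul, Complex.sub_im,
        coe_im]
      field_simp
      ring
    rw [h1]
    refine div_pos ?_ hr
    rcases eq_or_lt_of_le hr₁0 with h | h
    · have : 0 < r₂ := by linarith
      have := mul_pos this c₁.im_pos
      rw [← h]; linarith
    · have := mul_pos h c₂.im_pos
      have := mul_nonneg hr₂0 c₁.im_pos.le
      linarith
  refine ⟨⟨_, him⟩, ?_, ?_⟩
  · rw [dist_comm, dist_eq_iff_dist_coe_center_eq]
    change dist ((c₁ : ℂ) + ((r₁ / (r₁ + r₂) : ℝ) : ℂ) * (c₂ - c₁)) c₁ = r₁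
    rw [Complex.dist_eq, add_sub_cancel_left, norm_mul, ← Complex.dist_eq, dist_comm, hdist,
      Complex.norm_real, Real.norm_of_nonneg (by positivity)]
    field_simp
  · rw [dist_eq_iff_dist_coe_center_eq]
    change dist ((c₁ : ℂ) + ((r₁ / (r₁ + r₂) : ℝ) : ℂ) * (c₂ - c₁)) c₂ = r₂
    have h1 : (c₁ : ℂ) + ((r₁ / (r₁ + r₂) : ℝ) : ℂ) * (c₂ - c₁) - c₂ =
        ((r₂ / (r₁ + r₂) : ℝ) : ℂ) * (c₁ - c₂) := by
      have h2 : ((r₂ / (r₁ + r₂) : ℝ) : ℂ) = 1 - ((r₁ / (r₁ + r₂) : ℝ) : ℂ) := by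
        rw [← Complex.ofReal_one, ← Complex.ofReal_sub]
        congr 1
        field_simp
        ring
      rw [h2]; ring
    rw [Complex.dist_eq, h1, norm_mul, ← Complex.dist_eq, hdist,
      Complex.norm_real, Real.norm_of_nonneg (by positivity)]
    field_simp

end UpperHalfPlane

/-- In a Gromov hyperbolic space, a chain of points with long steps and small Gromov products at
consecutive triples progresses linearly. -/
theorem le_dist_of_local_quasigeodesic {X : Type*} [PseudoMetricSpace X] {C K L : ℝ}
    (hX : ∀ x y z w : X, dist x y + dist z w ≤ max (dist x z + dist y w) (dist x w + dist y z) + C)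
    (hL : K + C < L) (hK : 0 ≤ K) (hC : 0 ≤ C) {n : ℕ} (x : ℕ → X)
    (h1 : ∀ i < n, L ≤ dist (x i) (x (i + 1)))
    (h2 : ∀ i, i + 1 < n → dist (x i) (x (i + 1)) + dist (x (i + 1)) (x (i + 2)) - K ≤
      dist (x i) (x (i + 2))) :
    n * (L - K - C) ≤ dist (x 0) (x n) := by
  have key : ∀ m < n, dist (x 0) (x m) + dist (x m) (x (m + 1)) - (K + C) ≤
      dist (x 0) (x (m + 1)) := by
    intro m
    induction m with
    | zero =>
      intro _
      rw [dist_self]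
      linarith
    | succ m ih =>
      intro hm
      have h3 := ih (by omega)
      have h4 := h2 m hm
      have h5 := h1 m (by omega)
      rcases le_max_iff.1 (sub_le_iff_le_add.2 (hX (x 0) (x (m + 1)) (x m) (x (m + 2)))) with h | h
      · linarith
      · rw [dist_comm (x (m + 1)) (x m)] at h
        change _ ≤ dist (x 0) (x (m + 2))
        change dist (x 0) (x (m + 1)) + dist (x (m + 1)) (x (m + 2)) - (K + C) ≤ _
        linarith
  have main : ∀ m ≤ n, m * (L - K - C) ≤ dist (x 0) (x m) := by
    intro m
    induction m with
    | zero => simp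
    | succ m ih =>
      intro hm
      have h3 := ih (by omega)
      have h4 := key m (by omega)
      have h5 := h1 m (by omega)
      push_cast
      linarith
  exact main n le_rfl

/-! ### Openness of discrete, faithful, cocompact representations -/

namespace PSL2R

instance instIsIsometricSMul : IsIsometricSMul PSL2R UpperHalfPlane where
  isometry_smul γ := by
    obtain ⟨A, rfl⟩ := mk_surjective γ
    exact isometry_smul UpperHalfPlane A

instance instIsPretransitive : MulAction.IsPretransitive PSL2R UpperHalfPlane where
  exists_smul_eq z w := by
    obtain ⟨A, hA⟩ := MulAction.exists_smul_eq SL(2, ℝ) z w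
    exact ⟨mk A, hA⟩

instance instContinuousSMul : ContinuousSMul PSL2R UpperHalfPlane where
  continuous_smul := by
    have hq : IsOpenQuotientMap (Prod.map mk id : SL(2, ℝ) × UpperHalfPlane → _) :=
      (QuotientGroup.isOpenQuotientMap_mk (N := Subgroup.center SL(2, ℝ))).prodMap
        IsOpenQuotientMap.id
    exact hq.isQuotientMap.continuous_iff.2
      (continuous_smul : Continuous fun p : SL(2, ℝ) × UpperHalfPlane => p.1 • p.2)

instance instT2Space : T2Space PSL2R := by
  have : IsClosed (Subgroup.center SL(2, ℝ) : Set SL(2, ℝ)) := by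
    refine ((Set.toFinite {1, -1}).subset fun A hA => ?_).isClosed
    exact mem_center hA
  infer_instance

instance instSecondCountable : SecondCountableTopology PSL2R := by
  have : SecondCountableTopology (Matrix (Fin 2) (Fin 2) ℝ) :=
    inferInstanceAs (SecondCountableTopology (Fin 2 → Fin 2 → ℝ))
  have : SecondCountableTopology SL(2, ℝ) :=
    (show IsInducing fun A : SL(2, ℝ) => (A : Matrix (Fin 2) (Fin 2) ℝ) from
      ⟨rfl⟩).secondCountableTopology
  infer_instance

/-- The elements of `PSL(2, ℝ)` moving the point `i` by a bounded distance form a compact set. -/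
theorem isCompact_dist_le (R : ℝ) :
    IsCompact {γ : PSL2R | dist UpperHalfPlane.I (γ • UpperHalfPlane.I) ≤ R} := by
  have h : {γ : PSL2R | dist UpperHalfPlane.I (γ • UpperHalfPlane.I) ≤ R} =
      mk '' ((fun A : SL(2, ℝ) => A • UpperHalfPlane.I) ⁻¹'
        Metric.closedBall UpperHalfPlane.I R) := by
    ext γ
    constructor
    · intro hγ
      obtain ⟨A, rfl⟩ := mk_surjective γ
      refine ⟨A, ?_, rfl⟩
      rw [mem_preimage, Metric.mem_closedBall, dist_comm]
      exact hγ
    · rintro ⟨A, hA, rfl⟩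
      rw [mem_preimage, Metric.mem_closedBall, dist_comm] at hA
      exact hA
  rw [h]
  exact (UpperHalfPlane.isProperMap_smul_I.isCompact_preimage
    (isCompact_closedBall _ _)).image continuous_mk

theorem dist_smul_inv (γ : PSL2R) (z : UpperHalfPlane) : dist z (γ⁻¹ • z) = dist z (γ • z) := by
  rw [← dist_smul γ z (γ⁻¹ • z), smul_inv_smul, dist_comm]

end PSL2R

section Weil

open UpperHalfPlane PSL2R

variable {Γ : Type*} [Group Γ]

/-- The orbit of the point `i` under a homomorphism to `PSL(2, ℝ)` is `D`-dense. -/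
def HasDenseOrbit (ρ : Γ →* PSL2R) (D : ℝ) : Prop :=
  ∀ p : UpperHalfPlane, ∃ γ, dist p (ρ γ • I) ≤ D

/-- Only finitely many elements move the point `i` by a bounded distance. -/
def HasFiniteBalls (ρ : Γ →* PSL2R) : Prop :=
  ∀ R : ℝ, {γ : Γ | dist I (ρ γ • I) ≤ R}.Finite

theorem Hom₀.hasFiniteBalls (ρ : Hom₀ Γ PSL2R) : HasFiniteBalls ρ.1 := by
  intro R
  have h1 : DiscreteTopology ρ.1.range := ρ.2.2.1
  have h2 : IsClosed (ρ.1.range : Set PSL2R) := Subgroup.isClosed_of_discrete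
  have h3 : ((ρ.1.range : Set PSL2R) ∩
      {γ : PSL2R | dist UpperHalfPlane.I (γ • UpperHalfPlane.I) ≤ R}).Finite := by
    have h4 : IsCompact ((Subtype.val : ρ.1.range → PSL2R) ⁻¹'
        {γ : PSL2R | dist UpperHalfPlane.I (γ • UpperHalfPlane.I) ≤ R}) :=
      h2.isClosedEmbedding_subtypeVal.isCompact_preimage (isCompact_dist_le R)
    have h5 := (h4.finite_of_discrete).image (Subtype.val : ρ.1.range → PSL2R)
    rw [image_preimage_eq_inter_range, Subtype.range_coe, inter_comm] at h5
    exact h5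
  refine (h3.preimage ρ.2.1.injOn).subset ?_
  intro γ hγ
  exact ⟨⟨γ, rfl⟩, hγ⟩

theorem Hom₀.exists_hasDenseOrbit (ρ : Hom₀ Γ PSL2R) : ∃ D, HasDenseOrbit ρ.1 D := by
  have h1 : CompactSpace (PSL2R ⧸ ρ.1.range) := ρ.2.2.2
  let U : ℕ → Set PSL2R := fun n => {g | dist I (g⁻¹ • I) < n}
  have hU : ∀ n, IsOpen (U n) := fun n =>
    isOpen_lt (continuous_const.dist (continuous_inv.smul continuous_const)) continuous_const
  have hV : ∀ n, IsOpen ((QuotientGroup.mk : PSL2R → PSL2R ⧸ ρ.1.range) '' U n) := fun n =>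
    QuotientGroup.isOpenMap_coe _ (hU n)
  obtain ⟨n, hn⟩ := isCompact_univ.elim_directed_cover _ hV (by
    intro q _
    obtain ⟨g, rfl⟩ := QuotientGroup.mk_surjective q
    obtain ⟨n, hn⟩ := exists_nat_gt (dist I (g⁻¹ • I))
    exact mem_iUnion.2 ⟨n, g, hn, rfl⟩) (by
    refine (monotone_nat_of_le_succ fun n => ?_).directed_le
    refine image_mono fun g hg => ?_
    have : dist I (g⁻¹ • I) < n := hg
    change dist I (g⁻¹ • I) < ((n + 1 : ℕ) : ℝ)
    push_cast
    linarith)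
  refine ⟨n, fun p => ?_⟩
  obtain ⟨h, rfl⟩ := MulAction.exists_smul_eq PSL2R I p
  obtain ⟨g, hg, hgh⟩ := hn (mem_univ (QuotientGroup.mk h⁻¹))
  obtain ⟨γ, hγ⟩ := QuotientGroup.eq.1 hgh
  refine ⟨γ⁻¹, ?_⟩
  have h2 : g⁻¹ = ρ.1 γ * h := by
    rw [hγ]; group
  have h3 : dist I (g⁻¹ • I) < n := hg
  rw [h2, mul_smul, ← dist_smul (ρ.1 γ)⁻¹, inv_smul_smul, dist_comm] at h3
  rw [map_inv]
  exact h3.le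

/-- A homomorphism is in `Hom₀` if it is injective, has a cobounded orbit and finite balls. -/
theorem hom₀_property {ρ : Γ →* PSL2R} {D : ℝ} (hi : Function.Injective ρ)
    (hb : HasFiniteBalls ρ) (hD : HasDenseOrbit ρ D) :
    Function.Injective ρ ∧ DiscreteTopology ρ.range ∧ CompactSpace (PSL2R ⧸ ρ.range) := by
  refine ⟨hi, ?_, ?_⟩
  · refine discreteTopology_of_isOpen_singleton_one ?_
    have h1 : ({g : ρ.range | dist I ((g : PSL2R) • I) < 1}).Finite := by
      refine (((hb 1).image fun γ => (⟨ρ γ, γ, rfl⟩ : ρ.range))).subset ?_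
      rintro ⟨_, γ, rfl⟩ h
      exact ⟨γ, (le_of_lt h : dist I (ρ γ • I) ≤ 1), rfl⟩
    have h2 : IsOpen {g : ρ.range | dist I ((g : PSL2R) • I) < 1} :=
      isOpen_lt (continuous_const.dist (continuous_subtype_val.smul continuous_const))
        continuous_const
    have h3 : ({1} : Set ρ.range) = {g : ρ.range | dist I ((g : PSL2R) • I) < 1} \
        ({g : ρ.range | dist I ((g : PSL2R) • I) < 1} \ {1}) := by
      rw [Set.sdiff_sdiff_right_self]
      symm
      apply inter_eq_right.2
      rintro _ rfl
      simp
    rw [h3]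
    exact h2.sdiff (h1.subset sdiff_subset).isClosed
  · have h1 : IsCompact {g : PSL2R | dist I (g⁻¹ • I) ≤ D} := by
      have h2 := isCompact_dist_le D
      simpa only [dist_smul_inv] using h2
    refine ⟨?_⟩
    convert h1.image (f := (QuotientGroup.mk : PSL2R → PSL2R ⧸ ρ.range)) continuous_quot_mk
    symm
    rw [eq_univ_iff_forall]
    intro q
    obtain ⟨g, rfl⟩ := QuotientGroup.mk_surjective q
    obtain ⟨γ, hγ⟩ := hD (g⁻¹ • I)
    refine ⟨g * ρ γ, ?_, ?_⟩
    · change dist I ((g * ρ γ)⁻¹ • I) ≤ D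
      rw [mul_inv_rev, mul_smul, ← dist_smul (ρ γ), smul_inv_smul, dist_comm]
      exact hγ
    · exact QuotientGroup.eq.2 ⟨γ⁻¹, by rw [map_inv]; group⟩

theorem dist_smul_eq (ρ : Γ →* PSL2R) (γ δ : Γ) :
    dist (ρ γ • I) (ρ δ • I) = dist I (ρ (γ⁻¹ * δ) • I) := by
  rw [map_mul, mul_smul, map_inv, ← dist_smul (ρ γ) I, smul_inv_smul]

/-- If `ρ` is close to `ρ₀` on a large ball, then its orbit map expands distances at a definite
rate relative to that of `ρ₀`: orbit points of `ρ₀` close to a geodesic are turned by `ρ` into a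
chain to which the local-to-global principle applies. -/
theorem dist_orbit_le_of_close {ρ₀ ρ : Γ →* PSL2R} {D : ℝ} (hD0 : 0 ≤ D)
    (hD : HasDenseOrbit ρ₀ D)
    (hclose : ∀ γ, dist I (ρ₀ γ • I) ≤ 18 * D + 22 → dist (ρ γ • I) (ρ₀ γ • I) ≤ 1) (γ : Γ) :
    dist I (ρ₀ γ • I) ≤ (8 * D + 11) * (dist I (ρ γ • I) + (10 * D + 14)) := by
  -- Orbit points approximating the ends of one step are at most `ℓ + 2 * D` apart, and those two
  -- steps apart at most `2 * ℓ + 2 * D = 18 * D + 22`, so that `hclose` applies to both.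
  set ℓ := 8 * D + 11 with hℓ
  have hℓ0 : 0 < ℓ := by positivity
  set z := ρ₀ γ • I with hz
  have happ : ∀ γ, dist I (ρ₀ γ • I) ≤ 18 * D + 22 →
      |dist I (ρ γ • I) - dist I (ρ₀ γ • I)| ≤ 1 := by
    intro γ hγ
    have h1 := hclose γ hγ
    have h2 := dist_triangle I (ρ γ • I) (ρ₀ γ • I)
    have h3 := dist_triangle_right I (ρ γ • I) (ρ₀ γ • I)
    rw [abs_le]
    constructor <;> linarith
  choose app hA using hD
  have hstep : ∀ p : UpperHalfPlane, ∃ q, ℓ ≤ dist p z → dist p q = ℓ ∧ dist q z = dist p z - ℓ := by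
    intro p
    by_cases h : ℓ ≤ dist p z
    · obtain ⟨q, h1, h2⟩ := exists_dist_eq_dist_eq p z hℓ0.le h
      exact ⟨q, fun _ => ⟨h1, h2⟩⟩
    · exact ⟨p, fun h' => absurd h' h⟩
  choose step hst using hstep
  let p : ℕ → UpperHalfPlane := fun i => step^[i] I
  have hp : ∀ i, p (i + 1) = step (p i) := fun i => Function.iterate_succ_apply' step i I
  set n := ⌊dist I z / ℓ⌋₊ with hn
  have hnle : n * ℓ ≤ dist I z := by
    have := Nat.floor_le (div_nonneg (dist_nonneg (x := I) (y := z)) hℓ0.le)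
    rwa [le_div_iff₀ hℓ0] at this
  have hnlt : dist I z < (n + 1) * ℓ := by
    have := Nat.lt_floor_add_one (dist I z / ℓ)
    rwa [div_lt_iff₀ hℓ0] at this
  have hpz : ∀ i ≤ n, dist (p i) z = dist I z - i * ℓ := by
    intro i
    induction i with
    | zero => intro _; simp [p]
    | succ i ih =>
      intro hi
      have h1 := ih (by omega)
      have h2 : ((i : ℝ) + 1) * ℓ ≤ n * ℓ := by
        have : ((i : ℝ) + 1) ≤ n := by exact_mod_cast hi
        exact mul_le_mul_of_nonneg_right this hℓ0.le
      rw [hp, (hst (p i) (by linarith)).2, h1]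
      push_cast; ring
  have hge : ∀ i < n, ℓ ≤ dist (p i) z := by
    intro i hi
    rw [hpz i hi.le]
    have h2 : ((i : ℝ) + 1) * ℓ ≤ n * ℓ := by
      have : ((i : ℝ) + 1) ≤ n := by exact_mod_cast hi
      exact mul_le_mul_of_nonneg_right this hℓ0.le
    linarith
  have hp1 : ∀ i < n, dist (p i) (p (i + 1)) = ℓ := fun i hi => by
    rw [hp]; exact (hst _ (hge i hi)).1
  have hp2 : ∀ i, i + 1 < n → 2 * ℓ ≤ dist (p i) (p (i + 2)) := by
    intro i hi
    have h1 := hpz i (by omega)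
    have h2 := hpz (i + 2) (by omega)
    have h3 := dist_triangle (p i) (p (i + 2)) z
    push_cast at h2
    linarith
  let c : ℕ → Γ := fun i => app (p i)
  have hc : ∀ i, dist (p i) (ρ₀ (c i) • I) ≤ D := fun i => hA (p i)
  -- distances between the approximating orbit points
  have hcomp : ∀ i j, |dist (ρ₀ (c i) • I) (ρ₀ (c j) • I) - dist (p i) (p j)| ≤ 2 * D := by
    intro i j
    have h1 := dist_triangle4 (ρ₀ (c i) • I) (p i) (p j) (ρ₀ (c j) • I)
    have h2 := dist_triangle4 (p i) (ρ₀ (c i) • I) (ρ₀ (c j) • I) (p j)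
    have h3 := hc i
    have h4 := hc j
    rw [dist_comm (ρ₀ (c i) • I) (p i)] at h1
    rw [dist_comm (ρ₀ (c j) • I) (p j)] at h2
    rw [abs_le]
    constructor <;> linarith
  have hcomp' : ∀ i j, dist (p i) (p j) ≤ 2 * ℓ →
      |dist (ρ (c i) • I) (ρ (c j) • I) - dist (p i) (p j)| ≤ 2 * D + 1 := by
    intro i j hij
    have h1 := abs_le.1 (hcomp i j)
    rw [dist_smul_eq ρ, abs_le]
    rw [dist_smul_eq ρ₀] at h1
    have h2 := abs_le.1 (happ ((c i)⁻¹ * c j) (by linarith))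
    constructor <;> linarith
  have hlin : n * ((ℓ - 2 * D - 1) - (6 * D + 3) - 6) ≤
      dist (ρ (c 0) • I) (ρ (c n) • I) := by
    refine le_dist_of_local_quasigeodesic dist_add_dist_le_max (by linarith) (by positivity)
      (by norm_num) (fun i => ρ (c i) • I) ?_ ?_
    · intro i hi
      have h1 := hp1 i hi
      have h2 := abs_le.1 (hcomp' i (i + 1) (by linarith))
      linarith
    · intro i hi
      have h1 := hp1 i (by omega)
      have h2 := hp1 (i + 1) (by omega)
      have h3 := hp2 i hi
      have h4 := abs_le.1 (hcomp' i (i + 1) (by linarith))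
      have h5 := abs_le.1 (hcomp' (i + 1) (i + 2) (by linarith))
      have h7 := dist_triangle (p i) (p (i + 1)) (p (i + 2))
      have h6 := abs_le.1 (hcomp' i (i + 2) (by linarith))
      change dist (ρ (c i) • I) (ρ (c (i + 1)) • I) + dist (ρ (c (i + 1)) • I) (ρ (c (i + 2)) • I)
        - (6 * D + 3) ≤ dist (ρ (c i) • I) (ρ (c (i + 2)) • I)
      linarith
  have hn1 : (n : ℝ) ≤ dist (ρ (c 0) • I) (ρ (c n) • I) := by
    refine le_trans (le_of_eq ?_) hlin
    rw [hℓ]; ring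
  -- the two ends of the chain
  have hend0 : dist I (ρ (c 0) • I) ≤ D + 1 := by
    have h1 : dist I (ρ₀ (c 0) • I) ≤ D := hc 0
    have h2 := abs_le.1 (happ (c 0) (by linarith))
    linarith
  have hend1 : dist (ρ (c n) • I) (ρ γ • I) ≤ ℓ + D + 1 := by
    have h1 : dist (ρ₀ (c n) • I) (ρ₀ γ • I) ≤ ℓ + D := by
      have h2 := dist_triangle_left (ρ₀ (c n) • I) (ρ₀ γ • I) (p n)
      have h3 := hc n
      have h4 := hpz n le_rfl
      rw [hz] at h4 hnlt
      linarith
    rw [dist_smul_eq] at h1 ⊢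
    have h2 := abs_le.1 (happ ((c n)⁻¹ * γ) (by linarith))
    linarith
  have h1 := dist_triangle4 (ρ (c 0) • I) I (ρ γ • I) (ρ (c n) • I)
  rw [dist_comm (ρ (c 0) • I) I, dist_comm (ρ γ • I) (ρ (c n) • I)] at h1
  have h2 : (n : ℝ) + 1 ≤ dist I (ρ γ • I) + (10 * D + 14) := by linarith
  calc dist I z ≤ (n + 1) * ℓ := hnlt.le
    _ ≤ (dist I (ρ γ • I) + (10 * D + 14)) * ℓ := mul_le_mul_of_nonneg_right h2 hℓ0.le
    _ = _ := mul_comm _ _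

/-- The orbit of a homomorphism close to `ρ₀` is still cobounded: the neighbourhood of radius `D + 1`
of the orbit is invariant under passing to neighbourhoods of radius one. -/
theorem hasDenseOrbit_of_close {ρ₀ ρ : Γ →* PSL2R} {D : ℝ} (hD : HasDenseOrbit ρ₀ D)
    (hclose : ∀ γ, dist I (ρ₀ γ • I) ≤ 2 * D + 2 → dist (ρ γ • I) (ρ₀ γ • I) ≤ 1) :
    HasDenseOrbit ρ (D + 1) := by
  set U : Set UpperHalfPlane := {x | ∃ γ, dist x (ρ γ • I) ≤ D + 1} with hU
  have hball : ∀ x, dist x I ≤ D + 2 → x ∈ U := by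
    intro x hx
    obtain ⟨γ, hγ⟩ := hD x
    have h1 := dist_triangle_left I (ρ₀ γ • I) x
    have h2 := hclose γ (by linarith)
    have h3 := dist_triangle_right x (ρ γ • I) (ρ₀ γ • I)
    exact ⟨γ, by linarith⟩
  have hnear : ∀ x ∈ U, ∀ y, dist x y < 1 → y ∈ U := by
    rintro x ⟨γ, hγ⟩ y hxy
    have h1 : dist ((ρ γ)⁻¹ • y) I ≤ D + 2 := by
      rw [← dist_smul (ρ γ), smul_inv_smul]
      have := dist_triangle_left y (ρ γ • I) x
      linarith
    obtain ⟨δ, hδ⟩ := hball _ h1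
    refine ⟨γ * δ, ?_⟩
    rw [map_mul, mul_smul, ← dist_smul (ρ γ)⁻¹, inv_smul_smul]
    exact hδ
  have hopen : IsOpen U := Metric.isOpen_iff.2 fun x hx => ⟨1, one_pos, fun y hy =>
    hnear x hx y (by rwa [dist_comm])⟩
  have hclosed : IsClosed U := by
    rw [← isOpen_compl_iff]
    exact Metric.isOpen_iff.2 fun x hx => ⟨1, one_pos, fun y hy hyU => hx (hnear y hyU x hy)⟩
  have huniv : U = univ := by
    refine IsClopen.eq_univ ⟨hclosed, hopen⟩ ⟨I, hball I ?_⟩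
    obtain ⟨γ, hγ⟩ := hD I
    rw [dist_self]
    linarith [dist_nonneg (x := I) (y := ρ₀ γ • I)]
  intro p
  have : p ∈ U := huniv ▸ mem_univ p
  exact this

/-- The space `Hom₀(Γ, PSL(2, ℝ))` is open among all homomorphisms, for the topology of pointwise
convergence. -/
theorem eventually_hom₀_property {α : Type*} {l : Filter α} {ρ : α → Γ →* PSL2R}
    (ρ₀ : Hom₀ Γ PSL2R) (h : ∀ γ, Tendsto (fun a => ρ a γ) l (𝓝 (ρ₀ γ))) :
    ∀ᶠ a in l, Function.Injective (ρ a) ∧ DiscreteTopology (ρ a).range ∧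
      CompactSpace (PSL2R ⧸ (ρ a).range) := by
  obtain ⟨D, hD⟩ := ρ₀.exists_hasDenseOrbit
  have hD0 : 0 ≤ D := by
    obtain ⟨γ, hγ⟩ := hD I
    exact dist_nonneg.trans hγ
  have hfin := ρ₀.hasFiniteBalls
  have hcont : Continuous fun g : PSL2R => g • I := continuous_id.smul continuous_const
  have h1 : ∀ γ, ∀ᶠ a in l, dist (ρ a γ • I) (ρ₀ γ • I) ≤ 1 := by
    intro γ
    have h2 : Tendsto (fun a => ρ a γ • I) l (𝓝 (ρ₀ γ • I)) :=
      (hcont.tendsto _).comp (h γ)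
    filter_upwards [h2 (Metric.closedBall_mem_nhds _ one_pos)] with a ha
    exact ha
  have h2 : ∀ γ, γ ≠ 1 → ∀ᶠ a in l, ρ a γ ≠ 1 := by
    intro γ hγ
    have h3 : ρ₀.1 γ ≠ 1 := by
      rw [← map_one ρ₀.1]
      exact ρ₀.2.1.ne hγ
    exact (h γ).eventually_ne h3
  have h3 : ∀ᶠ a in l, ∀ γ ∈ {γ : Γ | dist I (ρ₀.1 γ • I) ≤ 18 * D + 22},
      dist (ρ a γ • I) (ρ₀ γ • I) ≤ 1 := (eventually_all_finite (hfin _)).2 fun γ _ => h1 γ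
  have h4 : ∀ᶠ a in l, ∀ γ ∈ {γ : Γ | dist I (ρ₀.1 γ • I) ≤ (8 * D + 11) * (10 * D + 14)},
      γ ≠ 1 → ρ a γ ≠ 1 :=
    (eventually_all_finite (hfin _)).2 fun γ _ => eventually_imp_distrib_left.2 (h2 γ)
  filter_upwards [h3, h4] with a ha hb
  have hlow := dist_orbit_le_of_close (ρ := ρ a) hD0 hD ha
  refine hom₀_property ?_ ?_ (hasDenseOrbit_of_close (ρ := ρ a) hD fun γ hγ =>
    ha γ (hγ.trans (by linarith)))
  · rw [injective_iff_map_eq_one]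
    intro γ hγ
    by_contra hne
    refine hb γ ?_ hne hγ
    have h5 := hlow γ
    rw [hγ, one_smul, dist_self, zero_add] at h5
    exact h5
  · intro R
    refine (hfin ((8 * D + 11) * (R + (10 * D + 14)))).subset ?_
    intro γ hγ
    have h6 : dist I (ρ a γ • I) ≤ R := hγ
    exact (hlow γ).trans (mul_le_mul_of_nonneg_left (by linarith) (by positivity))

end Weil

open scoped Matrix

/-! ### Elements of cocompact discrete groups are hyperbolic -/

namespace PSL2R

theorem det_eq (A : SL(2, ℝ)) : A 0 0 * A 1 1 - A 0 1 * A 1 0 = 1 := by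
  rw [← Matrix.det_fin_two]; exact A.2

theorem denom_ne_zero (A : SL(2, ℝ)) (z : UpperHalfPlane) :
    (A 1 0 : ℂ) * z + (A 1 1 : ℂ) ≠ 0 := by
  intro h
  have h1 := congrArg Complex.im h
  have h2 := congrArg Complex.re h
  have h3 := det_eq A
  simp only [Complex.add_im, Complex.im_ofReal_mul, Complex.ofReal_im, add_zero, Complex.zero_im,
    Complex.add_re, Complex.re_ofReal_mul, Complex.ofReal_re, Complex.zero_re] at h1 h2
  have h4 : A 1 0 = 0 := by
    rcases mul_eq_zero.1 h1 with h | h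
    · exact h
    · exact absurd h z.im_pos.ne'
  rw [h4, zero_mul, zero_add] at h2
  rw [h4, h2] at h3
  simp at h3

theorem coe_smul_eq (A : SL(2, ℝ)) (z : UpperHalfPlane) :
    ((A • z : UpperHalfPlane) : ℂ) =
      ((A 0 0 : ℂ) * z + (A 0 1 : ℂ)) / ((A 1 0 : ℂ) * z + (A 1 1 : ℂ)) :=
  UpperHalfPlane.coe_specialLinearGroup_apply A z

/-- The displacement of a Möbius transformation in terms of its fixed point equation. -/
theorem cosh_dist_smul (A : SL(2, ℝ)) (z : UpperHalfPlane) :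
    Real.cosh (dist z (A • z)) = 1 +
      Complex.normSq (A 1 0 * (z : ℂ) ^ 2 + (A 1 1 - A 0 0) * z - A 0 1) / (2 * z.im ^ 2) := by
  have hd := denom_ne_zero A z
  have hz := z.im_pos
  have hn : 0 < Complex.normSq ((A 1 0 : ℂ) * z + (A 1 1 : ℂ)) := Complex.normSq_pos.2 hd
  have him : (A • z : UpperHalfPlane).im =
      z.im / Complex.normSq ((A 1 0 : ℂ) * z + (A 1 1 : ℂ)) := by
    have h1 : (A • z : UpperHalfPlane).im = ((A • z : UpperHalfPlane) : ℂ).im := rfl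
    rw [h1, coe_smul_eq, Complex.div_im]
    have h3 := det_eq A
    rw [← sub_div]
    congr 1
    simp
    linear_combination z.im * h3
  rw [UpperHalfPlane.cosh_dist, him, Complex.dist_eq, ← Complex.normSq_eq_norm_sq, coe_smul_eq]
  have h1 : (z : ℂ) - ((A 0 0 : ℂ) * z + (A 0 1 : ℂ)) / ((A 1 0 : ℂ) * z + (A 1 1 : ℂ)) =
      (A 1 0 * (z : ℂ) ^ 2 + (A 1 1 - A 0 0) * z - A 0 1) /
        ((A 1 0 : ℂ) * z + (A 1 1 : ℂ)) := by
    rw [eq_div_iff hd, sub_mul, div_mul_cancel₀ _ hd]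
    ring
  rw [h1, Complex.normSq_div]
  field_simp

theorem dist_lt_of_normSq_lt (A : SL(2, ℝ)) {z : UpperHalfPlane} {ε : ℝ} (hε : 0 < ε)
    (h : Complex.normSq (A 1 0 * (z : ℂ) ^ 2 + (A 1 1 - A 0 0) * z - A 0 1) / (2 * z.im ^ 2) <
      Real.cosh ε - 1) : dist z (A • z) < ε := by
  have h1 := cosh_dist_smul A z
  have h2 : Real.cosh (dist z (A • z)) < Real.cosh ε := by linarith
  rwa [Real.cosh_lt_cosh, abs_of_nonneg dist_nonneg, abs_of_pos hε] at h2

/-- A Möbius transformation which is not hyperbolic moves some points by arbitrarily little: points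
near a fixed point in the closed half plane. -/
theorem exists_dist_lt_of_trace_sq_le {A : SL(2, ℝ)} (h : (A 0 0 + A 1 1) ^ 2 ≤ 4) {ε : ℝ}
    (hε : 0 < ε) : ∃ z : UpperHalfPlane, dist z (A • z) < ε := by
  have hη : 0 < Real.cosh ε - 1 := by
    have := Real.one_lt_cosh.2 hε.ne'
    linarith
  set η := Real.cosh ε - 1
  have hdet := det_eq A
  by_cases hc : A 1 0 = 0
  · have had : A 1 1 = A 0 0 := by
      rw [hc, mul_zero, sub_zero] at hdet
      nlinarith [sq_nonneg (A 1 1 - A 0 0)]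
    obtain ⟨s, hs⟩ := exists_gt (max 1 (A 0 1 ^ 2 / η))
    have hs1 : 1 < s := (le_max_left _ _).trans_lt hs
    have hs2 : A 0 1 ^ 2 / η < s := (le_max_right _ _).trans_lt hs
    have him : 0 < (⟨0, s⟩ : ℂ).im := by change 0 < s; linarith
    refine ⟨⟨⟨0, s⟩, him⟩, dist_lt_of_normSq_lt A hε ?_⟩
    rw [hc, had]
    have h1 : Complex.normSq (((0 : ℝ) : ℂ) * (((⟨⟨0, s⟩, him⟩ : UpperHalfPlane) : ℂ)) ^ 2 +
        ((A 0 0 : ℂ) - A 0 0) * ((⟨⟨0, s⟩, him⟩ : UpperHalfPlane) : ℂ) - A 0 1) = A 0 1 ^ 2 := by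
      rw [sub_self, Complex.ofReal_zero, zero_mul, zero_mul, zero_add, zero_sub,
        Complex.normSq_neg, Complex.normSq_ofReal, sq]
    rw [h1]
    change A 0 1 ^ 2 / (2 * s ^ 2) < η
    rw [div_lt_iff₀ hη] at hs2
    rw [div_lt_iff₀ (by positivity)]
    nlinarith [mul_pos hη (by linarith : 0 < s)]
  · set r := (A 0 0 - A 1 1) / (2 * A 1 0) with hr
    obtain ⟨δ, hδ0, hδ⟩ : ∃ δ : ℝ, 0 < δ ∧ A 1 0 ^ 2 * δ < 2 * η := by
      refine ⟨η / A 1 0 ^ 2, by positivity, ?_⟩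
      field_simp
      linarith
    set q := (4 - (A 0 0 + A 1 1) ^ 2) / (4 * A 1 0 ^ 2) + δ with hq
    have hq1 : δ ≤ q := by
      have : 0 ≤ (4 - (A 0 0 + A 1 1) ^ 2) / (4 * A 1 0 ^ 2) :=
        div_nonneg (by linarith) (by positivity)
      linarith
    have hq0 : 0 < q := by linarith
    have hsq : √q ^ 2 = q := Real.sq_sqrt hq0.le
    have him : 0 < (⟨r, √q⟩ : ℂ).im := Real.sqrt_pos.2 hq0
    refine ⟨⟨⟨r, √q⟩, him⟩, dist_lt_of_normSq_lt A hε ?_⟩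
    have h1 : (A 1 0 : ℂ) * (((⟨⟨r, √q⟩, him⟩ : UpperHalfPlane) : ℂ)) ^ 2 +
        ((A 1 1 : ℂ) - A 0 0) * ((⟨⟨r, √q⟩, him⟩ : UpperHalfPlane) : ℂ) - A 0 1 =
        ((-(A 1 0 * δ) : ℝ) : ℂ) := by
      change (A 1 0 : ℂ) * (⟨r, √q⟩ : ℂ) ^ 2 + ((A 1 1 : ℂ) - A 0 0) * (⟨r, √q⟩ : ℂ) - A 0 1 = _
      apply Complex.ext
      · simp only [pow_two, Complex.sub_re, Complex.add_re, Complex.mul_re, Complex.ofReal_re,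
          Complex.ofReal_im, Complex.mul_im, Complex.sub_im]
        rw [← pow_two √q, hsq, hq, hr]
        field_simp
        linear_combination 16 * hdet
      · simp only [pow_two, Complex.sub_re, Complex.add_im, Complex.mul_re, Complex.ofReal_re,
          Complex.ofReal_im, Complex.mul_im, Complex.sub_im]
        rw [hr]
        field_simp
        ring
    rw [h1, Complex.normSq_ofReal]
    change -(A 1 0 * δ) * -(A 1 0 * δ) / (2 * √q ^ 2) < η
    rw [hsq, div_lt_iff₀ (by positivity)]
    nlinarith [mul_pos hη hδ0, mul_le_mul_of_nonneg_left hq1 hη.le]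

/-- The distance by which the point `i` is moved is bounded in terms of the matrix entries. -/
theorem dist_I_smul_le {A : SL(2, ℝ)} {c : ℝ} (h : ∀ i j, |A i j| ≤ c) :
    dist UpperHalfPlane.I (A • UpperHalfPlane.I) ≤ 2 * (1 + 4 * c ^ 2) := by
  have h1 := cosh_dist_smul A UpperHalfPlane.I
  set d := dist UpperHalfPlane.I (A • UpperHalfPlane.I) with hd
  have h2 : Complex.normSq (A 1 0 * ((UpperHalfPlane.I : UpperHalfPlane) : ℂ) ^ 2 +
      (A 1 1 - A 0 0) * ((UpperHalfPlane.I : UpperHalfPlane) : ℂ) - A 0 1) =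
      (A 1 0 + A 0 1) ^ 2 + (A 1 1 - A 0 0) ^ 2 := by
    rw [UpperHalfPlane.coe_I, Complex.I_sq, Complex.normSq_apply]
    simp
    ring
  rw [h2, UpperHalfPlane.I_im] at h1
  have h3 : d + 1 ≤ Real.exp d := Real.add_one_le_exp d
  have h4 : Real.cosh d = (Real.exp d + Real.exp (-d)) / 2 := Real.cosh_eq d
  have h5 := Real.exp_pos (-d)
  have hb : ∀ i j, A i j ^ 2 ≤ c ^ 2 := fun i j => sq_le_sq' (abs_le.1 (h i j)).1 (abs_le.1 (h i j)).2
  nlinarith [hb 0 0, hb 0 1, hb 1 0, hb 1 1, sq_nonneg (A 1 0 - A 0 1),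
    sq_nonneg (A 1 1 + A 0 0)]

end PSL2R

section Translation

open UpperHalfPlane PSL2R

variable {Γ : Type*} [Group Γ]

theorem smul_ne_of_hasFiniteBalls {ρ : Γ →* PSL2R} (hb : HasFiniteBalls ρ) {γ : Γ}
    (hγ : ∀ n : ℕ, 0 < n → γ ^ n ≠ 1) (z : UpperHalfPlane) : ρ γ • z ≠ z := by
  intro hz
  have hpow : ∀ n : ℕ, ρ (γ ^ n) • z = z := by
    intro n
    induction n with
    | zero => simp
    | succ n ih => rw [pow_succ, map_mul, mul_smul, hz, ih]
  have hinj : Function.Injective fun n : ℕ => γ ^ n := by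
    refine injective_pow_iff_not_isOfFinOrder.2 fun h => ?_
    obtain ⟨n, hn, hn1⟩ := isOfFinOrder_iff_pow_eq_one.1 h
    exact hγ n hn hn1
  refine Set.infinite_range_of_injective hinj ((hb (2 * dist I z)).subset ?_)
  rintro _ ⟨n, rfl⟩
  change dist I (ρ (γ ^ n) • I) ≤ 2 * dist I z
  have h1 := dist_triangle I z (ρ (γ ^ n) • I)
  have h2 : dist z (ρ (γ ^ n) • I) = dist z I := by
    conv_lhs => rw [← hpow n]
    rw [dist_smul]
  rw [h2, dist_comm z I] at h1
  linarith

/-- In a cocompact discrete group, the elements of infinite order have positive translation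
length. -/
theorem exists_le_dist_smul {ρ : Γ →* PSL2R} {D : ℝ} (hb : HasFiniteBalls ρ)
    (hD : HasDenseOrbit ρ D) {γ : Γ} (hγ : ∀ n : ℕ, 0 < n → γ ^ n ≠ 1) :
    ∃ ε > 0, ∀ z : UpperHalfPlane, ε ≤ dist z (ρ γ • z) := by
  have hfin : {β : Γ | dist I (ρ β • I) ≤ 2 * D + 1}.Finite := hb _
  have h1 : ∀ β : Γ, (∀ n : ℕ, 0 < n → β ^ n ≠ 1) → ∀ᶠ ε in 𝓝[>] (0 : ℝ),
      ∀ z ∈ Metric.closedBall I D, ε ≤ dist z (ρ β • z) := by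
    intro β hβ
    obtain ⟨ε, hε, hle⟩ := (isCompact_closedBall I D).exists_forall_le' (a := 0)
      (f := fun z => dist z (ρ β • z))
      (continuous_id.dist (continuous_const_smul (ρ β))).continuousOn fun z _ =>
        dist_pos.2 (smul_ne_of_hasFiniteBalls hb hβ z).symm
    filter_upwards [Ioo_mem_nhdsGT hε] with δ hδ z hz
    exact hδ.2.le.trans (hle z hz)
  have h2 : ∀ᶠ ε in 𝓝[>] (0 : ℝ), ∀ β ∈ {β : Γ | dist I (ρ β • I) ≤ 2 * D + 1},
      (∀ n : ℕ, 0 < n → β ^ n ≠ 1) → ∀ z ∈ Metric.closedBall I D, ε ≤ dist z (ρ β • z) :=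
    (eventually_all_finite hfin).2 fun β _ => eventually_imp_distrib_left.2 (h1 β)
  obtain ⟨ε, hε, hε1⟩ := (h2.and (Ioo_mem_nhdsGT (zero_lt_one' ℝ))).exists
  refine ⟨ε, hε1.1, fun z => ?_⟩
  -- conjugate so that the point lies in a fixed ball
  obtain ⟨δ, hδ⟩ := hD z
  by_contra! hlt
  set w := (ρ δ)⁻¹ • z with hw
  have hwD : dist w I ≤ D := by
    rw [hw, ← dist_smul (ρ δ), smul_inv_smul]
    exact hδ
  have hconj : dist w (ρ (δ⁻¹ * γ * δ) • w) = dist z (ρ γ • z) := by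
    rw [hw, map_mul, map_mul, map_inv, mul_smul, smul_inv_smul, mul_smul, dist_smul]
  refine absurd (hε (δ⁻¹ * γ * δ) ?_ ?_ w (Metric.mem_closedBall.2 hwD)) ?_
  · change dist I (ρ (δ⁻¹ * γ * δ) • I) ≤ 2 * D + 1
    have h3 := dist_triangle4 I w (ρ (δ⁻¹ * γ * δ) • w) (ρ (δ⁻¹ * γ * δ) • I)
    rw [dist_smul, dist_comm I w, hconj] at h3
    linarith [hε1.2]
  · intro n hn h4
    have h5 : (δ⁻¹ * γ * δ) ^ n = δ⁻¹ * γ ^ n * δ := by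
      have := conj_pow (a := δ⁻¹) (b := γ) (i := n)
      rwa [inv_inv] at this
    rw [h5] at h4
    refine hγ n hn ?_
    have h6 : γ ^ n = δ * (δ⁻¹ * γ ^ n * δ) * δ⁻¹ := by group
    rw [h6, h4]
    group
  · rw [hconj]
    exact not_le.2 hlt

/-- A discrete, faithful, cocompact representation sends elements of infinite order to hyperbolic
matrices. -/
theorem Hom₀.exists_rep_two_lt_trace (ρ : Hom₀ Γ PSL2R) {γ : Γ}
    (hγ : ∀ n : ℕ, 0 < n → γ ^ n ≠ 1) :
    ∃ A : SL(2, ℝ), mk A = ρ γ ∧ 2 < A 0 0 + A 1 1 := by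
  obtain ⟨D, hD⟩ := ρ.exists_hasDenseOrbit
  obtain ⟨ε, hε, h⟩ := exists_le_dist_smul ρ.hasFiniteBalls hD hγ
  obtain ⟨A, hA⟩ := mk_surjective (ρ γ)
  have h4 : 4 < (A 0 0 + A 1 1) ^ 2 := by
    by_contra! h4
    obtain ⟨z, hz⟩ := exists_dist_lt_of_trace_sq_le h4 hε
    have h5 := h z
    rw [show ρ.1 γ = mk A from hA.symm, mk_smul] at h5
    linarith
  rcases le_total 0 (A 0 0 + A 1 1) with h0 | h0
  · exact ⟨A, hA, by nlinarith⟩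
  · refine ⟨-A, (mk_neg A).trans hA, ?_⟩
    have h1 : (-A) 0 0 + (-A) 1 1 = -(A 0 0 + A 1 1) := by
      simp; ring
    rw [h1]
    nlinarith

end Translation

/-! ### Eigenvectors and attractive fixed points -/

namespace PSL2R

/-- `v` is an eigenvector of `A` for the eigenvalue `l`. -/
def IsEigenvector (A : SL(2, ℝ)) (l : ℝ) (v : Fin 2 → ℝ) : Prop :=
  v ≠ 0 ∧ (A : Matrix (Fin 2) (Fin 2) ℝ) *ᵥ v = l • v

/-- The determinant of two vectors of the plane. -/
def area (v w : Fin 2 → ℝ) : ℝ := v 0 * w 1 - v 1 * w 0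

/-- The point of `ℝ ∪ {∞}` with the homogeneous coordinates `v`. -/
noncomputable def boundaryPoint (v : Fin 2 → ℝ) : OnePoint ℝ :=
  if v 1 = 0 then OnePoint.infty else ((v 0 / v 1 : ℝ) : OnePoint ℝ)

theorem mulVec_apply_zero (A : SL(2, ℝ)) (v : Fin 2 → ℝ) :
    ((A : Matrix (Fin 2) (Fin 2) ℝ) *ᵥ v) 0 = A 0 0 * v 0 + A 0 1 * v 1 := by
  simp [Matrix.mulVec, dotProduct, Fin.sum_univ_two]

theorem mulVec_apply_one (A : SL(2, ℝ)) (v : Fin 2 → ℝ) :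
    ((A : Matrix (Fin 2) (Fin 2) ℝ) *ᵥ v) 1 = A 1 0 * v 0 + A 1 1 * v 1 := by
  simp [Matrix.mulVec, dotProduct, Fin.sum_univ_two]

theorem isEigenvector_iff {A : SL(2, ℝ)} {l : ℝ} {v : Fin 2 → ℝ} :
    IsEigenvector A l v ↔ v ≠ 0 ∧ A 0 0 * v 0 + A 0 1 * v 1 = l * v 0 ∧
      A 1 0 * v 0 + A 1 1 * v 1 = l * v 1 := by
  rw [IsEigenvector, funext_iff (f := (A : Matrix (Fin 2) (Fin 2) ℝ) *ᵥ v), Fin.forall_fin_two,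
    mulVec_apply_zero, mulVec_apply_one]
  rfl

theorem vec_eq_zero {v : Fin 2 → ℝ} (h0 : v 0 = 0) (h1 : v 1 = 0) : v = 0 := by
  ext i; fin_cases i <;> simpa

theorem IsEigenvector.trace_eq {A : SL(2, ℝ)} {l : ℝ} {v : Fin 2 → ℝ} (h : IsEigenvector A l v) :
    l * l + 1 = l * (A 0 0 + A 1 1) := by
  obtain ⟨hv, h0, h1⟩ := isEigenvector_iff.1 h
  have hd := det_eq A
  have e0 : (l * l + 1 - l * (A 0 0 + A 1 1)) * v 0 = 0 := by
    linear_combination -v 0 * hd - (l - A 1 1) * h0 - A 0 1 * h1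
  have e1 : (l * l + 1 - l * (A 0 0 + A 1 1)) * v 1 = 0 := by
    linear_combination -v 1 * hd - A 1 0 * h0 - (l - A 0 0) * h1
  by_contra hne
  have hne' : l * l + 1 - l * (A 0 0 + A 1 1) ≠ 0 := fun h => hne (by linarith)
  exact hv (vec_eq_zero ((mul_eq_zero.1 e0).resolve_left hne')
    ((mul_eq_zero.1 e1).resolve_left hne'))

theorem IsEigenvector.inv {A : SL(2, ℝ)} {l : ℝ} {v : Fin 2 → ℝ} (h : IsEigenvector A l v)
    (hl : l ≠ 0) : IsEigenvector A⁻¹ l⁻¹ v := by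
  refine ⟨h.1, ?_⟩
  have h2 : v = l⁻¹ • ((A : Matrix (Fin 2) (Fin 2) ℝ) *ᵥ v) := by
    rw [h.2, smul_smul, inv_mul_cancel₀ hl, one_smul]
  have h3 : ((A⁻¹ : SL(2, ℝ)) : Matrix (Fin 2) (Fin 2) ℝ) * A = 1 := by
    rw [← Matrix.SpecialLinearGroup.coe_mul, inv_mul_cancel, Matrix.SpecialLinearGroup.coe_one]
  conv_lhs => rw [h2, Matrix.mulVec_smul, Matrix.mulVec_mulVec, h3, Matrix.one_mulVec]

theorem IsEigenvector.conj {A : SL(2, ℝ)} {l : ℝ} {v : Fin 2 → ℝ} (h : IsEigenvector A l v)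
    (P : SL(2, ℝ)) :
    IsEigenvector (P * A * P⁻¹) l ((P : Matrix (Fin 2) (Fin 2) ℝ) *ᵥ v) := by
  have h3 : ((P⁻¹ : SL(2, ℝ)) : Matrix (Fin 2) (Fin 2) ℝ) * P = 1 := by
    rw [← Matrix.SpecialLinearGroup.coe_mul, inv_mul_cancel, Matrix.SpecialLinearGroup.coe_one]
  refine ⟨?_, ?_⟩
  · intro h0
    have h4 : ((P⁻¹ : SL(2, ℝ)) : Matrix (Fin 2) (Fin 2) ℝ) *ᵥ
        ((P : Matrix (Fin 2) (Fin 2) ℝ) *ᵥ v) = v := by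
      rw [Matrix.mulVec_mulVec, h3, Matrix.one_mulVec]
    rw [h0, Matrix.mulVec_zero] at h4
    exact h.1 h4.symm
  · rw [Matrix.SpecialLinearGroup.coe_mul, Matrix.SpecialLinearGroup.coe_mul,
      Matrix.mulVec_mulVec, mul_assoc, mul_assoc, h3, mul_one, ← Matrix.mulVec_mulVec, h.2,
      Matrix.mulVec_smul]

/-- Eigenvectors for different eigenvalues are independent. -/
theorem IsEigenvector.area_ne_zero {A : SL(2, ℝ)} {l m : ℝ} {v w : Fin 2 → ℝ}
    (hv : IsEigenvector A l v) (hw : IsEigenvector A m w) (hlm : l ≠ m) : area v w ≠ 0 := by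
  obtain ⟨hv0, h0, h1⟩ := isEigenvector_iff.1 hv
  obtain ⟨hw0, g0, g1⟩ := isEigenvector_iff.1 hw
  intro ha
  rw [area] at ha
  have hlm' : l - m ≠ 0 := sub_ne_zero.2 hlm
  -- if `w` were a multiple of `v`, both eigenvalue equations would hold for it
  have key : ∀ i j, (l - m) * (v i * w j) = 0 := by
    have e0 : (l - m) * (v 0 * w 0) = 0 := by
      linear_combination (-w 0) * h0 + v 0 * g0 - A 0 1 * ha
    have e1 : (l - m) * (v 1 * w 1) = 0 := by
      linear_combination (-w 1) * h1 + v 1 * g1 + A 1 0 * ha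
    have e2 : (l - m) * (v 0 * w 1) = 0 := by
      linear_combination (1 / 2) * ((-w 1) * h0 + v 0 * g1 - w 0 * h1 + v 1 * g0 +
        (A 0 0 - A 1 1) * ha + (l - m) * ha)
    have e3 : (l - m) * (v 1 * w 0) = 0 := by
      linear_combination (1 / 2) * ((-w 1) * h0 + v 0 * g1 - w 0 * h1 + v 1 * g0 +
        (A 0 0 - A 1 1) * ha - (l - m) * ha)
    intro i j
    fin_cases i <;> fin_cases j
    exacts [e0, e2, e3, e1]
  have key' : ∀ i j, v i * w j = 0 := fun i j => (mul_eq_zero.1 (key i j)).resolve_left hlm'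
  obtain ⟨i, hi⟩ := Function.ne_iff.1 hv0
  obtain ⟨j, hj⟩ := Function.ne_iff.1 hw0
  exact mul_ne_zero hi hj (key' i j)

/-- If `l` solves the characteristic equation, then the columns of `A - l⁻¹` are eigenvectors or
zero. -/
theorem isEigenvector_sub {A : SL(2, ℝ)} {l m : ℝ} (hlm : l * m = 1)
    (ht : l + m = A 0 0 + A 1 1) {e : Fin 2 → ℝ}
    (he : (A : Matrix (Fin 2) (Fin 2) ℝ) *ᵥ e - m • e ≠ 0) :
    IsEigenvector A l ((A : Matrix (Fin 2) (Fin 2) ℝ) *ᵥ e - m • e) := by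
  have hd := det_eq A
  refine isEigenvector_iff.2 ⟨he, ?_, ?_⟩
  · simp only [Pi.sub_apply, mulVec_apply_zero, mulVec_apply_one, Pi.smul_apply, smul_eq_mul]
    linear_combination (-(A 0 0 * e 0 + A 0 1 * e 1)) * ht - e 0 * hd + e 0 * hlm
  · simp only [Pi.sub_apply, mulVec_apply_zero, mulVec_apply_one, Pi.smul_apply, smul_eq_mul]
    linear_combination (-(A 1 0 * e 0 + A 1 1 * e 1)) * ht - e 1 * hd + e 1 * hlm

theorem exists_mulVec_sub_ne_zero (A : SL(2, ℝ)) {m : ℝ} (hm : m * m ≠ 1) :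
    ∃ e : Fin 2 → ℝ, (A : Matrix (Fin 2) (Fin 2) ℝ) *ᵥ e - m • e ≠ 0 := by
  by_contra! h
  have h1 := h ![1, 0]
  have h2 := h ![0, 1]
  have a0 := congrFun h1 0
  have a1 := congrFun h1 1
  have b0 := congrFun h2 0
  have b1 := congrFun h2 1
  simp only [Pi.sub_apply, mulVec_apply_zero, mulVec_apply_one, Pi.smul_apply, smul_eq_mul] at *
  simp at a0 a1 b0 b1
  have hd := det_eq A
  rw [a1, sub_eq_zero.1 a0, sub_eq_zero.1 b1] at hd
  exact hm (by linarith)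

theorem IsEigenvector.exists_inv {A : SL(2, ℝ)} {l : ℝ} {v : Fin 2 → ℝ}
    (h : IsEigenvector A l v) (hl : 1 < l) : ∃ u, IsEigenvector A l⁻¹ u := by
  have hl0 : l ≠ 0 := by positivity
  obtain ⟨e, he⟩ := exists_mulVec_sub_ne_zero A (m := l) (by nlinarith)
  refine ⟨_, isEigenvector_sub (inv_mul_cancel₀ hl0) ?_ he⟩
  have := h.trace_eq
  field_simp
  linarith

theorem IsEigenvector.smul_point {A : SL(2, ℝ)} {l : ℝ} {v : Fin 2 → ℝ}
    (h : IsEigenvector A l v) (hl : l ≠ 0) (z : UpperHalfPlane) :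
    ((v 1 : ℂ) * (A • z : UpperHalfPlane) - v 0) * ((A 1 0 : ℂ) * z + (A 1 1 : ℂ)) =
      (l : ℂ)⁻¹ * ((v 1 : ℂ) * z - v 0) := by
  obtain ⟨-, h0, h1⟩ := isEigenvector_iff.1 h
  have hd := det_eq A
  have hl' : (l : ℂ) ≠ 0 := by exact_mod_cast hl
  have h0' : (A 0 0 : ℂ) * v 0 + A 0 1 * v 1 = l * v 0 := by exact_mod_cast h0
  have h1' : (A 1 0 : ℂ) * v 0 + A 1 1 * v 1 = l * v 1 := by exact_mod_cast h1
  have hd' : (A 0 0 : ℂ) * A 1 1 - A 0 1 * A 1 0 = 1 := by exact_mod_cast hd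
  rw [coe_smul_eq, sub_mul, mul_assoc, div_mul_cancel₀ _ (denom_ne_zero A z),
    eq_inv_mul_iff_mul_eq₀ hl']
  linear_combination ((v 1 : ℂ) * z - v 0) * hd' -
    ((A 0 0 : ℂ) * z + A 0 1) * h1' + ((A 1 0 : ℂ) * z + A 1 1) * h0'

theorem point_ne_zero {v : Fin 2 → ℝ} (hv : v ≠ 0) (z : UpperHalfPlane) :
    (v 1 : ℂ) * z - v 0 ≠ 0 := by
  intro h
  have h1 := congrArg Complex.im h
  have h2 := congrArg Complex.re h
  simp only [Complex.sub_im, Complex.im_ofReal_mul, Complex.ofReal_im, sub_zero, Complex.zero_im,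
    Complex.sub_re, Complex.re_ofReal_mul, Complex.ofReal_re, Complex.zero_re] at h1 h2
  have h3 : v 1 = 0 := (mul_eq_zero.1 h1).resolve_right z.im_pos.ne'
  rw [h3, zero_mul, zero_sub, neg_eq_zero] at h2
  exact hv (vec_eq_zero h2 h3)

/-- The attractive fixed point of a hyperbolic matrix is given by the eigenvector for the large
eigenvalue: in the coordinate which sends the fixed points to `0` and `∞`, the matrix acts as
multiplication by `l⁻²`. -/
theorem IsEigenvector.isAttractiveFixedPoint {A : SL(2, ℝ)} {l : ℝ} {v : Fin 2 → ℝ}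
    (h : IsEigenvector A l v) (hl : 1 < l) :
    IsAttractiveFixedPoint (mk A) (boundaryPoint v) := by
  intro z
  obtain ⟨u, hu⟩ := h.exists_inv hl
  have hl0 : l ≠ 0 := by positivity
  let ζ : ℕ → UpperHalfPlane := fun n => (mk A) ^ n • z
  have hζ : ∀ n, ζ (n + 1) = A • ζ n := fun n => by
    change (mk A) ^ (n + 1) • z = mk A • (mk A) ^ n • z
    rw [pow_succ', mul_smul]
  let r : ℕ → ℂ := fun n => ((v 1 : ℂ) * ζ n - v 0) / ((u 1 : ℂ) * ζ n - u 0)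
  have hr : ∀ n, r (n + 1) = ((l : ℂ)⁻¹ * (l : ℂ)⁻¹) * r n := by
    intro n
    have h1 := h.smul_point hl0 (ζ n)
    have h2 := hu.smul_point (inv_ne_zero hl0) (ζ n)
    have h3 := denom_ne_zero A (ζ n)
    have h4 := point_ne_zero hu.1 (ζ n)
    have h5 := point_ne_zero hu.1 (A • ζ n)
    have hl' : (l : ℂ) ≠ 0 := by exact_mod_cast hl0
    simp only [r, hζ]
    rw [Complex.ofReal_inv, inv_inv] at h2
    rw [← mul_div_mul_right _ _ h3, h1, h2]
    field_simp
  have hrn : ∀ n, r n = ((l : ℂ)⁻¹ * (l : ℂ)⁻¹) ^ n * r 0 := by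
    intro n
    induction n with
    | zero => simp
    | succ n ih => rw [hr, ih, pow_succ']; ring
  have hlim : Tendsto r atTop (𝓝 0) := by
    have h1 : ‖(l : ℂ)⁻¹ * (l : ℂ)⁻¹‖ < 1 := by
      rw [norm_mul, norm_inv, Complex.norm_real, Real.norm_of_nonneg (by positivity), ← mul_inv]
      exact inv_lt_one_of_one_lt₀ (by nlinarith)
    have h2 := (tendsto_pow_atTop_nhds_zero_of_norm_lt_one h1).mul_const (r 0)
    rw [zero_mul] at h2
    exact h2.congr fun n => (hrn n).symm
  have heq : ∀ n, (v 1 - r n * u 1) * (ζ n : ℂ) = v 0 - r n * u 0 := by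
    intro n
    have h4 := point_ne_zero hu.1 (ζ n)
    have h5 : r n * ((u 1 : ℂ) * ζ n - u 0) = (v 1 : ℂ) * ζ n - v 0 := div_mul_cancel₀ _ h4
    linear_combination -h5
  have hc1 : Tendsto (fun n => (v 1 : ℂ) - r n * u 1) atTop (𝓝 (v 1)) := by
    simpa using tendsto_const_nhds.sub (hlim.mul_const (u 1 : ℂ))
  have hc0 : Tendsto (fun n => (v 0 : ℂ) - r n * u 0) atTop (𝓝 (v 0)) := by
    simpa using tendsto_const_nhds.sub (hlim.mul_const (u 0 : ℂ))
  change Tendsto (fun n => ((ζ n : ℂ) : OnePoint ℂ)) atTop _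
  by_cases hv1 : v 1 = 0
  · rw [boundaryPoint, if_pos hv1]
    change Tendsto _ _ (𝓝 (OnePoint.infty : OnePoint ℂ))
    have hv0 : (v 0 : ℂ) ≠ 0 := by
      intro h0
      exact h.1 (vec_eq_zero (by exact_mod_cast h0) hv1)
    refine OnePoint.tendsto_coe_infty.comp (f := fun n => (ζ n : ℂ)) ?_
    rw [Filter.coclosedCompact_eq_cocompact, ← Metric.cobounded_eq_cocompact]
    have hne : ∀ n, (ζ n : ℂ) ≠ 0 := fun n h0 => by
      have := congrArg Complex.im h0
      exact (ζ n).im_pos.ne' this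
    have hinv : Tendsto (fun n => ((ζ n : ℂ))⁻¹) atTop (𝓝[≠] 0) := by
      refine tendsto_nhdsWithin_iff.2 ⟨?_, Eventually.of_forall fun n => inv_ne_zero (hne n)⟩
      have h1 : Tendsto (fun n => ((v 1 : ℂ) - r n * u 1) / (v 0 - r n * u 0)) atTop (𝓝 0) := by
        have h2 : (v 1 : ℂ) / v 0 = 0 := by simp [hv1]
        rw [← h2]
        exact hc1.div hc0 hv0
      refine h1.congr' ?_
      filter_upwards [hc0.eventually_ne hv0] with n hn
      rw [div_eq_iff hn, ← heq n, hv1]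
      field_simp [hne n]
    have := Filter.tendsto_inv₀_nhdsNE_zero.comp hinv
    simpa [Function.comp_def] using this
  · rw [boundaryPoint, if_neg hv1]
    change Tendsto _ _ (𝓝 (((v 0 / v 1 : ℝ) : ℂ) : OnePoint ℂ))
    have hv1' : (v 1 : ℂ) ≠ 0 := by exact_mod_cast hv1
    refine (OnePoint.continuous_coe.tendsto _).comp (f := fun n => (ζ n : ℂ)) ?_
    rw [Complex.ofReal_div]
    refine (hc0.div hc1 hv1').congr' ?_
    filter_upwards [hc1.eventually_ne hv1'] with n hn
    rw [Pi.div_apply, div_eq_iff hn, ← heq n]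
    ring

theorem IsAttractiveFixedPoint.unique {γ : PSL2R} {x y : OnePoint ℝ}
    (hx : IsAttractiveFixedPoint γ x) (hy : IsAttractiveFixedPoint γ y) : x = y := by
  have h := tendsto_nhds_unique (hx UpperHalfPlane.I) (hy UpperHalfPlane.I)
  induction x using OnePoint.rec with
  | infty =>
    induction y using OnePoint.rec with
    | infty => rfl
    | coe y => exact absurd h.symm (OnePoint.coe_ne_infty _)
  | coe x =>
    induction y using OnePoint.rec with
    | infty => exact absurd h (OnePoint.coe_ne_infty _)
    | coe y =>
      have h1 : (x : ℂ) = (y : ℂ) := OnePoint.coe_injective h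
      rw [Complex.ofReal_inj] at h1
      rw [h1]

theorem IsEigenvector.isAttractiveFixedPoint_iff {A : SL(2, ℝ)} {l : ℝ} {v : Fin 2 → ℝ}
    (h : IsEigenvector A l v) (hl : 1 < l) {x : OnePoint ℝ} :
    IsAttractiveFixedPoint (mk A) x ↔ boundaryPoint v = x :=
  ⟨fun hx => (h.isAttractiveFixedPoint hl).unique hx, fun hx => hx ▸ h.isAttractiveFixedPoint hl⟩

theorem boundaryPoint_eq_infty {v : Fin 2 → ℝ} : boundaryPoint v = OnePoint.infty ↔ v 1 = 0 := by
  rw [boundaryPoint]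
  split_ifs with h
  · simp [h]
  · simp [h]

theorem boundaryPoint_eq_coe {v : Fin 2 → ℝ} {x : ℝ} :
    boundaryPoint v = (x : OnePoint ℝ) ↔ v 1 ≠ 0 ∧ v 0 = x * v 1 := by
  rw [boundaryPoint]
  split_ifs with h
  · simp [h]
  · rw [OnePoint.coe_eq_coe, div_eq_iff h]
    simp [h]

end PSL2R

/-! ### The first two generators of a surface group -/

theorem map_commutatorProduct {G H : Type*} [Group G] [Group H] (φ : G →* H) (g : ℕ)
    (p : Fin g ⊕ Fin g → G) :
    φ (commutatorProduct g p) = commutatorProduct g fun s => φ (p s) := by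
  rw [commutatorProduct, commutatorProduct, map_list_prod, List.map_ofFn]
  congr 2
  funext i
  simp

namespace SurfaceGroup

/-- The surface group of genus at least two maps to any group generated by two elements `x`, `y`,
with `a₁ ↦ x` and `b₁ ↦ y`: the second handle cancels the commutator of the first one. -/
theorem exists_hom {g : ℕ} (hg : 2 ≤ g) {G : Type*} [Group G] (x y : G) :
    ∃ φ : SurfaceGroup g →* G, φ (PresentedGroup.of (Sum.inl (firstIndex hg))) = x ∧
      φ (PresentedGroup.of (Sum.inr (firstIndex hg))) = y := by
  obtain ⟨n, rfl⟩ : ∃ n, g = n + 2 := ⟨g - 2, by omega⟩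
  let f : Fin (n + 2) ⊕ Fin (n + 2) → G := Sum.elim
    (Fin.cons x (Fin.cons y fun _ => 1)) (Fin.cons y (Fin.cons x fun _ => 1))
  have hf : ∀ r ∈ ({commutatorProduct (n + 2) FreeGroup.of} :
      Set (FreeGroup (Fin (n + 2) ⊕ Fin (n + 2)))), FreeGroup.lift f r = 1 := by
    rintro _ rfl
    rw [map_commutatorProduct, commutatorProduct, List.ofFn_succ, List.ofFn_succ]
    simp only [List.prod_cons, FreeGroup.lift_apply_of, f, Sum.elim_inl, Sum.elim_inr,
      Fin.cons_succ, Fin.cons_zero, mul_one, inv_one, List.ofFn_const, List.prod_replicate,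
      one_pow]
    group
  refine ⟨PresentedGroup.toGroup hf, ?_, ?_⟩
  · rw [PresentedGroup.toGroup.of]; rfl
  · rw [PresentedGroup.toGroup.of]; rfl

theorem exists_pow_not_commute :
    ∃ x y : SL(2, ℤ), ∀ k : ℕ, 0 < k → ¬ Commute (x ^ k) y ∧ ¬ Commute (y ^ k) x := by
  let x : SL(2, ℤ) := ⟨!![1, 1; 0, 1], by simp⟩
  let y : SL(2, ℤ) := ⟨!![1, 0; 1, 1], by simp⟩
  have hx : ∀ k : ℕ, ((x ^ k : SL(2, ℤ)) : Matrix (Fin 2) (Fin 2) ℤ) = !![1, (k : ℤ); 0, 1] := by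
    intro k
    induction k with
    | zero => simp [Matrix.one_fin_two]
    | succ k ih =>
      rw [pow_succ, Matrix.SpecialLinearGroup.coe_mul, ih]
      simp [x, add_comm]
  have hy : ∀ k : ℕ, ((y ^ k : SL(2, ℤ)) : Matrix (Fin 2) (Fin 2) ℤ) = !![1, 0; (k : ℤ), 1] := by
    intro k
    induction k with
    | zero => simp [Matrix.one_fin_two]
    | succ k ih =>
      rw [pow_succ, Matrix.SpecialLinearGroup.coe_mul, ih]
      simp [y]
  refine ⟨x, y, fun k hk => ⟨fun h => ?_, fun h => ?_⟩⟩
  · have h1 := congrArg (fun A : SL(2, ℤ) => A 0 0) h.eq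
    simp only [Matrix.SpecialLinearGroup.coe_mul, hx] at h1
    simp [y] at h1
    omega
  · have h1 := congrArg (fun A : SL(2, ℤ) => A 0 0) h.eq
    simp only [Matrix.SpecialLinearGroup.coe_mul, hy] at h1
    simp [x] at h1
    omega

/-- The powers of `a₁` and `b₁` do not commute with the other one of these generators. -/
theorem not_commute_pow {g : ℕ} (hg : 2 ≤ g) {k : ℕ} (hk : 0 < k) :
    ¬ Commute ((PresentedGroup.of (Sum.inl (firstIndex hg)) : SurfaceGroup g) ^ k)
        (PresentedGroup.of (Sum.inr (firstIndex hg))) ∧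
      ¬ Commute ((PresentedGroup.of (Sum.inr (firstIndex hg)) : SurfaceGroup g) ^ k)
        (PresentedGroup.of (Sum.inl (firstIndex hg))) := by
  obtain ⟨x, y, h⟩ := exists_pow_not_commute
  obtain ⟨φ, rfl, rfl⟩ := exists_hom hg x y
  refine ⟨fun hc => (h k hk).1 ?_, fun hc => (h k hk).2 ?_⟩
  · rw [← map_pow]; exact hc.map φ
  · rw [← map_pow]; exact hc.map φ

end SurfaceGroup

namespace PSL2R

theorem area_smul_eq (v u e : Fin 2 → ℝ) : area v u • e = area e u • v + area v e • u := by
  ext i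
  fin_cases i <;> simp [area] <;> ring

theorem area_comm (v w : Fin 2 → ℝ) : area v w = -area w v := by rw [area, area]; ring

theorem IsEigenvector.of_area_eq_zero {A : SL(2, ℝ)} {l : ℝ} {v w : Fin 2 → ℝ}
    (h : IsEigenvector A l w) (hv : v ≠ 0) (ha : area v w = 0) : IsEigenvector A l v := by
  obtain ⟨hw, h0, h1⟩ := isEigenvector_iff.1 h
  rw [area] at ha
  refine isEigenvector_iff.2 ⟨hv, ?_⟩
  by_cases hw0 : w 0 = 0
  · have hw1 : w 1 ≠ 0 := fun hw1 => hw (vec_eq_zero hw0 hw1)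
    constructor
    · refine mul_left_cancel₀ hw1 ?_
      linear_combination v 1 * h0 + (A 0 0 - l) * ha
    · refine mul_left_cancel₀ hw1 ?_
      linear_combination v 1 * h1 + A 1 0 * ha
  · constructor
    · refine mul_left_cancel₀ hw0 ?_
      linear_combination v 0 * h0 - A 0 1 * ha
    · refine mul_left_cancel₀ hw0 ?_
      linear_combination v 0 * h1 - (A 1 1 - l) * ha

theorem IsEigenvector.pow {A : SL(2, ℝ)} {l : ℝ} {v : Fin 2 → ℝ} (h : IsEigenvector A l v)
    (n : ℕ) : IsEigenvector (A ^ n) (l ^ n) v := by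
  refine ⟨h.1, ?_⟩
  induction n with
  | zero => simp
  | succ n ih =>
    rw [pow_succ, Matrix.SpecialLinearGroup.coe_mul, ← Matrix.mulVec_mulVec, h.2,
      Matrix.mulVec_smul, ih, smul_smul, pow_succ, mul_comm]

/-- If `B` fixes the attractive fixed point of `A`, then the conjugates `A⁻ⁿ B Aⁿ` stay in a
bounded set. -/
theorem exists_conj_pow_le {A B : SL(2, ℝ)} {l m : ℝ} {v u : Fin 2 → ℝ} (hl : 1 < l)
    (hv : IsEigenvector A l v) (hu : IsEigenvector A l⁻¹ u) (hB : IsEigenvector B m v) :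
    ∃ c, ∀ (n : ℕ) (i j : Fin 2), |((A ^ n)⁻¹ * B * A ^ n) i j| ≤ c := by
  have hl0 : l ≠ 0 := by positivity
  have ha : area v u ≠ 0 := hv.area_ne_zero hu fun h => by
    have := inv_lt_one_of_one_lt₀ hl
    linarith
  set a := area v u with ha'
  set b := (B : Matrix (Fin 2) (Fin 2) ℝ) *ᵥ u with hb
  have key : ∀ (e : Fin 2 → ℝ) (i : Fin 2), ∃ c, ∀ n : ℕ,
      |(((A ^ n)⁻¹ * B * A ^ n : SL(2, ℝ)) : Matrix (Fin 2) (Fin 2) ℝ).mulVec e i| ≤ c := by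
    intro e i
    refine ⟨(|a * (area e u * (m * v i))| + |area v e * (area b u * v i)| +
      |area v e * (area v b * u i)|) / (a * a), fun n => ?_⟩
    set t := l⁻¹ ^ n * l⁻¹ ^ n with ht
    have ht0 : 0 ≤ t := by positivity
    have ht1 : t ≤ 1 := by
      have : l⁻¹ ^ n ≤ 1 := pow_le_one₀ (by positivity) (inv_lt_one_of_one_lt₀ hl).le
      have h0 : 0 ≤ l⁻¹ ^ n := by positivity
      nlinarith
    have hln : l⁻¹ ^ n * l ^ n = 1 := by rw [← mul_pow, inv_mul_cancel₀ hl0, one_pow]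
    have hv1 := (hv.pow n).2
    have hu1 := (hu.pow n).2
    have hv2 := ((hv.pow n).inv (pow_ne_zero n hl0)).2
    have hu2 := ((hu.pow n).inv (pow_ne_zero n (inv_ne_zero hl0))).2
    rw [← inv_pow (a := l)] at hv2
    rw [← inv_pow (a := l⁻¹), inv_inv (a := l)] at hu2
    have hCv : (((A ^ n)⁻¹ * B * A ^ n : SL(2, ℝ)) : Matrix (Fin 2) (Fin 2) ℝ) *ᵥ v = m • v := by
      rw [Matrix.SpecialLinearGroup.coe_mul, Matrix.SpecialLinearGroup.coe_mul,
        ← Matrix.mulVec_mulVec, ← Matrix.mulVec_mulVec, hv1, Matrix.mulVec_smul, hB.2,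
        Matrix.mulVec_smul, Matrix.mulVec_smul, hv2, smul_smul, smul_smul]
      congr 1
      linear_combination m * hln
    have hCu : a • ((((A ^ n)⁻¹ * B * A ^ n : SL(2, ℝ)) : Matrix (Fin 2) (Fin 2) ℝ) *ᵥ u) =
        (t * area b u) • v + area v b • u := by
      rw [Matrix.SpecialLinearGroup.coe_mul, Matrix.SpecialLinearGroup.coe_mul,
        ← Matrix.mulVec_mulVec, ← Matrix.mulVec_mulVec, hu1, Matrix.mulVec_smul, ← hb,
        Matrix.mulVec_smul, smul_comm, ← Matrix.mulVec_smul, ha', area_smul_eq v u b,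
        Matrix.mulVec_add, Matrix.mulVec_smul, Matrix.mulVec_smul, hv2, hu2, smul_add, smul_smul,
        smul_smul, smul_smul, smul_smul]
      congr 2
      · rw [ht]; ring
      · linear_combination area v b * hln
    have hCe : (a * a) * ((((A ^ n)⁻¹ * B * A ^ n : SL(2, ℝ)) : Matrix (Fin 2) (Fin 2) ℝ) *ᵥ e) i =
        a * (area e u * (m * v i)) + t * (area v e * (area b u * v i)) +
          area v e * (area v b * u i) := by
      have h1 : a • ((((A ^ n)⁻¹ * B * A ^ n : SL(2, ℝ)) : Matrix (Fin 2) (Fin 2) ℝ) *ᵥ (a • e)) =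
          a • (area e u • m • v) + area v e • ((t * area b u) • v + area v b • u) := by
        rw [ha', area_smul_eq v u e, ← ha', Matrix.mulVec_add, Matrix.mulVec_smul,
          Matrix.mulVec_smul, hCv, smul_add, smul_comm a (area v e), hCu]
      have h2 := congrFun h1 i
      rw [Matrix.mulVec_smul] at h2
      simp only [Pi.smul_apply, Pi.add_apply, smul_eq_mul] at h2
      linear_combination h2
    have haa : 0 < a * a := mul_self_pos.2 ha
    rw [le_div_iff₀ haa, ← abs_of_pos haa, ← abs_mul, mul_comm, hCe]
    refine (abs_add_le _ _).trans (add_le_add_left ((abs_add_le _ _).trans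
      (add_le_add_right ?_ _)) _)
    rw [abs_mul, abs_of_nonneg ht0]
    exact mul_le_of_le_one_left (abs_nonneg _) ht1
  have key' : ∀ i j : Fin 2, ∃ c, ∀ n : ℕ, |((A ^ n)⁻¹ * B * A ^ n) i j| ≤ c := by
    intro i j
    obtain ⟨c, hc⟩ := key (Pi.single j 1) i
    refine ⟨c, fun n => ?_⟩
    have := hc n
    rwa [Matrix.mulVec_single_one] at this
  choose c hc using key'
  refine ⟨∑ i, ∑ j, |c i j|, fun n i j => ((hc i j n).trans (le_abs_self _)).trans ?_⟩
  refine (Finset.single_le_sum (f := fun j => |c i j|) (fun _ _ => abs_nonneg _)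
    (Finset.mem_univ j)).trans ?_
  exact Finset.single_le_sum (f := fun i => ∑ j, |c i j|)
    (fun _ _ => Finset.sum_nonneg fun _ _ => abs_nonneg _) (Finset.mem_univ i)

/-- The larger root of the characteristic polynomial of a matrix of determinant one and trace
`t ≥ 2`. -/
noncomputable def largeRoot (t : ℝ) : ℝ := (t + √(t ^ 2 - 4)) / 2

theorem one_lt_largeRoot {t : ℝ} (h : 2 < t) : 1 < largeRoot t := by
  have := Real.sqrt_nonneg (t ^ 2 - 4)
  rw [largeRoot]
  linarith

theorem largeRoot_add_inv {t : ℝ} (h : 2 < t) : largeRoot t + (largeRoot t)⁻¹ = t := by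
  have h1 : √(t ^ 2 - 4) ^ 2 = t ^ 2 - 4 := Real.sq_sqrt (by nlinarith)
  have h2 : largeRoot t ≠ 0 := by linarith [one_lt_largeRoot h]
  field_simp
  rw [largeRoot]
  linear_combination h1 / 4

theorem exists_isEigenvector_of_two_lt {A : SL(2, ℝ)} (h : 2 < A 0 0 + A 1 1) :
    ∃ (l : ℝ) (v : Fin 2 → ℝ), 1 < l ∧ IsEigenvector A l v := by
  have h1 := one_lt_largeRoot h
  have h2 : largeRoot (A 0 0 + A 1 1) ≠ 0 := by linarith
  have h3 := inv_lt_one_of_one_lt₀ h1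
  have h4 : 0 < (largeRoot (A 0 0 + A 1 1))⁻¹ := by positivity
  obtain ⟨e, he⟩ := exists_mulVec_sub_ne_zero A (m := (largeRoot (A 0 0 + A 1 1))⁻¹)
    (by nlinarith)
  exact ⟨_, _, h1, isEigenvector_sub (mul_inv_cancel₀ h2) (largeRoot_add_inv h) he⟩

end PSL2R

open PSL2R

theorem exists_commute_pow {Γ : Type*} [Group Γ] {ρ : Γ →* PSL2R} (hb : HasFiniteBalls ρ)
    {a b : Γ} {A B : SL(2, ℝ)} (hA : mk A = ρ a) (hB : mk B = ρ b) {c : ℝ}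
    (h : ∀ (n : ℕ) (i j : Fin 2), |((A ^ n)⁻¹ * B * A ^ n) i j| ≤ c) :
    ∃ k : ℕ, 0 < k ∧ Commute (a ^ k) b := by
  have hpow : ∀ n : ℕ, mk (A ^ n) = ρ (a ^ n) := by
    intro n
    induction n with
    | zero => rw [pow_zero, pow_zero, map_one]; rfl
    | succ n ih => rw [pow_succ, pow_succ, map_mul, mk_mul, ih, hA]
  have hmem : ∀ n : ℕ, (a ^ n)⁻¹ * b * a ^ n ∈
      {γ | dist UpperHalfPlane.I (ρ γ • UpperHalfPlane.I) ≤ 2 * (1 + 4 * c ^ 2)} := by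
    intro n
    have h1 : ρ ((a ^ n)⁻¹ * b * a ^ n) = mk ((A ^ n)⁻¹ * B * A ^ n) := by
      rw [map_mul, map_mul, map_inv, mk_mul, mk_mul, mk_inv, hpow, hB]
    rw [mem_ofPred_eq, h1, mk_smul]
    exact dist_I_smul_le (h n)
  have hfin := hb (2 * (1 + 4 * c ^ 2))
  obtain ⟨n, k, hnk, heq⟩ : ∃ n k : ℕ, n < k ∧
      (a ^ n)⁻¹ * b * a ^ n = (a ^ k)⁻¹ * b * a ^ k := by
    by_contra! hne
    refine Set.infinite_range_of_injective (f := fun n : ℕ => (a ^ n)⁻¹ * b * a ^ n) ?_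
      (hfin.subset (range_subset_iff.2 hmem))
    intro n k hnk
    rcases lt_trichotomy n k with h | h | h
    · exact absurd hnk (hne n k h)
    · exact h
    · exact absurd hnk.symm (hne k n h)
  refine ⟨k - n, by omega, ?_⟩
  have hk : a ^ k = a ^ (k - n) * a ^ n := by rw [← pow_add]; congr 1; omega
  rw [hk] at heq
  have h2 : (a ^ n)⁻¹ * b * a ^ n = (a ^ n)⁻¹ * ((a ^ (k - n))⁻¹ * b * a ^ (k - n)) * a ^ n := by
    rw [heq]; group
  have h3 := mul_left_cancel (mul_right_cancel h2)
  change a ^ (k - n) * b = b * a ^ (k - n)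
  conv_lhs => rw [h3]
  group

/-- For a discrete, faithful, cocompact representation of a surface group, the generators `a₁` and
`b₁` go to hyperbolic matrices. -/
theorem Hom₀.exists_eigenvectors {g : ℕ} (hg : 2 ≤ g) (ρ : Hom₀ (SurfaceGroup g) PSL2R) :
    ∃ (A B : SL(2, ℝ)) (l m : ℝ) (v u w : Fin 2 → ℝ),
      mk A = ρ (PresentedGroup.of (Sum.inl (firstIndex hg))) ∧
      mk B = ρ (PresentedGroup.of (Sum.inr (firstIndex hg))) ∧ 1 < l ∧ 1 < m ∧
      IsEigenvector A l v ∧ IsEigenvector A l⁻¹ u ∧ IsEigenvector B m w := by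
  have hinf : ∀ n : ℕ, 0 < n →
      (PresentedGroup.of (Sum.inl (firstIndex hg)) : SurfaceGroup g) ^ n ≠ 1 ∧
      (PresentedGroup.of (Sum.inr (firstIndex hg)) : SurfaceGroup g) ^ n ≠ 1 := by
    intro n hn
    have h := SurfaceGroup.not_commute_pow hg hn
    refine ⟨fun h1 => h.1 ?_, fun h1 => h.2 ?_⟩
    · rw [h1]; exact Commute.one_left _
    · rw [h1]; exact Commute.one_left _
  obtain ⟨A, hA, htA⟩ := ρ.exists_rep_two_lt_trace fun n hn => (hinf n hn).1
  obtain ⟨B, hB, htB⟩ := ρ.exists_rep_two_lt_trace fun n hn => (hinf n hn).2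
  obtain ⟨l, v, hl, hv⟩ := exists_isEigenvector_of_two_lt htA
  obtain ⟨m, w, hm, hw⟩ := exists_isEigenvector_of_two_lt htB
  obtain ⟨u, hu⟩ := hv.exists_inv hl
  exact ⟨A, B, l, m, v, u, w, hA, hB, hl, hm, hv, hu, hw⟩

/-- The attractive fixed point of `ρ(b₁)` is not a fixed point of `ρ(a₁)`. -/
theorem Hom₀.area_ne_zero {g : ℕ} (hg : 2 ≤ g) (ρ : Hom₀ (SurfaceGroup g) PSL2R)
    {A B : SL(2, ℝ)} {l m : ℝ} {v u w : Fin 2 → ℝ}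
    (hA : mk A = ρ (PresentedGroup.of (Sum.inl (firstIndex hg))))
    (hB : mk B = ρ (PresentedGroup.of (Sum.inr (firstIndex hg)))) (hl : 1 < l)
    (hv : IsEigenvector A l v) (hu : IsEigenvector A l⁻¹ u) (hw : IsEigenvector B m w) :
    area v w ≠ 0 ∧ area u w ≠ 0 := by
  have hl0 : l ≠ 0 := by positivity
  refine ⟨fun h => ?_, fun h => ?_⟩
  · obtain ⟨c, hc⟩ := exists_conj_pow_le hl hv hu (hw.of_area_eq_zero hv.1 h)
    obtain ⟨k, hk, hcomm⟩ := exists_commute_pow ρ.hasFiniteBalls hA hB hc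
    exact (SurfaceGroup.not_commute_pow hg hk).1 hcomm
  · have hv' := hv.inv hl0
    have hu' := hu.inv (inv_ne_zero hl0)
    rw [inv_inv] at hu'
    obtain ⟨c, hc⟩ := exists_conj_pow_le hl hu' hv' (hw.of_area_eq_zero hu.1 h)
    have hA' : mk A⁻¹ = ρ.1 (PresentedGroup.of (Sum.inl (firstIndex hg)))⁻¹ := by
      rw [map_inv, mk_inv, hA]
    obtain ⟨k, hk, hcomm⟩ := exists_commute_pow ρ.hasFiniteBalls hA' hB hc
    rw [inv_pow] at hcomm
    exact (SurfaceGroup.not_commute_pow hg hk).1 (Commute.inv_left_iff.1 hcomm)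

/-! ### The differential of the product of commutators -/

namespace PSL2R

/-- The transvection `1 + t N`, where `N` is the nilpotent matrix `x ↦ area x v • v`. -/
def transvection (v : Fin 2 → ℝ) (t : ℝ) : SL(2, ℝ) :=
  ⟨!![1 + t * (v 0 * v 1), -(t * v 0 ^ 2); t * v 1 ^ 2, 1 - t * (v 0 * v 1)], by
    rw [Matrix.det_fin_two_of]; ring⟩

theorem transvection_conj (P : SL(2, ℝ)) (v : Fin 2 → ℝ) (t : ℝ) :
    P * transvection v t * P⁻¹ =
      transvection ((P : Matrix (Fin 2) (Fin 2) ℝ) *ᵥ v) t := by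
  have hd := det_eq P
  rw [mul_inv_eq_iff_eq_mul]
  ext i j
  rw [Matrix.SpecialLinearGroup.coe_mul, Matrix.SpecialLinearGroup.coe_mul, Matrix.mul_apply,
    Matrix.mul_apply, Fin.sum_univ_two, Fin.sum_univ_two]
  fin_cases i <;> fin_cases j <;> simp [transvection] <;> rw [← sub_eq_zero]
  · linear_combination (-t * v 1 * (P 0 0 * v 0 + P 0 1 * v 1)) * hd
  · linear_combination (t * v 0 * (P 0 0 * v 0 + P 0 1 * v 1)) * hd
  · linear_combination (-t * v 1 * (P 1 0 * v 0 + P 1 1 * v 1)) * hd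
  · linear_combination (t * v 0 * (P 1 0 * v 0 + P 1 1 * v 1)) * hd

theorem transvection_inv (v : Fin 2 → ℝ) (t : ℝ) :
    (transvection v t)⁻¹ = transvection v (-t) := by
  ext i j
  rw [Matrix.SpecialLinearGroup.coe_inv, Matrix.adjugate_fin_two]
  fin_cases i <;> fin_cases j <;> simp [transvection, sub_eq_add_neg]

theorem transvection_zero (v : Fin 2 → ℝ) : transvection v 0 = 1 := by
  ext i j
  fin_cases i <;> fin_cases j <;> simp [transvection]

theorem contMDiff_mk_transvection (v : Fin 2 → ℝ) :
    ContMDiff 𝓘(ℝ) (𝓡 3) ∞ fun t : ℝ => mk (transvection v t) := by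
  have h : ∀ i j, ContDiff ℝ ∞ fun t : ℝ => transvection v t i j := by
    intro i j
    fin_cases i <;> fin_cases j <;> simp [transvection] <;> fun_prop
  refine contMDiff_of_quad (continuous_mk.comp (continuous_induced_rng.2 ?_)) fun i j k l => ?_
  · exact continuous_matrix fun i j => (h i j).continuous
  · exact ((h i j).mul (h k l)).contMDiff

/-- The derivative of a product of two transvections in the chart around the identity. -/
theorem hasDerivAt_transvection_mul (v w : Fin 2 → ℝ) :
    HasDerivAt (fun t : ℝ => baseChart (mk (transvection v t * transvection w (-t))))
      (!₂[2 * (v 0 * v 1 - w 0 * w 1), w 0 ^ 2 - v 0 ^ 2, v 1 ^ 2 - w 1 ^ 2] :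
        EuclideanSpace ℝ (Fin 3)) 0 := by
  have hpoly : ∀ (f : ℝ → ℝ) (a b c : ℝ), (∀ t, f t = a + b * t + c * t ^ 2) →
      HasDerivAt f b 0 := by
    intro f a b c hf
    have h1 : HasDerivAt (fun t : ℝ => a + b * t + c * t ^ 2) (b * 1 + c * (2 * 0)) 0 := by
      have h2 := (((hasDerivAt_id (0 : ℝ)).const_mul b).const_add a).add
        (((hasDerivAt_id (0 : ℝ)).pow 2).const_mul c)
      exact h2.congr_deriv (by simp)
    rw [funext hf]
    simpa using h1
  set P : ℝ → SL(2, ℝ) := fun t => transvection v t * transvection w (-t) with hP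
  have hP0 : P 0 = 1 := by rw [hP]; simp [transvection_zero]
  have h00 : HasDerivAt (fun t => P t 0 0) (v 0 * v 1 - w 0 * w 1) 0 := by
    refine hpoly _ 1 _ (v 0 ^ 2 * w 1 ^ 2 - v 0 * v 1 * (w 0 * w 1)) fun t => ?_
    rw [hP, Matrix.SpecialLinearGroup.coe_mul, Matrix.mul_apply, Fin.sum_univ_two]
    simp [transvection]
    ring
  have h01 : HasDerivAt (fun t => P t 0 1) (w 0 ^ 2 - v 0 ^ 2) 0 := by
    refine hpoly _ 0 _ (v 0 * v 1 * w 0 ^ 2 - v 0 ^ 2 * (w 0 * w 1)) fun t => ?_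
    rw [hP, Matrix.SpecialLinearGroup.coe_mul, Matrix.mul_apply, Fin.sum_univ_two]
    simp [transvection]
    ring
  have h10 : HasDerivAt (fun t => P t 1 0) (v 1 ^ 2 - w 1 ^ 2) 0 := by
    refine hpoly _ 0 _ (v 0 * v 1 * w 1 ^ 2 - v 1 ^ 2 * (w 0 * w 1)) fun t => ?_
    rw [hP, Matrix.SpecialLinearGroup.coe_mul, Matrix.mul_apply, Fin.sum_univ_two]
    simp [transvection]
    ring
  rw [hasDerivAt_iff_hasFDerivAt, ← hasFDerivWithinAt_univ, hasFDerivWithinAt_euclidean]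
  intro i
  rw [hasFDerivWithinAt_univ, hasFDerivAt_iff_hasDerivAt]
  fin_cases i
  · have h := h00.mul h00
    rw [hP0] at h
    refine h.congr_deriv ?_
    simp
    ring
  · have h := h00.mul h01
    rw [hP0] at h
    refine h.congr_deriv ?_
    simp
  · have h := h00.mul h10
    rw [hP0] at h
    refine h.congr_deriv ?_
    simp

/-- The velocity of the image of a curve, in the chart around its starting point, lies in the
range of the differential. -/
theorem exists_mfderiv_eq {E H M : Type*} [NormedAddCommGroup E] [NormedSpace ℝ E]
    [TopologicalSpace H] {I : ModelWithCorners ℝ E H} [TopologicalSpace M] [ChartedSpace H M]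
    {R : M → PSL2R} {c : ℝ → M} {p : M} (hcp : c 0 = p) (hc : MDifferentiableAt 𝓘(ℝ) I c 0)
    (hR : MDifferentiableAt I (𝓡 3) R p) {d : EuclideanSpace ℝ (Fin 3)}
    (hd : HasDerivAt (fun t => baseChart ((R p)⁻¹ * R (c t))) d 0) :
    ∃ ξ : E, (mfderiv I (𝓡 3) R p : E →L[ℝ] EuclideanSpace ℝ (Fin 3)) ξ = d := by
  subst hcp
  have h2 := (hR.hasMFDerivAt.comp (0 : ℝ) hc.hasMFDerivAt).2
  rw [modelWithCornersSelf_coe, range_id] at h2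
  obtain ⟨D, hD⟩ : ∃ D : E →L[ℝ] EuclideanSpace ℝ (Fin 3), D = mfderiv I (𝓡 3) R (c 0) :=
    ⟨_, rfl⟩
  obtain ⟨C, hC⟩ : ∃ C : ℝ →L[ℝ] E, C = mfderiv 𝓘(ℝ) I c 0 := ⟨_, rfl⟩
  have h3 : HasFDerivAt (fun t => baseChart ((R (c 0))⁻¹ * R (c t))) (D.comp C) 0 := by
    rw [hD, hC]
    exact hasFDerivWithinAt_univ.1 h2
  refine ⟨C 1, ?_⟩
  rw [← hD]
  have h4 := DFunLike.congr_fun (h3.unique hd.hasFDerivAt) (1 : ℝ)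
  have h5 : D (C 1) = d := by simpa using h4
  exact h5

/-- Two matrices of determinant one which preserve the same nonzero quadratic form on the plane
commute. -/
theorem commute_of_quadratic_eq {A B : SL(2, ℝ)} {Q : (Fin 2 → ℝ) → ℝ} {α β γ : ℝ}
    (hQ : ∀ v, Q v = α * v 0 ^ 2 + β * (v 0 * v 1) + γ * v 1 ^ 2)
    (h0 : ¬ (α = 0 ∧ β = 0 ∧ γ = 0))
    (hA : ∀ v, Q ((A : Matrix (Fin 2) (Fin 2) ℝ) *ᵥ v) = Q v)
    (hB : ∀ v, Q ((B : Matrix (Fin 2) (Fin 2) ℝ) *ᵥ v) = Q v) : Commute A B := by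
  -- the traceless part of a matrix preserving the form is determined up to a factor
  have key : ∀ C : SL(2, ℝ), (∀ v, Q ((C : Matrix (Fin 2) (Fin 2) ℝ) *ᵥ v) = Q v) →
      α * (C 0 0 - C 1 1) + β * C 1 0 = 0 ∧ α * C 0 1 + γ * C 1 0 = 0 ∧
        β * C 0 1 = γ * (C 0 0 - C 1 1) := by
    intro C hC
    have hd := det_eq C
    have e1 := hC ![1, 0]
    have e2 := hC ![0, 1]
    have e3 := hC ![1, 1]
    simp only [hQ, mulVec_apply_zero, mulVec_apply_one] at e1 e2 e3
    simp at e1 e2 e3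
    have e4 : 2 * α * C 0 0 * C 0 1 + β * (C 0 0 * C 1 1 + C 0 1 * C 1 0) +
        2 * γ * C 1 0 * C 1 1 = β := by linear_combination e3 - e1 - e2
    refine ⟨?_, ?_, ?_⟩
    · linear_combination C 1 1 * e1 - C 1 0 / 2 * e4 - (C 0 0 * α + β * C 1 0 / 2) * hd
    · linear_combination C 1 1 / 2 * e4 - C 1 0 * e2 - (α * C 0 1 + β * C 1 1 / 2) * hd
    · linear_combination -C 0 1 / 2 * e4 + C 0 0 * e2 - (β * C 0 1 / 2 + γ * C 1 1) * hd
  obtain ⟨a1, a2, a3⟩ := key A hA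
  obtain ⟨b1, b2, b3⟩ := key B hB
  have hp : (A 0 0 - A 1 1) * B 0 1 = A 0 1 * (B 0 0 - B 1 1) ∧
      (A 0 0 - A 1 1) * B 1 0 = A 1 0 * (B 0 0 - B 1 1) ∧ A 0 1 * B 1 0 = A 1 0 * B 0 1 := by
    by_cases hα : α = 0
    · by_cases hγ : γ = 0
      · have hβ : β ≠ 0 := fun hβ => h0 ⟨hα, hβ, hγ⟩
        simp only [hα, hγ, zero_mul, zero_add, mul_eq_zero, hβ, false_or] at a1 a3 b1 b3
        simp [a1, a3, b1, b3]
      · refine ⟨mul_left_cancel₀ hγ ?_, mul_left_cancel₀ (mul_ne_zero hγ hγ) ?_,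
          mul_left_cancel₀ hγ ?_⟩
        · linear_combination -B 0 1 * a3 + A 0 1 * b3
        · linear_combination -γ * B 1 0 * a3 + β * A 0 1 * b2 + γ * A 1 0 * b3 - β * B 0 1 * a2
        · linear_combination A 0 1 * b2 - B 0 1 * a2
    · refine ⟨mul_left_cancel₀ (mul_ne_zero hα hα) ?_, mul_left_cancel₀ hα ?_,
        mul_left_cancel₀ hα ?_⟩
      · linear_combination α * B 0 1 * a1 - β * A 1 0 * b2 - α * A 0 1 * b1 + β * B 1 0 * a2
      · linear_combination B 1 0 * a1 - A 1 0 * b1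
      · linear_combination B 1 0 * a2 - A 1 0 * b2
  obtain ⟨h1, h2, h3⟩ := hp
  change A * B = B * A
  ext i j
  rw [Matrix.SpecialLinearGroup.coe_mul, Matrix.SpecialLinearGroup.coe_mul, Matrix.mul_apply,
    Matrix.mul_apply, Fin.sum_univ_two, Fin.sum_univ_two]
  fin_cases i <;> fin_cases j
  · change A 0 0 * B 0 0 + A 0 1 * B 1 0 = B 0 0 * A 0 0 + B 0 1 * A 1 0
    linear_combination h3
  · change A 0 0 * B 0 1 + A 0 1 * B 1 1 = B 0 0 * A 0 1 + B 0 1 * A 1 1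
    linear_combination h1
  · change A 1 0 * B 0 0 + A 1 1 * B 1 0 = B 1 0 * A 0 0 + B 1 1 * A 1 0
    linear_combination -h2
  · change A 1 0 * B 0 1 + A 1 1 * B 1 1 = B 1 0 * A 0 1 + B 1 1 * A 1 1
    linear_combination -h3

end PSL2R

section CommutatorProduct

open PSL2R

theorem commutatorProduct_succ {G : Type*} [Group G] (n : ℕ) (p : Fin (n + 1) ⊕ Fin (n + 1) → G) :
    commutatorProduct (n + 1) p =
      p (Sum.inl 0) * p (Sum.inr 0) * (p (Sum.inl 0))⁻¹ * (p (Sum.inr 0))⁻¹ *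
        commutatorProduct n fun s => p (Sum.map Fin.succ Fin.succ s) := by
  rw [commutatorProduct, List.ofFn_succ, List.prod_cons]
  rfl

theorem contMDiff_commutatorProduct (g : ℕ) :
    ContMDiff (ModelWithCorners.pi fun _ : Fin g ⊕ Fin g => 𝓡 3) (𝓡 3) ∞
      (commutatorProduct (G := PSL2R) g) := by
  have h : ∀ (n : ℕ) (f : Fin n → (Fin g ⊕ Fin g → PSL2R) → PSL2R),
      (∀ i, ContMDiff (ModelWithCorners.pi fun _ : Fin g ⊕ Fin g => 𝓡 3) (𝓡 3) ∞ (f i)) →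
      ContMDiff (ModelWithCorners.pi fun _ : Fin g ⊕ Fin g => 𝓡 3) (𝓡 3) ∞
        fun p => (List.ofFn fun i => f i p).prod := by
    intro n
    induction n with
    | zero => intro f _; simpa using contMDiff_const
    | succ n ih =>
      intro f hf
      simp only [List.ofFn_succ, List.prod_cons]
      exact (hf 0).mul (ih (fun i => f i.succ) fun i => hf i.succ)
  refine h g _ fun i => ?_
  have h1 := contMDiff_pi_proj (M := fun _ : Fin g ⊕ Fin g => PSL2R)
    (I := fun _ : Fin g ⊕ Fin g => 𝓡 3) (Sum.inl i)
  have h2 := contMDiff_pi_proj (M := fun _ : Fin g ⊕ Fin g => PSL2R)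
    (I := fun _ : Fin g ⊕ Fin g => 𝓡 3) (Sum.inr i)
  exact ((h1.mul h2).mul h1.inv).mul h2.inv

/-- The differential of the product of commutators is onto at every tuple whose first two entries
do not commute. A covector which vanishes on its range is a quadratic form `Q` on the plane, by
pairing it with the nilpotent matrices `x ↦ area x v • v`; moving the first two entries by
transvections shows that a translate of `Q` is invariant under both entries. -/
theorem surjective_mfderiv_commutatorProduct {g : ℕ} (hg : 2 ≤ g)
    {p : Fin g ⊕ Fin g → PSL2R}
    (hp : ¬ Commute (p (Sum.inl (firstIndex hg))) (p (Sum.inr (firstIndex hg)))) :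
    Function.Surjective (mfderiv (ModelWithCorners.pi fun _ : Fin g ⊕ Fin g => 𝓡 3) (𝓡 3)
      (commutatorProduct (G := PSL2R) g) p) := by
  obtain ⟨n, rfl⟩ : ∃ n, g = n + 1 := ⟨g - 1, by omega⟩
  change ¬ Commute (p (Sum.inl 0)) (p (Sum.inr 0)) at hp
  set R := commutatorProduct (G := PSL2R) (n + 1) with hR
  obtain ⟨A, hA⟩ := mk_surjective (p (Sum.inl 0))
  obtain ⟨B, hB⟩ := mk_surjective (p (Sum.inr 0))
  obtain ⟨W, hW⟩ := mk_surjective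
    (commutatorProduct n fun s => p (Sum.map Fin.succ Fin.succ s))
  have hRp : R p = mk (A * B * A⁻¹ * B⁻¹ * W) := by
    rw [hR, commutatorProduct_succ, ← hA, ← hB, ← hW]; rfl
  have hdiff : MDifferentiableAt (ModelWithCorners.pi fun _ : Fin (n + 1) ⊕ Fin (n + 1) => 𝓡 3)
      (𝓡 3) R p := (contMDiff_commutatorProduct (n + 1) p).mdifferentiableAt (by simp)
  let L : (Fin (n + 1) ⊕ Fin (n + 1) → EuclideanSpace ℝ (Fin 3)) →L[ℝ] EuclideanSpace ℝ (Fin 3) :=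
    mfderiv (ModelWithCorners.pi fun _ : Fin (n + 1) ⊕ Fin (n + 1) => 𝓡 3) (𝓡 3) R p
  change Function.Surjective L
  -- a curve through `p` which moves only one of the first two entries
  have hcurve : ∀ (s : Fin (n + 1) ⊕ Fin (n + 1)) (P : SL(2, ℝ)) (hP : mk P = p s)
      (v x y : Fin 2 → ℝ), (∀ t, (R p)⁻¹ * R (Function.update p s (mk (P * transvection v t))) =
        mk (transvection x t * transvection y (-t))) →
      (!₂[2 * (x 0 * x 1 - y 0 * y 1), y 0 ^ 2 - x 0 ^ 2, x 1 ^ 2 - y 1 ^ 2] :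
        EuclideanSpace ℝ (Fin 3)) ∈ LinearMap.range L.toLinearMap := by
    intro s P hP v x y h
    have hc : ContMDiff 𝓘(ℝ) (ModelWithCorners.pi fun _ : Fin (n + 1) ⊕ Fin (n + 1) => 𝓡 3) ∞
        fun t : ℝ => Function.update p s (mk (P * transvection v t)) := by
      refine contMDiff_pi_of_components fun i => ?_
      by_cases hi : i = s
      · subst hi
        simp only [Function.update_self]
        exact (contMDiff_const (c := mk P)).mul (contMDiff_mk_transvection v)
      · simp only [Function.update_of_ne hi]
        exact contMDiff_const
    refine exists_mfderiv_eq (c := fun t : ℝ => Function.update p s (mk (P * transvection v t)))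
      ?_ ((hc 0).mdifferentiableAt (by simp)) hdiff ?_
    · simp [transvection_zero, hP]
    · simp only [h]
      exact hasDerivAt_transvection_mul x y
  have htail : ∀ (s : Fin (n + 1) ⊕ Fin (n + 1)) (y : PSL2R), (s = Sum.inl 0 ∨ s = Sum.inr 0) →
      (commutatorProduct n fun s' => Function.update p s y (Sum.map Fin.succ Fin.succ s')) =
        mk W := by
    intro s y hs
    rw [hW]
    congr 1
    funext s'
    refine Function.update_of_ne ?_ _ _
    rcases hs with rfl | rfl <;> rcases s' with i | i <;> simp
  have hI := fun v => hcurve (Sum.inl 0) A hA v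
    (((W⁻¹ * B * A * B⁻¹ : SL(2, ℝ)) : Matrix (Fin 2) (Fin 2) ℝ) *ᵥ v)
    (((W⁻¹ * B * A : SL(2, ℝ)) : Matrix (Fin 2) (Fin 2) ℝ) *ᵥ v) (fun t => by
      rw [hRp, hR, commutatorProduct_succ, htail _ _ (Or.inl rfl), Function.update_self,
        Function.update_of_ne (by simp), ← hB, ← transvection_conj, ← transvection_conj,
        ← transvection_inv]
      simp only [← mk_mul, ← mk_inv]
      congr 1
      group)
  have hJ := fun v => hcurve (Sum.inr 0) B hB v
    (((W⁻¹ * B * A : SL(2, ℝ)) : Matrix (Fin 2) (Fin 2) ℝ) *ᵥ v)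
    (((W⁻¹ * B : SL(2, ℝ)) : Matrix (Fin 2) (Fin 2) ℝ) *ᵥ v) (fun t => by
      rw [hRp, hR, commutatorProduct_succ, htail _ _ (Or.inr rfl), Function.update_self,
        Function.update_of_ne (by simp), ← hA, ← transvection_conj, ← transvection_conj,
        ← transvection_inv]
      simp only [← mk_mul, ← mk_inv]
      congr 1
      group)
  change Function.Surjective L.toLinearMap
  rw [← LinearMap.range_eq_top]
  by_contra hlt
  obtain ⟨φ, hφ0, hφ⟩ := Submodule.exists_le_ker_of_lt_top _ (lt_top_iff_ne_top.2 hlt)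
  have hφ' : ∀ a b c : ℝ, φ !₂[a, b, c] = a * φ (EuclideanSpace.single 0 1) +
      b * φ (EuclideanSpace.single 1 1) + c * φ (EuclideanSpace.single 2 1) := by
    intro a b c
    have h1 : (!₂[a, b, c] : EuclideanSpace ℝ (Fin 3)) = a • EuclideanSpace.single 0 1 +
        b • EuclideanSpace.single 1 1 + c • EuclideanSpace.single 2 1 := by
      ext i; fin_cases i <;> simp
    rw [h1]
    simp
  let Q : (Fin 2 → ℝ) → ℝ := fun v => -φ (EuclideanSpace.single 1 1) * v 0 ^ 2 +
    2 * φ (EuclideanSpace.single 0 1) * (v 0 * v 1) + φ (EuclideanSpace.single 2 1) * v 1 ^ 2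
  have hQ : ∀ x y : Fin 2 → ℝ,
      (!₂[2 * (x 0 * x 1 - y 0 * y 1), y 0 ^ 2 - x 0 ^ 2, x 1 ^ 2 - y 1 ^ 2] :
        EuclideanSpace ℝ (Fin 3)) ∈ LinearMap.range L.toLinearMap →
      Q x = Q y := by
    intro x y h
    have h1 := LinearMap.mem_ker.1 (hφ h)
    rw [hφ'] at h1
    simp only [Q]
    linear_combination h1
  set D : SL(2, ℝ) := W⁻¹ * B with hD
  have hmul : ∀ (P P' : SL(2, ℝ)) (v : Fin 2 → ℝ), (P : Matrix (Fin 2) (Fin 2) ℝ) *ᵥ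
      ((P' : Matrix (Fin 2) (Fin 2) ℝ) *ᵥ v) =
        ((P * P' : SL(2, ℝ)) : Matrix (Fin 2) (Fin 2) ℝ) *ᵥ v := by
    intro P P' v
    rw [Matrix.SpecialLinearGroup.coe_mul, Matrix.mulVec_mulVec]
  have hone : ∀ v : Fin 2 → ℝ, ((1 : SL(2, ℝ)) : Matrix (Fin 2) (Fin 2) ℝ) *ᵥ v = v := fun v => by
    rw [Matrix.SpecialLinearGroup.coe_one, Matrix.one_mulVec]
  have hQA : ∀ v, Q (((D * A * D⁻¹ : SL(2, ℝ)) : Matrix (Fin 2) (Fin 2) ℝ) *ᵥ v) = Q v := by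
    intro v
    have h1 := hQ _ _ (hJ (((D⁻¹ : SL(2, ℝ)) : Matrix (Fin 2) (Fin 2) ℝ) *ᵥ v))
    rwa [hmul, hmul, mul_inv_cancel, hone] at h1
  have hQB : ∀ v, Q (((D * B * D⁻¹ : SL(2, ℝ)) : Matrix (Fin 2) (Fin 2) ℝ) *ᵥ v) = Q v := by
    intro v
    have h1 := hQ _ _ (hI (((B * D⁻¹ : SL(2, ℝ)) : Matrix (Fin 2) (Fin 2) ℝ) *ᵥ v))
    have h2 : D * A * B⁻¹ * (B * D⁻¹) = D * A * D⁻¹ := by group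
    have h3 : D * A * (B * D⁻¹) = D * A * D⁻¹ * (D * B * D⁻¹) := by group
    rw [hmul, hmul, h2, h3, ← hmul (D * A * D⁻¹), hQA, hQA] at h1
    exact h1.symm
  have hcomm : Commute (D * A * D⁻¹) (D * B * D⁻¹) := by
    refine commute_of_quadratic_eq (fun v => rfl) ?_ hQA hQB
    rintro ⟨h1, h2, h3⟩
    refine hφ0 (LinearMap.ext fun x => ?_)
    have h4 : x = !₂[x 0, x 1, x 2] := by ext i; fin_cases i <;> rfl
    have h5 : φ (EuclideanSpace.single 0 1) = 0 := by linarith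
    have h6 : φ (EuclideanSpace.single 1 1) = 0 := by linarith
    rw [h4, hφ', h3, h5, h6]
    simp
  have hAB : Commute A B := by
    have h1 := hcomm.eq
    have h2 : D * A * D⁻¹ * (D * B * D⁻¹) = D * (A * B) * D⁻¹ := by group
    have h3 : D * B * D⁻¹ * (D * A * D⁻¹) = D * (B * A) * D⁻¹ := by group
    rw [h2, h3] at h1
    exact mul_left_cancel (mul_right_cancel h1)
  refine hp ?_
  rw [← hA, ← hB]
  exact congrArg mk hAB.eq

end CommutatorProduct

/-! ### Normalization of triples of boundary points -/

namespace PSL2R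

/-- The points with homogeneous coordinates `v`, `u`, `w` form one of the triples `(0, 1, ∞)` and
`(1, 0, ∞)`, for nonzero vectors. -/
def IsBaseTriple (v u w : Fin 2 → ℝ) : Prop :=
  w 1 = 0 ∧ (v 0 = 0 ∧ u 0 = u 1 ∨ v 0 = v 1 ∧ u 0 = 0)

theorem isBaseTriple_iff {v u w : Fin 2 → ℝ} (hv : v ≠ 0) (hu : u ≠ 0) :
    IsBaseTriple v u w ↔
      (boundaryPoint v = ((0 : ℝ) : OnePoint ℝ) ∧ boundaryPoint u = ((1 : ℝ) : OnePoint ℝ) ∧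
        boundaryPoint w = OnePoint.infty) ∨
      (boundaryPoint v = ((1 : ℝ) : OnePoint ℝ) ∧ boundaryPoint u = ((0 : ℝ) : OnePoint ℝ) ∧
        boundaryPoint w = OnePoint.infty) := by
  have h0 : ∀ x : Fin 2 → ℝ, x ≠ 0 → (boundaryPoint x = ((0 : ℝ) : OnePoint ℝ) ↔ x 0 = 0) := by
    intro x hx
    rw [boundaryPoint_eq_coe, zero_mul]
    exact ⟨fun h => h.2, fun h => ⟨fun h1 => hx (vec_eq_zero h h1), h⟩⟩
  have h1 : ∀ x : Fin 2 → ℝ, x ≠ 0 → (boundaryPoint x = ((1 : ℝ) : OnePoint ℝ) ↔ x 0 = x 1) := by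
    intro x hx
    rw [boundaryPoint_eq_coe, one_mul]
    exact ⟨fun h => h.2, fun h => ⟨fun h1 => hx (vec_eq_zero (h.trans h1) h1), h⟩⟩
  rw [h0 v hv, h0 u hu, h1 v hv, h1 u hu, boundaryPoint_eq_infty, IsBaseTriple]
  tauto

/-- A matrix which maps one base triple to another one is trivial in `PSL(2, ℝ)`: an element
exchanging `0` and `1` and fixing `∞` would reverse the orientation. -/
theorem mk_eq_one_of_isBaseTriple {P : SL(2, ℝ)} {v u w : Fin 2 → ℝ} (hv : v ≠ 0) (hu : u ≠ 0)
    (hw : w ≠ 0) (h : IsBaseTriple v u w)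
    (h' : IsBaseTriple ((P : Matrix (Fin 2) (Fin 2) ℝ) *ᵥ v)
      ((P : Matrix (Fin 2) (Fin 2) ℝ) *ᵥ u) ((P : Matrix (Fin 2) (Fin 2) ℝ) *ᵥ w)) :
    mk P = 1 := by
  have hd := det_eq P
  simp only [IsBaseTriple, mulVec_apply_zero, mulVec_apply_one] at h h'
  obtain ⟨hw1, h⟩ := h
  obtain ⟨hw', h'⟩ := h'
  have hw0 : w 0 ≠ 0 := fun h0 => hw (vec_eq_zero h0 hw1)
  rw [hw1, mul_zero, add_zero, mul_eq_zero, or_iff_left hw0] at hw'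
  have hfix : P 0 1 = 0 → P 0 0 = P 1 1 → mk P = 1 := by
    intro h01 h00
    rw [h01, hw', h00] at hd
    have h11 : P 1 1 = 1 ∨ P 1 1 = -1 := mul_self_eq_one_iff.1 (by linarith)
    have hP : P = 1 ∨ P = -1 := by
      rcases h11 with h11 | h11
      · left
        ext i j
        fin_cases i <;> fin_cases j <;> simp [h01, hw', h00, h11]
      · right
        ext i j
        fin_cases i <;> fin_cases j <;> simp [h01, hw', h00, h11]
    rcases hP with rfl | rfl
    · rfl
    · exact mk_neg 1
  have hswap : P 0 1 = P 1 1 → P 0 0 + P 0 1 = 0 → mk P = 1 := by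
    intro h01 h00
    have h00' : P 0 0 = -P 1 1 := by linarith
    rw [hw', h00'] at hd
    nlinarith [sq_nonneg (P 1 1)]
  rcases h with ⟨a, b⟩ | ⟨a, b⟩
  · have hv1 : v 1 ≠ 0 := fun h0 => hv (vec_eq_zero a h0)
    have hu1 : u 1 ≠ 0 := fun h0 => hu (vec_eq_zero (b.trans h0) h0)
    rw [a, b, hw'] at h'
    rcases h' with ⟨c, d⟩ | ⟨c, d⟩
    · have e : P 0 1 = 0 := (mul_eq_zero.1 (by linarith : P 0 1 * v 1 = 0)).resolve_right hv1
      refine hfix e (mul_right_cancel₀ hu1 ?_)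
      rw [e] at d
      linarith
    · exact hswap (mul_right_cancel₀ hv1 (by linarith)) (mul_right_cancel₀ hu1 (by linarith))
  · have hv1 : v 1 ≠ 0 := fun h0 => hv (vec_eq_zero (a.trans h0) h0)
    have hu1 : u 1 ≠ 0 := fun h0 => hu (vec_eq_zero b h0)
    rw [a, b, hw'] at h'
    rcases h' with ⟨c, d⟩ | ⟨c, d⟩
    · exact hswap (mul_right_cancel₀ hu1 (by linarith)) (mul_right_cancel₀ hv1 (by linarith))
    · have e : P 0 1 = 0 := (mul_eq_zero.1 (by linarith : P 0 1 * u 1 = 0)).resolve_right hu1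
      refine hfix e (mul_right_cancel₀ hv1 ?_)
      rw [e] at c
      linarith

/-- The orientation of a triple of points of the boundary circle is the sign of this number. -/
def orientation (v u w : Fin 2 → ℝ) : ℝ := area v u * area u w * area w v

theorem orientation_swap (v u w : Fin 2 → ℝ) : orientation u v w = -orientation v u w := by
  simp only [orientation, area]; ring

/-- The matrix with the columns `area v u • w` and `area u w • v`, divided by the square root of
its determinant. The sum of these columns is a multiple of `u`. -/
noncomputable def frameMatrix (v u w : Fin 2 → ℝ) : Matrix (Fin 2) (Fin 2) ℝ :=
  !![(√(orientation v u w))⁻¹ * (area v u * w 0), (√(orientation v u w))⁻¹ * (area u w * v 0);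
    (√(orientation v u w))⁻¹ * (area v u * w 1), (√(orientation v u w))⁻¹ * (area u w * v 1)]

theorem det_frameMatrix {v u w : Fin 2 → ℝ} (h : 0 < orientation v u w) :
    (frameMatrix v u w).det = 1 := by
  have h1 : √(orientation v u w) ≠ 0 := (Real.sqrt_pos.2 h).ne'
  have h2 : √(orientation v u w) ^ 2 = orientation v u w := Real.sq_sqrt h.le
  rw [frameMatrix, Matrix.det_fin_two_of]
  field_simp
  rw [h2, orientation]
  simp only [area]
  ring

open Classical in
/-- For a positively oriented triple, the matrix of determinant one which sends `0`, `1`, `∞` to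
the points with homogeneous coordinates `v`, `u`, `w`. -/
noncomputable def frame (v u w : Fin 2 → ℝ) : SL(2, ℝ) :=
  if h : 0 < orientation v u w then ⟨frameMatrix v u w, det_frameMatrix h⟩ else 1

theorem frame_apply {v u w : Fin 2 → ℝ} (h : 0 < orientation v u w) (i j : Fin 2) :
    frame v u w i j = frameMatrix v u w i j := by
  have : frame v u w = ⟨frameMatrix v u w, det_frameMatrix h⟩ := dif_pos h
  rw [this]

theorem mulVec_inv_apply (P : SL(2, ℝ)) (v : Fin 2 → ℝ) :
    (((P⁻¹ : SL(2, ℝ)) : Matrix (Fin 2) (Fin 2) ℝ) *ᵥ v) 0 = P 1 1 * v 0 - P 0 1 * v 1 ∧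
    (((P⁻¹ : SL(2, ℝ)) : Matrix (Fin 2) (Fin 2) ℝ) *ᵥ v) 1 = P 0 0 * v 1 - P 1 0 * v 0 := by
  rw [mulVec_apply_zero, mulVec_apply_one, Matrix.SpecialLinearGroup.coe_inv,
    Matrix.adjugate_fin_two]
  simp
  constructor <;> ring

theorem frame_inv_mulVec {v u w : Fin 2 → ℝ} (h : 0 < orientation v u w) :
    (((frame v u w)⁻¹ : SL(2, ℝ)) : Matrix (Fin 2) (Fin 2) ℝ).mulVec w 1 = 0 ∧
    (((frame v u w)⁻¹ : SL(2, ℝ)) : Matrix (Fin 2) (Fin 2) ℝ).mulVec v 0 = 0 ∧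
    (((frame v u w)⁻¹ : SL(2, ℝ)) : Matrix (Fin 2) (Fin 2) ℝ).mulVec u 0 =
      (((frame v u w)⁻¹ : SL(2, ℝ)) : Matrix (Fin 2) (Fin 2) ℝ).mulVec u 1 := by
  simp only [(mulVec_inv_apply _ _).1, (mulVec_inv_apply _ _).2, frame_apply h]
  simp [frameMatrix, area]
  refine ⟨by ring, by ring, by ring⟩

open Classical in
/-- The matrix sending one of the two base triples to the points with homogeneous coordinates `v`,
`u`, `w`. -/
noncomputable def normalizer (v u w : Fin 2 → ℝ) : SL(2, ℝ) :=
  if 0 < orientation v u w then frame v u w else frame u v w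

theorem isBaseTriple_normalizer_inv {v u w : Fin 2 → ℝ} (h : orientation v u w ≠ 0) :
    IsBaseTriple (((normalizer v u w)⁻¹ : SL(2, ℝ)).1 *ᵥ v)
      (((normalizer v u w)⁻¹ : SL(2, ℝ)).1 *ᵥ u) (((normalizer v u w)⁻¹ : SL(2, ℝ)).1 *ᵥ w) := by
  by_cases h0 : 0 < orientation v u w
  · rw [normalizer, if_pos h0]
    obtain ⟨h1, h2, h3⟩ := frame_inv_mulVec h0
    exact ⟨h1, Or.inl ⟨h2, h3⟩⟩
  · rw [normalizer, if_neg h0]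
    have h0' : 0 < orientation u v w := by
      rw [orientation_swap]
      rcases lt_or_gt_of_ne h with h | h
      · linarith
      · exact absurd h h0
    obtain ⟨h1, h2, h3⟩ := frame_inv_mulVec h0'
    exact ⟨h1, Or.inr ⟨h3, h2⟩⟩

/-- The projection from `SL(2, ℝ)` to `PSL(2, ℝ)` has a smooth local section through every matrix;
smoothness in `SL(2, ℝ)` is expressed by the matrix entries. -/
theorem exists_local_lift (A₀ : SL(2, ℝ)) :
    ∃ L : PSL2R → SL(2, ℝ), L (mk A₀) = A₀ ∧ (∀ᶠ x in 𝓝 (mk A₀), mk (L x) = x) ∧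
      ∀ i j, ContMDiffAt (𝓡 3) 𝓘(ℝ) ∞ (fun x => L x i j) (mk A₀) := by
  classical
  let c : PSL2R → EuclideanSpace ℝ (Fin 3) := fun x => baseChart ((mk A₀)⁻¹ * x)
  have hc1 : c (mk A₀) = !₂[1, 0, 0] := by
    simp only [c, inv_mul_cancel]
    change !₂[quad 0 0 0 0 (mk 1), quad 0 0 0 1 (mk 1), quad 0 0 1 0 (mk 1)] = _
    simp
  have hc : ContMDiff (𝓡 3) 𝓘(ℝ, EuclideanSpace ℝ (Fin 3)) ∞ c := by
    have key : ∀ i j k l, ContMDiff (𝓡 3) 𝓘(ℝ) ∞ fun x => quad i j k l ((mk A₀)⁻¹ * x) :=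
      fun i j k l => (contMDiff_quad i j k l).comp (contMDiff_mul_left (a := (mk A₀)⁻¹))
    have h : ContMDiff (𝓡 3) 𝓘(ℝ, Fin 3 → ℝ) ∞ fun x =>
        ![quad 0 0 0 0 ((mk A₀)⁻¹ * x), quad 0 0 0 1 ((mk A₀)⁻¹ * x),
          quad 0 0 1 0 ((mk A₀)⁻¹ * x)] := by
      refine contMDiff_pi_space.2 fun i => ?_
      fin_cases i
      exacts [key 0 0 0 0, key 0 0 0 1, key 0 0 1 0]
    exact (EuclideanSpace.equiv (Fin 3) ℝ).symm.contDiff.contMDiff.comp h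
  let S : PSL2R → SL(2, ℝ) := fun x =>
    if h : 0 < c x 0 then ⟨sectionMatrix (c x), det_sectionMatrix h⟩ else 1
  have hpos : ∀ᶠ x in 𝓝 (mk A₀), 0 < c x 0 := by
    have h1 : Continuous fun x => c x 0 := (PiLp.continuous_apply 2 _ 0).comp hc.continuous
    refine (h1.tendsto (mk A₀)).eventually (lt_mem_nhds ?_)
    rw [hc1]; simp
  have hSx : ∀ x (h : 0 < c x 0), S x = ⟨sectionMatrix (c x), det_sectionMatrix h⟩ :=
    fun x h => dif_pos h
  refine ⟨fun x => A₀ * S x, ?_, ?_, fun i j => ?_⟩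
  · have h0 : 0 < c (mk A₀) 0 := by rw [hc1]; simp
    change A₀ * S (mk A₀) = A₀
    have : S (mk A₀) = 1 := by
      rw [hSx _ h0]
      ext i j
      change sectionMatrix (c (mk A₀)) i j = _
      rw [hc1]
      fin_cases i <;> fin_cases j <;> simp [sectionMatrix]
    rw [this, mul_one]
  · filter_upwards [hpos] with x hx
    have h1 : mk (S x) = (mk A₀)⁻¹ * x := by
      rw [hSx _ hx, ← chartInv_eq hx]
      exact baseChart.left_inv hx
    change mk (A₀ * S x) = x
    rw [mk_mul, h1, mul_inv_cancel_left]
  · have hS : ∀ i j, ContMDiffAt (𝓡 3) 𝓘(ℝ) ∞ (fun x => S x i j) (mk A₀) := by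
      intro i j
      have h1 : ContDiffAt ℝ ∞ (fun v => sectionMatrix v i j) (c (mk A₀)) := by
        refine (contDiffOn_sectionMatrix i j).contDiffAt ?_
        refine (isOpen_lt continuous_const (PiLp.continuous_apply 2 _ 0)).mem_nhds ?_
        exact hpos.self_of_nhds
      refine (h1.contMDiffAt.comp (mk A₀) (hc (mk A₀))).congr_of_eventuallyEq ?_
      filter_upwards [hpos] with x hx
      rw [hSx _ hx]
      rfl
    have h2 : (fun x => (A₀ * S x) i j) = fun x => A₀ i 0 * S x 0 j + A₀ i 1 * S x 1 j := by
      funext x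
      rw [Matrix.SpecialLinearGroup.coe_mul, Matrix.mul_apply, Fin.sum_univ_two]
    rw [h2]
    exact (contMDiffAt_const.mul (hS 0 j)).add (contMDiffAt_const.mul (hS 1 j))

variable {E H N : Type*} [NormedAddCommGroup E] [NormedSpace ℝ E] [TopologicalSpace H]
  {I : ModelWithCorners ℝ E H} [TopologicalSpace N] [ChartedSpace H N]

theorem contMDiffAt_mk {P : N → SL(2, ℝ)} {x : N}
    (h : ∀ i j, ContMDiffAt I 𝓘(ℝ) ∞ (fun y => P y i j) x) :
    ContMDiffAt I (𝓡 3) ∞ (fun y => mk (P y)) x := by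
  rw [contMDiffAt_iff_target]
  refine ⟨?_, ?_⟩
  · refine continuous_mk.continuousAt.comp ?_
    refine Topology.IsInducing.subtypeVal.continuousAt_iff.2 ?_
    exact continuousAt_pi.2 fun i => continuousAt_pi.2 fun j => (h i j).continuousAt
  · have key : ∀ i j k l, ContMDiffAt I 𝓘(ℝ) ∞ (fun y => quad i j k l ((mk (P x))⁻¹ * mk (P y)))
        x := by
      intro i j k l
      simp only [quad_mul, quad_mk]
      exact contMDiffAt_finsetSum fun m _ => contMDiffAt_finsetSum fun n _ =>
        contMDiffAt_const.mul ((h _ _).mul (h _ _))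
    have h' : ContMDiffAt I 𝓘(ℝ, Fin 3 → ℝ) ∞ (fun y =>
        ![quad 0 0 0 0 ((mk (P x))⁻¹ * mk (P y)), quad 0 0 0 1 ((mk (P x))⁻¹ * mk (P y)),
          quad 0 0 1 0 ((mk (P x))⁻¹ * mk (P y))]) x := by
      refine contMDiffAt_pi_space.2 fun i => ?_
      fin_cases i
      exacts [key 0 0 0 0, key 0 0 0 1, key 0 0 1 0]
    exact (EuclideanSpace.equiv (Fin 3) ℝ).symm.contDiff.contMDiff.contMDiffAt.comp x h'

theorem contMDiffAt_area {v w : N → Fin 2 → ℝ} {x : N}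
    (hv : ∀ i, ContMDiffAt I 𝓘(ℝ) ∞ (fun y => v y i) x)
    (hw : ∀ i, ContMDiffAt I 𝓘(ℝ) ∞ (fun y => w y i) x) :
    ContMDiffAt I 𝓘(ℝ) ∞ (fun y => area (v y) (w y)) x :=
  ((hv 0).mul (hw 1)).sub ((hv 1).mul (hw 0))

theorem contMDiffAt_orientation {v u w : N → Fin 2 → ℝ} {x : N}
    (hv : ∀ i, ContMDiffAt I 𝓘(ℝ) ∞ (fun y => v y i) x)
    (hu : ∀ i, ContMDiffAt I 𝓘(ℝ) ∞ (fun y => u y i) x)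
    (hw : ∀ i, ContMDiffAt I 𝓘(ℝ) ∞ (fun y => w y i) x) :
    ContMDiffAt I 𝓘(ℝ) ∞ (fun y => orientation (v y) (u y) (w y)) x :=
  ((contMDiffAt_area hv hu).mul (contMDiffAt_area hu hw)).mul (contMDiffAt_area hw hv)

theorem contMDiffAt_frame {v u w : N → Fin 2 → ℝ} {x : N}
    (hv : ∀ i, ContMDiffAt I 𝓘(ℝ) ∞ (fun y => v y i) x)
    (hu : ∀ i, ContMDiffAt I 𝓘(ℝ) ∞ (fun y => u y i) x)
    (hw : ∀ i, ContMDiffAt I 𝓘(ℝ) ∞ (fun y => w y i) x)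
    (h : 0 < orientation (v x) (u x) (w x)) (i j : Fin 2) :
    ContMDiffAt I 𝓘(ℝ) ∞ (fun y => frame (v y) (u y) (w y) i j) x := by
  have ho := contMDiffAt_orientation hv hu hw
  have h1 : ContDiffAt ℝ ∞ (fun t : ℝ => (√t)⁻¹) (orientation (v x) (u x) (w x)) :=
    (contDiffAt_id.sqrt h.ne').inv (Real.sqrt_pos.2 h).ne'
  have h2 : ContMDiffAt I 𝓘(ℝ) ∞ (fun y => (√(orientation (v y) (u y) (w y)))⁻¹) x :=
    h1.contMDiffAt.comp (f := fun y => orientation (v y) (u y) (w y)) x ho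
  have h3 : ∀ᶠ y in 𝓝 x, 0 < orientation (v y) (u y) (w y) :=
    ho.continuousAt.eventually (lt_mem_nhds h)
  have h4 : ContMDiffAt I 𝓘(ℝ) ∞ (fun y => frameMatrix (v y) (u y) (w y) i j) x := by
    fin_cases i <;> fin_cases j
    · exact h2.mul ((contMDiffAt_area hv hu).mul (hw 0))
    · exact h2.mul ((contMDiffAt_area hu hw).mul (hv 0))
    · exact h2.mul ((contMDiffAt_area hv hu).mul (hw 1))
    · exact h2.mul ((contMDiffAt_area hu hw).mul (hv 1))
  refine h4.congr_of_eventuallyEq ?_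
  filter_upwards [h3] with y hy
  exact frame_apply hy i j

theorem contMDiffAt_normalizer {v u w : N → Fin 2 → ℝ} {x : N}
    (hv : ∀ i, ContMDiffAt I 𝓘(ℝ) ∞ (fun y => v y i) x)
    (hu : ∀ i, ContMDiffAt I 𝓘(ℝ) ∞ (fun y => u y i) x)
    (hw : ∀ i, ContMDiffAt I 𝓘(ℝ) ∞ (fun y => w y i) x)
    (h : orientation (v x) (u x) (w x) ≠ 0) (i j : Fin 2) :
    ContMDiffAt I 𝓘(ℝ) ∞ (fun y => normalizer (v y) (u y) (w y) i j) x := by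
  have ho := (contMDiffAt_orientation hv hu hw).continuousAt
  rcases lt_or_gt_of_ne h with h | h
  · refine (contMDiffAt_frame hu hv hw (by rw [orientation_swap]; linarith) i j).congr_of_eventuallyEq
      ?_
    filter_upwards [ho.eventually (gt_mem_nhds h)] with y hy
    rw [normalizer, if_neg (not_lt.2 hy.le)]
  · refine (contMDiffAt_frame hv hu hw h i j).congr_of_eventuallyEq ?_
    filter_upwards [ho.eventually (lt_mem_nhds h)] with y hy
    rw [normalizer, if_pos hy]

/-- The eigenvalues and eigenvectors of a hyperbolic matrix depend smoothly on the matrix. -/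
theorem exists_smooth_eigenvectors {A : N → SL(2, ℝ)} {x : N}
    (hA : ∀ i j, ContMDiffAt I 𝓘(ℝ) ∞ (fun y => A y i j) x) (ht : 2 < A x 0 0 + A x 1 1) :
    ∃ (l : N → ℝ) (v u : N → Fin 2 → ℝ),
      (∀ i, ContMDiffAt I 𝓘(ℝ) ∞ (fun y => v y i) x) ∧
      (∀ i, ContMDiffAt I 𝓘(ℝ) ∞ (fun y => u y i) x) ∧
      ∀ᶠ y in 𝓝 x, 1 < l y ∧ IsEigenvector (A y) (l y) (v y) ∧
        IsEigenvector (A y) (l y)⁻¹ (u y) := by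
  let l : N → ℝ := fun y => largeRoot (A y 0 0 + A y 1 1)
  have htr : ContMDiffAt I 𝓘(ℝ) ∞ (fun y => A y 0 0 + A y 1 1) x := (hA 0 0).add (hA 1 1)
  have htr' : ∀ᶠ y in 𝓝 x, 2 < A y 0 0 + A y 1 1 :=
    htr.continuousAt.eventually (lt_mem_nhds ht)
  have hlx : 1 < l x := one_lt_largeRoot ht
  have hl : ContMDiffAt I 𝓘(ℝ) ∞ l x := by
    have h1 : ContDiffAt ℝ ∞ largeRoot (A x 0 0 + A x 1 1) := by
      refine ContDiffAt.div_const (contDiffAt_id.add (ContDiffAt.sqrt (by fun_prop) ?_)) 2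
      nlinarith
    exact h1.contMDiffAt.comp x htr
  have hl' : ContMDiffAt I 𝓘(ℝ) ∞ (fun y => (l y)⁻¹) x := by
    have h1 : ContDiffAt ℝ ∞ (fun t : ℝ => t⁻¹) (l x) := contDiffAt_id.inv (by
      change l x ≠ 0
      linarith)
    exact h1.contMDiffAt.comp x hl
  -- the vectors `A e - m e`, with `e` fixed
  have key : ∀ m : N → ℝ, ContMDiffAt I 𝓘(ℝ) ∞ m x → m x * m x ≠ 1 →
      ∃ e : Fin 2 → ℝ, (∀ i, ContMDiffAt I 𝓘(ℝ) ∞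
        (fun y => ((A y : Matrix (Fin 2) (Fin 2) ℝ) *ᵥ e - m y • e) i) x) ∧
        ∀ᶠ y in 𝓝 x, (A y : Matrix (Fin 2) (Fin 2) ℝ) *ᵥ e - m y • e ≠ 0 := by
    intro m hm hm1
    obtain ⟨e, he⟩ := exists_mulVec_sub_ne_zero (A x) hm1
    have hs : ∀ i, ContMDiffAt I 𝓘(ℝ) ∞
        (fun y => ((A y : Matrix (Fin 2) (Fin 2) ℝ) *ᵥ e - m y • e) i) x := by
      have h0 : ∀ i, ContMDiffAt I 𝓘(ℝ) ∞
          (fun y => A y i 0 * e 0 + A y i 1 * e 1 - m y * e i) x := fun i =>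
        (((hA i 0).mul contMDiffAt_const).add ((hA i 1).mul contMDiffAt_const)).sub
          (hm.mul contMDiffAt_const)
      intro i
      refine (h0 i).congr_of_eventuallyEq (Eventually.of_forall fun y => ?_)
      fin_cases i
      · simp
      · simp
    refine ⟨e, hs, ?_⟩
    obtain ⟨i, hi⟩ := Function.ne_iff.1 he
    filter_upwards [(hs i).continuousAt.eventually_ne hi] with y hy h0
    exact hy (congrFun h0 i)
  have hlx0 : 0 < l x := by linarith
  have hlx1 : (l x)⁻¹ < 1 := inv_lt_one_of_one_lt₀ hlx
  have hlx2 : 0 < (l x)⁻¹ := by positivity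
  obtain ⟨e, he, he'⟩ := key _ hl' (by nlinarith)
  obtain ⟨f, hf, hf'⟩ := key _ hl (by nlinarith)
  refine ⟨l, _, _, he, hf, ?_⟩
  filter_upwards [he', hf', htr'] with y h1 h2 h3
  have h4 : 1 < l y := one_lt_largeRoot h3
  have h5 : l y ≠ 0 := by linarith
  have h6 : l y + (l y)⁻¹ = A y 0 0 + A y 1 1 := largeRoot_add_inv h3
  exact ⟨h4, isEigenvector_sub (mul_inv_cancel₀ h5) h6 h1,
    isEigenvector_sub (inv_mul_cancel₀ h5) (by rw [add_comm]; exact h6) h2⟩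

end PSL2R

/-! ### The equivariant map to `PSL(2, ℝ)` -/

section SliceMap

open PSL2R

variable {g : ℕ} (hg : 2 ≤ g)

theorem mem_fixedPointSlice_iff {ρ : Hom₀ (SurfaceGroup g) PSL2R} {A B : SL(2, ℝ)} {l m : ℝ}
    {v u w : Fin 2 → ℝ} (hA : mk A = ρ (PresentedGroup.of (Sum.inl (firstIndex hg))))
    (hB : mk B = ρ (PresentedGroup.of (Sum.inr (firstIndex hg)))) (hl : 1 < l) (hm : 1 < m)
    (hv : IsEigenvector A l v) (hu : IsEigenvector A l⁻¹ u) (hw : IsEigenvector B m w) :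
    ρ ∈ fixedPointSlice hg ↔ IsBaseTriple v u w := by
  have hl0 : l ≠ 0 := by positivity
  have hu' := hu.inv (inv_ne_zero hl0)
  rw [inv_inv] at hu'
  change (_ ∧ _ ∧ _) ∨ (_ ∧ _ ∧ _) ↔ _
  rw [isBaseTriple_iff hv.1 hu.1, ← hA, ← hB, ← mk_inv]
  simp only [hv.isAttractiveFixedPoint_iff hl, hu'.isAttractiveFixedPoint_iff hl,
    hw.isAttractiveFixedPoint_iff hm]

theorem smul_mem_fixedPointSlice_iff {ρ : Hom₀ (SurfaceGroup g) PSL2R} {A B : SL(2, ℝ)} {l m : ℝ}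
    {v u w : Fin 2 → ℝ} (hA : mk A = ρ (PresentedGroup.of (Sum.inl (firstIndex hg))))
    (hB : mk B = ρ (PresentedGroup.of (Sum.inr (firstIndex hg)))) (hl : 1 < l) (hm : 1 < m)
    (hv : IsEigenvector A l v) (hu : IsEigenvector A l⁻¹ u) (hw : IsEigenvector B m w)
    (P : SL(2, ℝ)) :
    mk P • ρ ∈ fixedPointSlice hg ↔ IsBaseTriple ((P : Matrix (Fin 2) (Fin 2) ℝ) *ᵥ v)
      ((P : Matrix (Fin 2) (Fin 2) ℝ) *ᵥ u) ((P : Matrix (Fin 2) (Fin 2) ℝ) *ᵥ w) := by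
  refine mem_fixedPointSlice_iff hg (A := P * A * P⁻¹) (B := P * B * P⁻¹) ?_ ?_ hl hm (hv.conj P)
    (hu.conj P) (hw.conj P)
  · rw [Hom₀.smul_apply, mk_mul, mk_mul, mk_inv, hA]
  · rw [Hom₀.smul_apply, mk_mul, mk_mul, mk_inv, hB]

theorem orientation_ne_zero (ρ : Hom₀ (SurfaceGroup g) PSL2R) {A B : SL(2, ℝ)} {l m : ℝ}
    {v u w : Fin 2 → ℝ} (hA : mk A = ρ (PresentedGroup.of (Sum.inl (firstIndex hg))))
    (hB : mk B = ρ (PresentedGroup.of (Sum.inr (firstIndex hg)))) (hl : 1 < l)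
    (hv : IsEigenvector A l v) (hu : IsEigenvector A l⁻¹ u) (hw : IsEigenvector B m w) :
    orientation v u w ≠ 0 := by
  obtain ⟨h1, h2⟩ := ρ.area_ne_zero hg hA hB hl hv hu hw
  refine mul_ne_zero (mul_ne_zero (hv.area_ne_zero hu ?_) h2) ?_
  · have := inv_lt_one_of_one_lt₀ hl
    linarith
  · rw [area_comm]
    exact neg_ne_zero.2 h1

theorem smul_normalizer_mem_fixedPointSlice {ρ : Hom₀ (SurfaceGroup g) PSL2R} {A B : SL(2, ℝ)}
    {l m : ℝ} {v u w : Fin 2 → ℝ}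
    (hA : mk A = ρ (PresentedGroup.of (Sum.inl (firstIndex hg))))
    (hB : mk B = ρ (PresentedGroup.of (Sum.inr (firstIndex hg)))) (hl : 1 < l) (hm : 1 < m)
    (hv : IsEigenvector A l v) (hu : IsEigenvector A l⁻¹ u) (hw : IsEigenvector B m w) :
    (mk (normalizer v u w))⁻¹ • ρ ∈ fixedPointSlice hg := by
  rw [← mk_inv, smul_mem_fixedPointSlice_iff hg hA hB hl hm hv hu hw]
  exact isBaseTriple_normalizer_inv (orientation_ne_zero hg ρ hA hB hl hv hu hw)

theorem eq_one_of_smul_mem_fixedPointSlice {ρ : Hom₀ (SurfaceGroup g) PSL2R} {h : PSL2R}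
    (h1 : ρ ∈ fixedPointSlice hg) (h2 : h • ρ ∈ fixedPointSlice hg) : h = 1 := by
  obtain ⟨A, B, l, m, v, u, w, hA, hB, hl, hm, hv, hu, hw⟩ := ρ.exists_eigenvectors hg
  obtain ⟨P, rfl⟩ := mk_surjective h
  rw [mem_fixedPointSlice_iff hg hA hB hl hm hv hu hw] at h1
  rw [smul_mem_fixedPointSlice_iff hg hA hB hl hm hv hu hw] at h2
  exact mk_eq_one_of_isBaseTriple hv.1 hu.1 hw.1 h1 h2

/-- Every orbit of the conjugation action meets the slice. -/
theorem exists_inv_smul_mem_fixedPointSlice (ρ : Hom₀ (SurfaceGroup g) PSL2R) :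
    ∃ h : PSL2R, h⁻¹ • ρ ∈ fixedPointSlice hg := by
  obtain ⟨A, B, l, m, v, u, w, hA, hB, hl, hm, hv, hu, hw⟩ := ρ.exists_eigenvectors hg
  exact ⟨_, smul_normalizer_mem_fixedPointSlice hg hA hB hl hm hv hu hw⟩

/-- The element of `PSL(2, ℝ)` which moves a representation in the slice to the given one. -/
noncomputable def sliceMap (ρ : Hom₀ (SurfaceGroup g) PSL2R) : PSL2R :=
  (exists_inv_smul_mem_fixedPointSlice hg ρ).choose

theorem inv_sliceMap_smul_mem (ρ : Hom₀ (SurfaceGroup g) PSL2R) :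
    (sliceMap hg ρ)⁻¹ • ρ ∈ fixedPointSlice hg :=
  (exists_inv_smul_mem_fixedPointSlice hg ρ).choose_spec

theorem sliceMap_eq {ρ : Hom₀ (SurfaceGroup g) PSL2R} {h : PSL2R}
    (hh : h⁻¹ • ρ ∈ fixedPointSlice hg) : sliceMap hg ρ = h := by
  have h1 : (h⁻¹ * sliceMap hg ρ) • (sliceMap hg ρ)⁻¹ • ρ ∈ fixedPointSlice hg := by
    rwa [smul_smul, mul_assoc, mul_inv_cancel, mul_one]
  have h2 := eq_one_of_smul_mem_fixedPointSlice hg (inv_sliceMap_smul_mem hg ρ) h1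
  exact (inv_mul_eq_one.1 h2).symm

theorem sliceMap_smul (h : PSL2R) (ρ : Hom₀ (SurfaceGroup g) PSL2R) :
    sliceMap hg (h • ρ) = h * sliceMap hg ρ := by
  refine sliceMap_eq hg ?_
  rw [mul_inv_rev, smul_smul, inv_mul_cancel_right]
  exact inv_sliceMap_smul_mem hg ρ

theorem sliceMap_eq_one_iff {ρ : Hom₀ (SurfaceGroup g) PSL2R} :
    sliceMap hg ρ = 1 ↔ ρ ∈ fixedPointSlice hg := by
  constructor
  · intro h
    have := inv_sliceMap_smul_mem hg ρ
    rwa [h, inv_one, one_smul] at this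
  · intro h
    refine sliceMap_eq hg ?_
    rwa [inv_one, one_smul]

theorem contMDiff_sliceMap_of_generators {E H : Type*} [NormedAddCommGroup E] [NormedSpace ℝ E]
    [TopologicalSpace H] {I : ModelWithCorners ℝ E H}
    [ChartedSpace H (Hom₀ (SurfaceGroup g) PSL2R)]
    (ha : ContMDiff I (𝓡 3) ∞ fun ρ : Hom₀ (SurfaceGroup g) PSL2R =>
      ρ (PresentedGroup.of (Sum.inl (firstIndex hg))))
    (hb : ContMDiff I (𝓡 3) ∞ fun ρ : Hom₀ (SurfaceGroup g) PSL2R =>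
      ρ (PresentedGroup.of (Sum.inr (firstIndex hg)))) :
    ContMDiff I (𝓡 3) ∞ (sliceMap hg) := by
  intro ρ
  obtain ⟨A, B, l, m, v, u, w, hA, hB, hl, hm, hv, hu, hw⟩ := ρ.exists_eigenvectors hg
  obtain ⟨L, hL, hL', hLs⟩ := exists_local_lift A
  obtain ⟨M, hM, hM', hMs⟩ := exists_local_lift B
  rw [hA] at hL hL' hLs
  rw [hB] at hM hM' hMs
  set a : Hom₀ (SurfaceGroup g) PSL2R → PSL2R := fun σ =>
    σ (PresentedGroup.of (Sum.inl (firstIndex hg))) with ha'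
  set b : Hom₀ (SurfaceGroup g) PSL2R → PSL2R := fun σ =>
    σ (PresentedGroup.of (Sum.inr (firstIndex hg))) with hb'
  have htr : ∀ {C : SL(2, ℝ)} {k : ℝ} {x : Fin 2 → ℝ}, 1 < k → IsEigenvector C k x →
      2 < C 0 0 + C 1 1 := by
    intro C k x hk hx
    have h3 := hx.trace_eq
    nlinarith [sq_nonneg (k - 1), mul_pos (by linarith : 0 < k - 1) (by linarith : 0 < k - 1)]
  have hAs : ∀ i j, ContMDiffAt I 𝓘(ℝ) ∞ (fun σ => L (a σ) i j) ρ := fun i j =>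
    (hLs i j).comp ρ (ha ρ)
  have hBs : ∀ i j, ContMDiffAt I 𝓘(ℝ) ∞ (fun σ => M (b σ) i j) ρ := fun i j =>
    (hMs i j).comp ρ (hb ρ)
  have hLρ : L (a ρ) = A := hL
  have hMρ : M (b ρ) = B := hM
  obtain ⟨l', v', u', hv's, hu's, hev⟩ := exists_smooth_eigenvectors (A := fun σ => L (a σ)) hAs
    (by rw [hLρ]; exact htr hl hv)
  obtain ⟨m', w', _, hw's, -, hew⟩ := exists_smooth_eigenvectors (A := fun σ => M (b σ)) hBs
    (by rw [hMρ]; exact htr hm hw)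
  have ho : orientation (v' ρ) (u' ρ) (w' ρ) ≠ 0 := by
    have e1 := hev.self_of_nhds
    have e2 := hew.self_of_nhds
    exact orientation_ne_zero hg ρ (hL'.self_of_nhds) (hM'.self_of_nhds) e1.1 e1.2.1 e1.2.2 e2.2.1
  have hs : ContMDiffAt I (𝓡 3) ∞ (fun σ => mk (normalizer (v' σ) (u' σ) (w' σ))) ρ :=
    contMDiffAt_mk fun i j => contMDiffAt_normalizer hv's hu's hw's ho i j
  refine hs.congr_of_eventuallyEq ?_
  filter_upwards [hev, hew, (ha ρ).continuousAt.eventually hL',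
    (hb ρ).continuousAt.eventually hM'] with σ e1 e2 e4 e5
  exact sliceMap_eq hg (smul_normalizer_mem_fixedPointSlice hg e4 e5 e1.1 e2.1 e1.2.1 e1.2.2
    e2.2.1)

end SliceMap

/-! ### The space of representations as a manifold -/

section RepresentationSpace

variable {Γ G : Type*} [Group Γ] [Group G] [TopologicalSpace G]

theorem Hom₀.continuous_apply (γ : Γ) : Continuous fun ρ : Hom₀ Γ G => ρ γ :=
  (_root_.continuous_apply γ).comp continuous_induced_dom

theorem continuous_freeGroup_lift [IsTopologicalGroup G] {ι : Type*} (w : FreeGroup ι) :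
    Continuous fun p : ι → G => FreeGroup.lift p w := by
  induction w using FreeGroup.induction_on with
  | C1 => simpa using continuous_const
  | of i => simpa using _root_.continuous_apply i
  | inv_of i h => simp only [map_inv]; exact h.inv
  | mul x y hx hy => simp only [map_mul]; exact hx.mul hy

theorem evalGenerators_lift {g : ℕ} (ρ : Hom₀ (SurfaceGroup g) PSL2R)
    (w : FreeGroup (Fin g ⊕ Fin g)) :
    ρ (PresentedGroup.mk _ w) = FreeGroup.lift (evalGenerators g ρ) w := by
  have h : ρ.1.comp (PresentedGroup.mk _) = FreeGroup.lift (evalGenerators g ρ) := by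
    ext i
    simp [evalGenerators, PresentedGroup.of]
  exact DFunLike.congr_fun h w

theorem commutatorProduct_evalGenerators {g : ℕ} (ρ : Hom₀ (SurfaceGroup g) PSL2R) :
    commutatorProduct g (evalGenerators g ρ) = 1 := by
  have h1 : (PresentedGroup.mk {commutatorProduct g FreeGroup.of})
      (commutatorProduct g (FreeGroup.of : Fin g ⊕ Fin g → FreeGroup _)) = 1 :=
    PresentedGroup.one_of_mem rfl
  have h2 := evalGenerators_lift ρ (commutatorProduct g FreeGroup.of)
  rw [h1, map_commutatorProduct] at h2
  simp only [FreeGroup.lift_apply_of] at h2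
  rw [← h2]
  exact map_one ρ.1

/-- A representation of a finitely generated group is determined by the images of the generators,
topologically as well. -/
theorem isEmbedding_evalGenerators (g : ℕ) : IsEmbedding (evalGenerators g) := by
  refine ⟨⟨le_antisymm ?_ ?_⟩, ?_⟩
  · refine continuous_iff_le_induced.1 (continuous_pi fun s => Hom₀.continuous_apply _)
  · refine (continuous_iff_le_induced (t₁ := TopologicalSpace.induced (evalGenerators g)
      Pi.topologicalSpace)).1 ?_
    refine (@continuous_pi_iff _ _ _ (TopologicalSpace.induced (evalGenerators g)
      Pi.topologicalSpace) _ _).2 fun γ => ?_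
    obtain ⟨w, rfl⟩ := PresentedGroup.mk_surjective _ γ
    simp only [evalGenerators_lift]
    exact @Continuous.comp _ _ _ (TopologicalSpace.induced (evalGenerators g)
      Pi.topologicalSpace) _ _ _ _ (continuous_freeGroup_lift w) continuous_induced_dom
  · intro ρ σ h
    apply Subtype.ext
    ext s
    exact congrFun h s

/-- Near a point of `Hom₀`, all solutions of the surface group relation belong to `Hom₀`. -/
theorem eventually_mem_range_evalGenerators {g : ℕ} (ρ : Hom₀ (SurfaceGroup g) PSL2R) :
    ∀ᶠ q in 𝓝 (evalGenerators g ρ), commutatorProduct g q = 1 → q ∈ range (evalGenerators g) := by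
  let S := {q : Fin g ⊕ Fin g → PSL2R // commutatorProduct g q = 1}
  have hrel : ∀ q : S, ∀ r ∈ ({commutatorProduct g FreeGroup.of} :
      Set (FreeGroup (Fin g ⊕ Fin g))), FreeGroup.lift q.1 r = 1 := by
    rintro q _ rfl
    rw [map_commutatorProduct]
    simpa using q.2
  let σ : S → (SurfaceGroup g →* PSL2R) := fun q => PresentedGroup.toGroup (hrel q)
  have hσ : ∀ (q : S) (w : FreeGroup (Fin g ⊕ Fin g)),
      σ q (PresentedGroup.mk _ w) = FreeGroup.lift q.1 w := fun q w => rfl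
  have h := eventually_hom₀_property (l := comap Subtype.val (𝓝 (evalGenerators g ρ))) (ρ := σ) ρ
    fun γ => by
      obtain ⟨w, rfl⟩ := PresentedGroup.mk_surjective _ γ
      simp only [hσ, evalGenerators_lift]
      exact ((continuous_freeGroup_lift w).tendsto _).comp tendsto_comap
  rw [eventually_comap] at h
  filter_upwards [h] with q hq hq1
  refine ⟨⟨σ ⟨q, hq1⟩, hq ⟨q, hq1⟩ rfl⟩, ?_⟩
  funext s
  change σ ⟨q, hq1⟩ (PresentedGroup.mk _ (FreeGroup.of s)) = q s
  rw [hσ]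
  simp

theorem Hom₀.not_commute {g : ℕ} (hg : 2 ≤ g) (ρ : Hom₀ (SurfaceGroup g) PSL2R) :
    ¬ Commute (evalGenerators g ρ (Sum.inl (firstIndex hg)))
      (evalGenerators g ρ (Sum.inr (firstIndex hg))) := by
  intro h
  have h1 := (SurfaceGroup.not_commute_pow hg one_pos).1
  rw [pow_one] at h1
  refine h1 (ρ.2.1 ?_)
  rw [map_mul, map_mul]
  exact h.eq

theorem exists_chartedSpace_hom₀ {g : ℕ} (hg : 2 ≤ g) :
    ∃ _ : ChartedSpace (EuclideanSpace ℝ (Fin (6 * g - 3))) (Hom₀ (SurfaceGroup g) PSL2R),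
      IsManifold (𝓡 (6 * g - 3)) ∞ (Hom₀ (SurfaceGroup g) PSL2R) ∧
      IsSmoothEmbedding (𝓡 (6 * g - 3)) (ModelWithCorners.pi fun _ : Fin g ⊕ Fin g => 𝓡 3) ∞
        (evalGenerators g) := by
  refine exists_chartedSpace_of_isSubmersionAt (J := 𝓡 3) (c := (1 : PSL2R))
    (R := commutatorProduct (G := PSL2R) g) (isEmbedding_evalGenerators g) (fun ρ => ?_)
    commutatorProduct_evalGenerators eventually_mem_range_evalGenerators
  refine isSubmersionAtOfComplement_of_surjective ?_ (contMDiff_commutatorProduct g)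
    (surjective_mfderiv_commutatorProduct hg (ρ.not_commute hg))
  rw [Module.finrank_pi_fintype]
  simp
  omega

end RepresentationSpace

/-- The differential of a map with a smooth section through a point is onto. -/
theorem surjective_mfderiv_of_comp_eq_id {E E' H H' M N : Type*}
    [NormedAddCommGroup E] [NormedSpace ℝ E] [NormedAddCommGroup E'] [NormedSpace ℝ E']
    [TopologicalSpace H] [TopologicalSpace H'] {I : ModelWithCorners ℝ E H}
    {J : ModelWithCorners ℝ E' H'} [TopologicalSpace M] [ChartedSpace H M]
    [TopologicalSpace N] [ChartedSpace H' N] {f : M → N} {s : N → M} (hf : ContMDiff I J ∞ f)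
    (hs : ContMDiff J I ∞ s) (h : ∀ y, f (s y) = y) {x : M} {y : N} (hx : s y = x) :
    Function.Surjective (mfderiv I J f x) := by
  subst hx
  have h1 := (hf (s y)).mdifferentiableAt (by simp) |>.hasMFDerivAt
  have h2 := (hs y).mdifferentiableAt (by simp) |>.hasMFDerivAt
  obtain ⟨D, hD⟩ : ∃ D : E →L[ℝ] E', D = mfderiv I J f (s y) := ⟨_, rfl⟩
  obtain ⟨C, hC⟩ : ∃ C : E' →L[ℝ] E, C = mfderiv J I s y := ⟨_, rfl⟩
  have h3 : f ∘ s = id := funext h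
  have h4 := h1.comp y h2
  rw [h3] at h4
  have h5 : D.comp C = ContinuousLinearMap.id ℝ E' := by
    rw [hD, hC]
    exact hasMFDerivAt_unique h4 (hasMFDerivAt_id y)
  rw [← hD]
  exact fun ξ => ⟨C ξ, DFunLike.congr_fun h5 ξ⟩

/-- A smooth structure on the target of a surjective map from a manifold is determined by the
condition that the map is a submersion. -/
theorem sameSmoothStructure_of_isSubmersion {E H M N : Type*} [NormedAddCommGroup E]
    [NormedSpace ℝ E] [TopologicalSpace H] {I : ModelWithCorners ℝ E H} [I.Boundaryless]
    [TopologicalSpace M] [ChartedSpace H M] [TopologicalSpace N] {d : ℕ} {π : M → N}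
    (hπ : Function.Surjective π) (c c' : ChartedSpace (EuclideanSpace ℝ (Fin d)) N)
    (hc : @IsManifold ℝ _ _ _ _ _ _ (𝓡 d) ∞ N _ c)
    (hc' : @IsManifold ℝ _ _ _ _ _ _ (𝓡 d) ∞ N _ c')
    (h : @IsSubmersion ℝ _ _ _ _ _ _ _ _ _ _ _ I (𝓡 d) M N _ _ _ c ∞ π)
    (h' : @IsSubmersion ℝ _ _ _ _ _ _ _ _ _ _ _ I (𝓡 d) M N _ _ _ c' ∞ π) :
    SameSmoothStructure c' c := by
  have key : ∀ c c' : ChartedSpace (EuclideanSpace ℝ (Fin d)) N,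
      @IsSubmersion ℝ _ _ _ _ _ _ _ _ _ _ _ I (𝓡 d) M N _ _ _ c ∞ π →
      @IsSubmersion ℝ _ _ _ _ _ _ _ _ _ _ _ I (𝓡 d) M N _ _ _ c' ∞ π →
      @ContMDiff ℝ _ _ _ _ _ _ (𝓡 d) N _ c _ _ _ _ _ (𝓡 d) N _ c' ∞ id := by
    intro c c' h h'
    have h1 := @IsSubmersion.contMDiff _ _ _ _ _ _ _ _ _ _ _ _ I (𝓡 d) M N _ _ _ c' ∞ π h'
    exact @IsSubmersion.contMDiff_of_comp _ _ _ _ _ _ M N N _ _ _ _ _ _ _ _ _ I (𝓡 d) (𝓡 d) _ _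
      _ c _ c' _ π h hπ id h1
  exact Subset.antisymm (maximalAtlas_le_of_contMDiff_id c' c hc (key _ _ h' h) (key _ _ h h'))
    (maximalAtlas_le_of_contMDiff_id c c' hc' (key _ _ h h') (key _ _ h' h))

section Action

variable {g : ℕ}

variable [ChartedSpace (EuclideanSpace ℝ (Fin (6 * g - 3))) (Hom₀ (SurfaceGroup g) PSL2R)]

theorem contMDiff_evalGenerators_apply
    (he : IsSmoothEmbedding (𝓡 (6 * g - 3)) (ModelWithCorners.pi fun _ : Fin g ⊕ Fin g => 𝓡 3) ∞
      (evalGenerators g)) (s : Fin g ⊕ Fin g) :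
    ContMDiff (𝓡 (6 * g - 3)) (𝓡 3) ∞ fun ρ => evalGenerators g ρ s :=
  (contMDiff_pi_proj (M := fun _ : Fin g ⊕ Fin g => PSL2R)
    (I := fun _ : Fin g ⊕ Fin g => 𝓡 3) s).comp he.contMDiff

/-- Conjugation of representations depends smoothly on both variables. -/
theorem contMDiff_smul_hom₀
    (he : IsSmoothEmbedding (𝓡 (6 * g - 3)) (ModelWithCorners.pi fun _ : Fin g ⊕ Fin g => 𝓡 3) ∞
      (evalGenerators g)) :
    ContMDiff ((𝓡 3).prod (𝓡 (6 * g - 3))) (𝓡 (6 * g - 3)) ∞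
      fun x : PSL2R × Hom₀ (SurfaceGroup g) PSL2R => x.1 • x.2 := by
  have h : ContMDiff ((𝓡 3).prod (𝓡 (6 * g - 3)))
      (ModelWithCorners.pi fun _ : Fin g ⊕ Fin g => 𝓡 3) ∞
      fun x : PSL2R × Hom₀ (SurfaceGroup g) PSL2R => evalGenerators g (x.1 • x.2) :=
    contMDiff_pi_of_components fun s =>
      (contMDiff_fst.mul ((contMDiff_evalGenerators_apply he s).comp contMDiff_snd)).mul
        contMDiff_fst.inv
  refine (ContMDiff.iff_comp_isImmersion he.isImmersion).2 ⟨?_, h⟩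
  exact he.isEmbedding.continuous_iff.2 h.continuous

end Action

/-! ### The slice and the orbit space -/

section Slice

variable {g : ℕ} (hg : 2 ≤ g)

/-- The representative in the slice of the orbit of `ρ`. -/
noncomputable def sliceProjection (ρ : Hom₀ (SurfaceGroup g) PSL2R) :
    Hom₀ (SurfaceGroup g) PSL2R :=
  (sliceMap hg ρ)⁻¹ • ρ

theorem sliceMap_sliceProjection (ρ : Hom₀ (SurfaceGroup g) PSL2R) :
    sliceMap hg (sliceProjection hg ρ) = 1 := by
  rw [sliceProjection, sliceMap_smul, inv_mul_cancel]

theorem sliceProjection_smul (h : PSL2R) (ρ : Hom₀ (SurfaceGroup g) PSL2R) :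
    sliceProjection hg (h • ρ) = sliceProjection hg ρ := by
  rw [sliceProjection, sliceMap_smul, mul_inv_rev, smul_smul, inv_mul_cancel_right]
  rfl

theorem sliceMap_smul_sliceProjection (ρ : Hom₀ (SurfaceGroup g) PSL2R) :
    sliceMap hg ρ • sliceProjection hg ρ = ρ := by
  rw [sliceProjection, smul_inv_smul]

theorem sliceProjection_eq_self {ρ : Hom₀ (SurfaceGroup g) PSL2R} (h : sliceMap hg ρ = 1) :
    sliceProjection hg ρ = ρ := by
  rw [sliceProjection, h, inv_one, one_smul]

/-- The section of the orbit space given by the slice. -/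
noncomputable def quotientSection :
    Hom₀Quotient (SurfaceGroup g) PSL2R → Hom₀ (SurfaceGroup g) PSL2R :=
  Quotient.lift (sliceProjection hg) fun ρ σ h => by
    obtain ⟨k, rfl⟩ := MulAction.orbitRel_apply.1 h
    exact sliceProjection_smul hg k σ

theorem mk_quotientSection (q : Hom₀Quotient (SurfaceGroup g) PSL2R) :
    Quotient.mk _ (quotientSection hg q) = q := by
  induction q using Quotient.inductionOn with
  | h ρ => exact Quotient.sound (MulAction.orbitRel_apply.2 ⟨(sliceMap hg ρ)⁻¹, rfl⟩)

theorem sliceMap_quotientSection (q : Hom₀Quotient (SurfaceGroup g) PSL2R) :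
    sliceMap hg (quotientSection hg q) = 1 := by
  induction q using Quotient.inductionOn with
  | h ρ => exact sliceMap_sliceProjection hg ρ

theorem sliceProjection_mem (ρ : Hom₀ (SurfaceGroup g) PSL2R) :
    sliceProjection hg ρ ∈ fixedPointSlice hg := inv_sliceMap_smul_mem hg ρ

theorem quotientSection_mem (q : Hom₀Quotient (SurfaceGroup g) PSL2R) :
    quotientSection hg q ∈ fixedPointSlice hg :=
  (sliceMap_eq_one_iff hg).1 (sliceMap_quotientSection hg q)

section Smooth

variable [ChartedSpace (EuclideanSpace ℝ (Fin (6 * g - 3))) (Hom₀ (SurfaceGroup g) PSL2R)]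

theorem contMDiff_sliceMap
    (he : IsSmoothEmbedding (𝓡 (6 * g - 3)) (ModelWithCorners.pi fun _ : Fin g ⊕ Fin g => 𝓡 3) ∞
      (evalGenerators g)) :
    ContMDiff (𝓡 (6 * g - 3)) (𝓡 3) ∞ (sliceMap hg) :=
  contMDiff_sliceMap_of_generators hg (contMDiff_evalGenerators_apply he _)
    (contMDiff_evalGenerators_apply he _)

theorem contMDiff_sliceProjection
    (he : IsSmoothEmbedding (𝓡 (6 * g - 3)) (ModelWithCorners.pi fun _ : Fin g ⊕ Fin g => 𝓡 3) ∞
      (evalGenerators g)) :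
    ContMDiff (𝓡 (6 * g - 3)) (𝓡 (6 * g - 3)) ∞ (sliceProjection hg) :=
  (contMDiff_smul_hom₀ he).comp ((contMDiff_sliceMap hg he).inv.prodMk contMDiff_id)

theorem isSubmersionAt_sliceMap [IsManifold (𝓡 (6 * g - 3)) ∞ (Hom₀ (SurfaceGroup g) PSL2R)]
    (he : IsSmoothEmbedding (𝓡 (6 * g - 3)) (ModelWithCorners.pi fun _ : Fin g ⊕ Fin g => 𝓡 3) ∞
      (evalGenerators g))
    (ρ : Hom₀ (SurfaceGroup g) PSL2R) :
    IsSubmersionAtOfComplement (EuclideanSpace ℝ (Fin (6 * g - 6))) (𝓡 (6 * g - 3)) (𝓡 3) ∞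
      (sliceMap hg) ρ := by
  refine isSubmersionAtOfComplement_of_surjective ?_ (contMDiff_sliceMap hg he) ?_
  · simp
    omega
  · -- the orbit through `ρ` is a section
    refine surjective_mfderiv_of_comp_eq_id (s := fun k => k • sliceProjection hg ρ)
      (y := sliceMap hg ρ) (contMDiff_sliceMap hg he) ?_ (fun k => ?_)
      (sliceMap_smul_sliceProjection hg ρ)
    · exact (contMDiff_smul_hom₀ he).comp (contMDiff_id.prodMk contMDiff_const)
    · rw [sliceMap_smul, sliceMap_sliceProjection, mul_one]

theorem exists_chartedSpace_slice [IsManifold (𝓡 (6 * g - 3)) ∞ (Hom₀ (SurfaceGroup g) PSL2R)]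
    (he : IsSmoothEmbedding (𝓡 (6 * g - 3)) (ModelWithCorners.pi fun _ : Fin g ⊕ Fin g => 𝓡 3) ∞
      (evalGenerators g)) :
    ∃ _ : ChartedSpace (EuclideanSpace ℝ (Fin (6 * g - 6))) (fixedPointSlice hg),
      IsManifold (𝓡 (6 * g - 6)) ∞ (fixedPointSlice hg) ∧
      IsSmoothEmbedding (𝓡 (6 * g - 6)) (𝓡 (6 * g - 3)) ∞
        (Subtype.val : fixedPointSlice hg → Hom₀ (SurfaceGroup g) PSL2R) := by
  refine exists_chartedSpace_of_isSubmersionAt (J := 𝓡 3) (c := (1 : PSL2R)) (R := sliceMap hg)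
    IsEmbedding.subtypeVal (fun z => isSubmersionAt_sliceMap hg he z.1)
    (fun z => (sliceMap_eq_one_iff hg).2 z.2) fun z => Eventually.of_forall fun ρ hρ => ?_
  exact ⟨⟨ρ, (sliceMap_eq_one_iff hg).1 hρ⟩, rfl⟩

theorem isEmbedding_quotientSection
    (he : IsSmoothEmbedding (𝓡 (6 * g - 3)) (ModelWithCorners.pi fun _ : Fin g ⊕ Fin g => 𝓡 3) ∞
      (evalGenerators g)) :
    IsEmbedding (quotientSection hg) :=
  IsEmbedding.of_leftInverse (f := Quotient.mk _) (mk_quotientSection hg) continuous_quot_mk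
    ((contMDiff_sliceProjection hg he).continuous.quotient_lift _)

theorem exists_chartedSpace_quotient
    [IsManifold (𝓡 (6 * g - 3)) ∞ (Hom₀ (SurfaceGroup g) PSL2R)]
    (he : IsSmoothEmbedding (𝓡 (6 * g - 3)) (ModelWithCorners.pi fun _ : Fin g ⊕ Fin g => 𝓡 3) ∞
      (evalGenerators g)) :
    ∃ _ : ChartedSpace (EuclideanSpace ℝ (Fin (6 * g - 6)))
        (Hom₀Quotient (SurfaceGroup g) PSL2R),
      IsManifold (𝓡 (6 * g - 6)) ∞ (Hom₀Quotient (SurfaceGroup g) PSL2R) ∧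
      IsSmoothEmbedding (𝓡 (6 * g - 6)) (𝓡 (6 * g - 3)) ∞ (quotientSection hg) := by
  refine exists_chartedSpace_of_isSubmersionAt (J := 𝓡 3) (c := (1 : PSL2R)) (R := sliceMap hg)
    (isEmbedding_quotientSection hg he) (fun q => isSubmersionAt_sliceMap hg he _)
    (sliceMap_quotientSection hg) fun q => Eventually.of_forall fun ρ hρ => ?_
  exact ⟨Quotient.mk _ ρ, sliceProjection_eq_self hg hρ⟩

end Smooth

end Slice

theorem mainTheorem12 (g : ℕ) (hg : 2 ≤ g) :
    -- the differential of the product of commutators is onto where the first two entries are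
    -- non-commuting hyperbolic elements
    (∀ p : Fin g ⊕ Fin g → PSL2R,
      PSL2R.IsHyperbolic (p (Sum.inl (firstIndex hg))) →
      PSL2R.IsHyperbolic (p (Sum.inr (firstIndex hg))) →
      ¬ Commute (p (Sum.inl (firstIndex hg))) (p (Sum.inr (firstIndex hg))) →
      Function.Surjective
        (mfderiv (ModelWithCorners.pi fun _ : Fin g ⊕ Fin g => 𝓡 3) (𝓡 3)
          (commutatorProduct (G := PSL2R) g) p)) ∧
    -- `Hom₀` is an embedded submanifold of `PSL(2, ℝ) ^ (2g)` of dimension `6g - 3`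
    ∃ _ : ChartedSpace (EuclideanSpace ℝ (Fin (6 * g - 3))) (Hom₀ (SurfaceGroup g) PSL2R),
      IsSmoothManifold (6 * g - 3) (Hom₀ (SurfaceGroup g) PSL2R) ∧
      IsSmoothEmbedding (𝓡 (6 * g - 3)) (ModelWithCorners.pi fun _ : Fin g ⊕ Fin g => 𝓡 3) ∞
        (evalGenerators g) ∧
      -- the slice is an embedded submanifold of `Hom₀` of codimension `3`
      ∃ _ : ChartedSpace (EuclideanSpace ℝ (Fin (6 * g - 6)))
          (fixedPointSlice hg),
        IsSmoothManifold (6 * g - 6) (fixedPointSlice hg) ∧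
        IsSmoothEmbedding (𝓡 (6 * g - 6)) (𝓡 (6 * g - 3)) ∞
          (Subtype.val : fixedPointSlice hg →
            Hom₀ (SurfaceGroup g) PSL2R) ∧
        -- it is the fibre over `1` of a smooth equivariant map to `PSL(2, ℝ)`
        (∃ ψ : Hom₀ (SurfaceGroup g) PSL2R → PSL2R,
          ContMDiff (𝓡 (6 * g - 3)) (𝓡 3) ∞ ψ ∧
          (∀ (h : PSL2R) (ρ : Hom₀ (SurfaceGroup g) PSL2R), ψ (h • ρ) = h * ψ ρ) ∧
          fixedPointSlice hg = ψ ⁻¹' {1}) ∧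
        -- conjugation identifies `PSL(2, ℝ) × slice` with `Hom₀`
        (∃ Φ : Diffeomorph ((𝓡 3).prod (𝓡 (6 * g - 6))) (𝓡 (6 * g - 3))
            (PSL2R × fixedPointSlice hg) (Hom₀ (SurfaceGroup g) PSL2R) ∞,
          ∀ (h : PSL2R) (z : fixedPointSlice hg), Φ (h, z) = h • z.1) ∧
        -- the quotient is a smooth manifold of dimension `6g - 6`, its smooth structure is the
        -- only one for which the projection from `Hom₀` is a submersion, and the slice is
        -- diffeomorphic to the quotient
        ∃ c : ChartedSpace (EuclideanSpace ℝ (Fin (6 * g - 6)))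
            (Hom₀Quotient (SurfaceGroup g) PSL2R),
          IsSmoothManifold (6 * g - 6) (Hom₀Quotient (SurfaceGroup g) PSL2R) ∧
          IsSubmersion (𝓡 (6 * g - 3)) (𝓡 (6 * g - 6)) ∞
            (Quotient.mk _ : Hom₀ (SurfaceGroup g) PSL2R →
              Hom₀Quotient (SurfaceGroup g) PSL2R) ∧
          (∀ c' : ChartedSpace (EuclideanSpace ℝ (Fin (6 * g - 6)))
              (Hom₀Quotient (SurfaceGroup g) PSL2R),
            IsManifold (𝓡 (6 * g - 6)) ∞ (Hom₀Quotient (SurfaceGroup g) PSL2R) →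
            IsSubmersion (𝓡 (6 * g - 3)) (𝓡 (6 * g - 6)) ∞
              (Quotient.mk _ : Hom₀ (SurfaceGroup g) PSL2R →
                Hom₀Quotient (SurfaceGroup g) PSL2R) →
            SameSmoothStructure c' c) ∧
          ∃ Θ : Diffeomorph (𝓡 (6 * g - 6)) (𝓡 (6 * g - 6))
              (fixedPointSlice hg)
              (Hom₀Quotient (SurfaceGroup g) PSL2R) ∞,
            ∀ z : fixedPointSlice hg, Θ z = Quotient.mk _ z.1 := by
  refine ⟨fun p _ _ hp => surjective_mfderiv_commutatorProduct hg hp, ?_⟩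
  have : T2Space (Hom₀ (SurfaceGroup g) PSL2R) := (isEmbedding_evalGenerators g).t2Space
  have : SecondCountableTopology (Hom₀ (SurfaceGroup g) PSL2R) :=
    (isEmbedding_evalGenerators g).secondCountableTopology
  obtain ⟨cM, hM, he⟩ := exists_chartedSpace_hom₀ hg
  refine ⟨cM, ⟨inferInstance, inferInstance, hM⟩, he, ?_⟩
  have hψ := contMDiff_sliceMap hg he
  have hp := contMDiff_sliceProjection hg he
  have hact := contMDiff_smul_hom₀ he
  obtain ⟨cZ, hZ, hι⟩ := exists_chartedSpace_slice hg he
  refine ⟨cZ, ⟨inferInstance, inferInstance, hZ⟩, hι, ⟨sliceMap hg, hψ, sliceMap_smul hg, ?_⟩,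
    ?_, ?_⟩
  · ext ρ
    exact (sliceMap_eq_one_iff hg).symm
  · have hZp : ContMDiff (𝓡 (6 * g - 3)) (𝓡 (6 * g - 6)) ∞
        fun ρ => (⟨sliceProjection hg ρ, sliceProjection_mem hg ρ⟩ : fixedPointSlice hg) :=
      (ContMDiff.iff_comp_isImmersion hι.isImmersion).2
        ⟨hp.continuous.subtype_mk _, hp⟩
    refine ⟨⟨⟨fun x => x.1 • x.2.1, fun ρ => (sliceMap hg ρ, ⟨sliceProjection hg ρ,
      sliceProjection_mem hg ρ⟩), ?_, sliceMap_smul_sliceProjection hg⟩, ?_, ?_⟩, fun h z => rfl⟩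
    · rintro ⟨h, z, hz⟩
      have hz1 := (sliceMap_eq_one_iff hg).2 hz
      refine Prod.ext ?_ (Subtype.ext ?_)
      · change sliceMap hg (h • z) = h
        rw [sliceMap_smul, hz1, mul_one]
      · change sliceProjection hg (h • z) = z
        rw [sliceProjection_smul, sliceProjection_eq_self hg hz1]
    · exact hact.comp (contMDiff_fst.prodMk (hι.contMDiff.comp contMDiff_snd))
    · exact hψ.prodMk hZp
  · obtain ⟨cQ, hQ, hs⟩ := exists_chartedSpace_quotient hg he
    have : T2Space (Hom₀Quotient (SurfaceGroup g) PSL2R) := hs.isEmbedding.t2Space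
    have : SecondCountableTopology (Hom₀Quotient (SurfaceGroup g) PSL2R) :=
      hs.isEmbedding.secondCountableTopology
    have hπ : ContMDiff (𝓡 (6 * g - 3)) (𝓡 (6 * g - 6)) ∞
        (Quotient.mk _ : Hom₀ (SurfaceGroup g) PSL2R → Hom₀Quotient (SurfaceGroup g) PSL2R) :=
      (ContMDiff.iff_comp_isImmersion hs.isImmersion).2 ⟨continuous_quot_mk, hp⟩
    have hsub : IsSubmersion (𝓡 (6 * g - 3)) (𝓡 (6 * g - 6)) ∞
        (Quotient.mk _ : Hom₀ (SurfaceGroup g) PSL2R → Hom₀Quotient (SurfaceGroup g) PSL2R) := by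
      refine ⟨EuclideanSpace ℝ (Fin 3), inferInstance, inferInstance, fun ρ => ?_⟩
      refine isSubmersionAtOfComplement_of_surjective ?_ hπ ?_
      · simp
        omega
      · refine surjective_mfderiv_of_comp_eq_id
          (s := fun q => sliceMap hg ρ • quotientSection hg q) (y := Quotient.mk _ ρ) hπ ?_
          (fun q => ?_) (sliceMap_smul_sliceProjection hg ρ)
        · exact hact.comp (contMDiff_const.prodMk hs.contMDiff)
        · refine Eq.trans (Quotient.sound ?_) (mk_quotientSection hg q)
          exact MulAction.orbitRel_apply.2 ⟨sliceMap hg ρ, rfl⟩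
    refine ⟨cQ, ⟨inferInstance, inferInstance, hQ⟩, hsub, fun c' hc' hsub' =>
      sameSmoothStructure_of_isSubmersion Quotient.mk_surjective cQ c' hQ hc' hsub hsub', ?_⟩
    refine ⟨⟨⟨fun z => Quotient.mk _ z.1, fun q => ⟨quotientSection hg q,
      quotientSection_mem hg q⟩, fun z => Subtype.ext ?_, mk_quotientSection hg⟩, ?_, ?_⟩,
      fun z => rfl⟩
    · exact sliceProjection_eq_self hg ((sliceMap_eq_one_iff hg).2 z.2)
    · exact hπ.comp hι.contMDiff
    · exact (ContMDiff.iff_comp_isImmersion hι.isImmersion).2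
        ⟨hs.isEmbedding.continuous.subtype_mk _, hs.contMDiff⟩
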